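/- **Setting.** Let $\mathcal X_1,\mathcal X_2,\mathcal S_0,\mathcal S_1,\mathcal S_2,\mathcal Y$ be finite sets, let $P_{S_0},P_{S_1},P_{S_2}$ be probability mass functions on $\mathcal S_0,\mathcal S_1,\mathcal S_2$, and let $P_{Y|X_1X_2S_0S_1S_2}$ be a channel with inputs in $\mathcal X_1,\mathcal X_2$, states in $\mathcal S_0,\mathcal S_1,\mathcal S_2$ and output in $\mathcal Y$. The channel is used without memory, and the triples $(S_{0,j},S_{1,j},S_{2,j})$, $j=1,2,\dots$, are i.i.d. with law $P_{S_0}P_{S_1}P_{S_2}$. Encoder 1 knows $(S_0^n,S_1^n)$ and encoder 2 knows $(S_0^n,S_2^n)$ non-causally, and each encoder learns the symbols sent by the other one strictly causally: a code of length $n$ and rates $R_1,R_2\ge 0$ consists of maps $$X_{1,j}=f_{1,j}(W_1,S_0^n,S_1^n,X_2^{j-1}),\qquad X_{2,j}=f_{2,j}(W_2,S_0^n,S_2^n,X_1^{j-1}),\qquad j=1,\dots,n,$$ and a decoder $(\hat W_1,\hat W_2)=g(Y^n)$, where the messages $W_1,W_2$ are independent and $W_i$ is uniform on a set of $\lceil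 2^{nR_i}\rceil$ elements. A pair $(R_1,R_2)$ with $R_1,R_2\ge0$ is achievable if there is a sequence of such codes, one for each length $n$, with $\Pr\{(\hat W_1,\hat W_2)\ne(W_1,W_2)\}\to0$ as $n\to\infty$. The capacity region is the closure of the set of achievable pairs. **Theorem.** Let $U,V_1,V_2$ be auxiliary random variables with finite alphabets $\mathcal U,\mathcal V_1,\mathcal V_2$ such that the joint law of $(S_0,S_1,S_2,U,V_1,V_2,X_1,X_2,Y)$ has the form $$P_{S_0}(s_0)P_{S_1}(s_1)P_{S_2}(s_2)\,P_{U|S_0}(u|s_0)\,P_{X_1V_1|US_0S_1}(x_1,v_1|u,s_0,s_1)\,P_{X_2V_2|US_0S_2}(x_2,v_2|u,s_0,s_2)\,P_{Y|X_1X_2S_0S_1S_2}(y|x_1,x_2,s_0,s_1,s_2).$$ Then every pair $(R_1,R_2)$ with $R_1,R_2\ge0$ and $$R_1\le I(X_1;V_1|U,S_0)-I(V_1;S_1|U,S_0),$$ $$R_2\le I(X_2;V_2|U,S_0)-I(V_2;S_2|U,S_0),$$ $$R_1+R_2\le I(Y;V_1,V_2,U)-I(U,V_1,V_2;S_0,S_1,S_2)$$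 (mutual informations in bits) belongs to the capacity region. In other words, the union of these sets of rate pairs, over all finite alphabets $\mathcal U,\mathcal V_1,\mathcal V_2$ and all joint laws of the above form, is contained in the capacity region. -/

import Mathlib

/-!
Two-user state-dependent discrete memoryless multiple-access channel with cooperating
(strictly causally cribbing) encoders and three independent states: `S₀`, known to both encoders,
`S₁`, known to encoder 1 only, and `S₂`, known to encoder 2 only (all non-causally).
-/

namespace CoopMAC

section Information

variable {Ω α β γ : Type*} [Fintype Ω]

open Classical in
/-- The probability mass function of the random variable `X : Ω → α` when the finite sample space
`Ω` carries the probability mass function `p`. -/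
noncomputable def law (p : Ω → ℝ) (X : Ω → α) (a : α) : ℝ :=
  ∑ ω with X ω = a, p ω

/-- Mutual information in bits, `I(X;Y) = E[log₂ (P(X,Y) / (P(X) P(Y)))]`. Outcomes with `p ω = 0`
contribute `0`; at all others each probability in the fraction is positive. -/
noncomputable def mutualInfo (p : Ω → ℝ) (X : Ω → α) (Y : Ω → β) : ℝ :=
  ∑ ω, p ω * Real.logb 2
    (law p (fun ω' => (X ω', Y ω')) (X ω, Y ω) / (law p X (X ω) * law p Y (Y ω)))

/-- Conditional mutual information in bits,
`I(X;Y|Z) = E[log₂ (P(X,Y|Z) / (P(X|Z) P(Y|Z)))]`. -/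
noncomputable def condMutualInfo (p : Ω → ℝ) (X : Ω → α) (Y : Ω → β) (Z : Ω → γ) : ℝ :=
  ∑ ω, p ω * Real.logb 2
    ((law p (fun ω' => (X ω', Y ω', Z ω')) (X ω, Y ω, Z ω) / law p Z (Z ω)) /
      ((law p (fun ω' => (X ω', Z ω')) (X ω, Z ω) / law p Z (Z ω)) *
        (law p (fun ω' => (Y ω', Z ω')) (Y ω, Z ω) / law p Z (Z ω))))

end Information

/-- The channel: probability mass functions of three independent states, and for each pair of
inputs and each triple of states a probability mass function `W x₁ x₂ s₀ s₁ s₂` of the output. -/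
structure Channel (𝒳₁ 𝒳₂ 𝒮₀ 𝒮₁ 𝒮₂ 𝒴 : Type*) [Fintype 𝒮₀] [Fintype 𝒮₁] [Fintype 𝒮₂]
    [Fintype 𝒴] where
  P₀ : 𝒮₀ → ℝ
  P₁ : 𝒮₁ → ℝ
  P₂ : 𝒮₂ → ℝ
  W : 𝒳₁ → 𝒳₂ → 𝒮₀ → 𝒮₁ → 𝒮₂ → 𝒴 → ℝ
  P₀_mem : P₀ ∈ stdSimplex ℝ 𝒮₀
  P₁_mem : P₁ ∈ stdSimplex ℝ 𝒮₁
  P₂_mem : P₂ ∈ stdSimplex ℝ 𝒮₂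
  W_mem : ∀ x₁ x₂ s₀ s₁ s₂, W x₁ x₂ s₀ s₁ s₂ ∈ stdSimplex ℝ 𝒴

/-- A code of length `n` with `M₁` and `M₂` messages. The symbol sent by an encoder at time `j`
depends on its message, on the whole state sequences that it knows, and on the symbols that the
other encoder sent at the times before `j`. -/
structure Code (𝒳₁ 𝒳₂ 𝒮₀ 𝒮₁ 𝒮₂ 𝒴 : Type*) (n M₁ M₂ : ℕ) where
  f₁ : (j : Fin n) → Fin M₁ → (Fin n → 𝒮₀) → (Fin n → 𝒮₁) → (Fin (j : ℕ) → 𝒳₂) → 𝒳₁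
  f₂ : (j : Fin n) → Fin M₂ → (Fin n → 𝒮₀) → (Fin n → 𝒮₂) → (Fin (j : ℕ) → 𝒳₁) → 𝒳₂
  g : (Fin n → 𝒴) → Fin M₁ × Fin M₂

section Coding

variable {𝒳₁ 𝒳₂ 𝒮₀ 𝒮₁ 𝒮₂ 𝒴 : Type*}

/-- The pair of channel inputs at time `j`: `X₁ⱼ = f₁ⱼ(w₁, s₀ⁿ, s₁ⁿ, X₂ʲ⁻¹)` and
`X₂ⱼ = f₂ⱼ(w₂, s₀ⁿ, s₂ⁿ, X₁ʲ⁻¹)`, by recursion on `j`. -/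
def Code.inputs {n M₁ M₂ : ℕ} (c : Code 𝒳₁ 𝒳₂ 𝒮₀ 𝒮₁ 𝒮₂ 𝒴 n M₁ M₂) (w₁ : Fin M₁) (w₂ : Fin M₂)
    (s₀ : Fin n → 𝒮₀) (s₁ : Fin n → 𝒮₁) (s₂ : Fin n → 𝒮₂) (j : Fin n) : 𝒳₁ × 𝒳₂ :=
  (c.f₁ j w₁ s₀ s₁ fun i => (c.inputs w₁ w₂ s₀ s₁ s₂ ⟨i, i.isLt.trans j.isLt⟩).2,
    c.f₂ j w₂ s₀ s₂ fun i => (c.inputs w₁ w₂ s₀ s₁ s₂ ⟨i, i.isLt.trans j.isLt⟩).1)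
termination_by (j : ℕ)
decreasing_by all_goals exact i.isLt

variable [Fintype 𝒮₀] [Fintype 𝒮₁] [Fintype 𝒮₂] [Fintype 𝒴]

open Classical in
/-- The probability that the decoder errs when `(w₁, w₂)` is sent: the states are i.i.d. in time
and the channel is memoryless. -/
noncomputable def errorProbGiven (ch : Channel 𝒳₁ 𝒳₂ 𝒮₀ 𝒮₁ 𝒮₂ 𝒴) {n M₁ M₂ : ℕ}
    (c : Code 𝒳₁ 𝒳₂ 𝒮₀ 𝒮₁ 𝒮₂ 𝒴 n M₁ M₂) (w₁ : Fin M₁) (w₂ : Fin M₂) : ℝ :=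
  ∑ s₀ : Fin n → 𝒮₀, ∑ s₁ : Fin n → 𝒮₁, ∑ s₂ : Fin n → 𝒮₂,
    (∏ j, ch.P₀ (s₀ j) * ch.P₁ (s₁ j) * ch.P₂ (s₂ j)) *
      ∑ y : Fin n → 𝒴 with c.g y ≠ (w₁, w₂),
        ∏ j, ch.W (c.inputs w₁ w₂ s₀ s₁ s₂ j).1 (c.inputs w₁ w₂ s₀ s₁ s₂ j).2
          (s₀ j) (s₁ j) (s₂ j) (y j)

/-- The average error probability for independent, uniformly distributed messages. -/
noncomputable def avgErrorProb (ch : Channel 𝒳₁ 𝒳₂ 𝒮₀ 𝒮₁ 𝒮₂ 𝒴) {n M₁ M₂ : ℕ}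
    (c : Code 𝒳₁ 𝒳₂ 𝒮₀ 𝒮₁ 𝒮₂ 𝒴 n M₁ M₂) : ℝ :=
  (1 / ((M₁ : ℝ) * (M₂ : ℝ))) * ∑ w₁ : Fin M₁, ∑ w₂ : Fin M₂, errorProbGiven ch c w₁ w₂

/-- The number of messages of a code of length `n` and rate `R` (bits per channel use):
`2 ^ (n R)`, rounded up. -/
noncomputable def numMessages (n : ℕ) (R : ℝ) : ℕ :=
  ⌈(2 : ℝ) ^ ((n : ℝ) * R)⌉₊

/-- A pair of rates is achievable if some sequence of codes with these rates, one of each length,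
has average error probability tending to `0`. -/
def Achievable (ch : Channel 𝒳₁ 𝒳₂ 𝒮₀ 𝒮₁ 𝒮₂ 𝒴) (R : ℝ × ℝ) : Prop :=
  0 ≤ R.1 ∧ 0 ≤ R.2 ∧
    ∃ c : ∀ n : ℕ, Code 𝒳₁ 𝒳₂ 𝒮₀ 𝒮₁ 𝒮₂ 𝒴 n (numMessages n R.1) (numMessages n R.2),
      Filter.Tendsto (fun n => avgErrorProb ch (c n)) Filter.atTop (nhds 0)

/-- The capacity region: the closure of the set of achievable pairs. -/
def capacityRegion (ch : Channel 𝒳₁ 𝒳₂ 𝒮₀ 𝒮₁ 𝒮₂ 𝒴) : Set (ℝ × ℝ) :=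
  closure {R | Achievable ch R}

end Coding

/-- The freely chosen factors of the joint distribution: `P(u|s₀)`, `P(x₁,v₁|u,s₀,s₁)` and
`P(x₂,v₂|u,s₀,s₂)`. -/
structure AuxLaws (𝒳₁ 𝒳₂ 𝒮₀ 𝒮₁ 𝒮₂ 𝒰 𝒱₁ 𝒱₂ : Type*) [Fintype 𝒳₁] [Fintype 𝒳₂]
    [Fintype 𝒰] [Fintype 𝒱₁] [Fintype 𝒱₂] where
  PU : 𝒮₀ → 𝒰 → ℝ
  Q₁ : 𝒰 → 𝒮₀ → 𝒮₁ → 𝒳₁ × 𝒱₁ → ℝ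
  Q₂ : 𝒰 → 𝒮₀ → 𝒮₂ → 𝒳₂ × 𝒱₂ → ℝ
  PU_mem : ∀ s₀, PU s₀ ∈ stdSimplex ℝ 𝒰
  Q₁_mem : ∀ u s₀ s₁, Q₁ u s₀ s₁ ∈ stdSimplex ℝ (𝒳₁ × 𝒱₁)
  Q₂_mem : ∀ u s₀ s₂, Q₂ u s₀ s₂ ∈ stdSimplex ℝ (𝒳₂ × 𝒱₂)

section Region

variable {𝒳₁ 𝒳₂ 𝒮₀ 𝒮₁ 𝒮₂ 𝒴 : Type*} [Fintype 𝒳₁] [Fintype 𝒳₂]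
  [Fintype 𝒮₀] [Fintype 𝒮₁] [Fintype 𝒮₂] [Fintype 𝒴]

/-- The joint probability mass function of `(S₀, S₁, S₂, U, V₁, V₂, X₁, X₂, Y)`. -/
def jointLaw {𝒰 𝒱₁ 𝒱₂ : Type*} [Fintype 𝒰] [Fintype 𝒱₁] [Fintype 𝒱₂]
    (ch : Channel 𝒳₁ 𝒳₂ 𝒮₀ 𝒮₁ 𝒮₂ 𝒴) (a : AuxLaws 𝒳₁ 𝒳₂ 𝒮₀ 𝒮₁ 𝒮₂ 𝒰 𝒱₁ 𝒱₂) :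
    𝒮₀ × 𝒮₁ × 𝒮₂ × 𝒰 × 𝒱₁ × 𝒱₂ × 𝒳₁ × 𝒳₂ × 𝒴 → ℝ :=
  fun (s₀, s₁, s₂, u, v₁, v₂, x₁, x₂, y) =>
    ch.P₀ s₀ * ch.P₁ s₁ * ch.P₂ s₂ * a.PU s₀ u * a.Q₁ u s₀ s₁ (x₁, v₁) * a.Q₂ u s₀ s₂ (x₂, v₂) *
      ch.W x₁ x₂ s₀ s₁ s₂ y

/-- The pairs of rates that satisfy the three inequalities for one joint distribution. -/
def ratesFor {𝒰 𝒱₁ 𝒱₂ : Type*} [Fintype 𝒰] [Fintype 𝒱₁] [Fintype 𝒱₂]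
    (ch : Channel 𝒳₁ 𝒳₂ 𝒮₀ 𝒮₁ 𝒮₂ 𝒴) (a : AuxLaws 𝒳₁ 𝒳₂ 𝒮₀ 𝒮₁ 𝒮₂ 𝒰 𝒱₁ 𝒱₂) : Set (ℝ × ℝ) :=
  {R | 0 ≤ R.1 ∧ 0 ≤ R.2 ∧
    -- `R₁ ≤ I(X₁;V₁|U,S₀) - I(V₁;S₁|U,S₀)`
    R.1 ≤ condMutualInfo (jointLaw ch a)
            (fun (_, _, _, _, _, _, x₁, _, _) => x₁) (fun (_, _, _, _, v₁, _, _, _, _) => v₁)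
            (fun (s₀, _, _, u, _, _, _, _, _) => (u, s₀))
        - condMutualInfo (jointLaw ch a)
            (fun (_, _, _, _, v₁, _, _, _, _) => v₁) (fun (_, s₁, _, _, _, _, _, _, _) => s₁)
            (fun (s₀, _, _, u, _, _, _, _, _) => (u, s₀)) ∧
    -- `R₂ ≤ I(X₂;V₂|U,S₀) - I(V₂;S₂|U,S₀)`
    R.2 ≤ condMutualInfo (jointLaw ch a)
            (fun (_, _, _, _, _, _, _, x₂, _) => x₂) (fun (_, _, _, _, _, v₂, _, _, _) => v₂)
            (fun (s₀, _, _, u, _, _, _, _, _) => (u, s₀))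
        - condMutualInfo (jointLaw ch a)
            (fun (_, _, _, _, _, v₂, _, _, _) => v₂) (fun (_, _, s₂, _, _, _, _, _, _) => s₂)
            (fun (s₀, _, _, u, _, _, _, _, _) => (u, s₀)) ∧
    -- `R₁ + R₂ ≤ I(Y;V₁,V₂,U) - I(U,V₁,V₂;S₀,S₁,S₂)`
    R.1 + R.2 ≤ mutualInfo (jointLaw ch a)
            (fun (_, _, _, _, _, _, _, _, y) => y)
            (fun (_, _, _, u, v₁, v₂, _, _, _) => (v₁, v₂, u))
        - mutualInfo (jointLaw ch a)
            (fun (_, _, _, u, v₁, v₂, _, _, _) => (u, v₁, v₂))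
            (fun (s₀, s₁, s₂, _, _, _, _, _, _) => (s₀, s₁, s₂))}

/-- The rate region: the union of `ratesFor ch a` over all finite alphabets of the auxiliary random
variables and all laws on them. -/
def rateRegion (ch : Channel 𝒳₁ 𝒳₂ 𝒮₀ 𝒮₁ 𝒮₂ 𝒴) : Set (ℝ × ℝ) :=
  {R | ∃ (𝒰 𝒱₁ 𝒱₂ : Type) (_ : Fintype 𝒰) (_ : Fintype 𝒱₁) (_ : Fintype 𝒱₂)
    (a : AuxLaws 𝒳₁ 𝒳₂ 𝒮₀ 𝒮₁ 𝒮₂ 𝒰 𝒱₁ 𝒱₂), R ∈ ratesFor ch a}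

end Region

end CoopMAC

/-!
Achievability for the multiple-access channel with strictly causally cribbing encoders and three
states.

The time axis is cut into `N + 1` blocks of length `m`. In block `b` both encoders know the
messages of the preceding block, since each has learned all symbols that the other one sent there;
these messages and `S₀` select a common word `u`. Each encoder then picks, from a list that belongs
to its fresh message, a codeword `vᵢ` that fits its states, and sends `xᵢ`. After the block the
other encoder recovers the fresh message from `xᵢ`, `u`, `s₀`. The receiver decodes backwards: once
it knows the fresh messages of a block, `Y` reveals the messages of the block before. Losing one
block of `N + 1` costs a vanishing part of the rate. This part is `markovCode` and
`errorProbGiven_markovCode_le`, which bounds the error by the sum of the errors of the blocks.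

For a single block, used with super-letters, `exists_blockCode_le` is a one-shot bound that needs
no typical sequences. All codewords are drawn uniformly, and the encoders would ideally select index
and symbol at random with weights proportional to the wanted conditional law. These weights sum up
to `1` only on average, but lists that are long enough make the sum concentrate (soft covering,
`expect_abs_one_sub_le`). Averaged over the codebook the selected words have exactly the wanted
joint law (`expect_ideal_true`), while every wrong codeword is uniform and independent, so that it
passes a threshold test with small probability (`Tests`, `expect_ideal_other`). A random choice that
depends on a key is replaced by the one that minimizes the total error over all occurrences of the
key, at the price of the defect of the weights (`exists_choice_le`). This also makes the
code good on average over all pairs of consecutive messages at once.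

For blocks of length `m` all quantities are products, and Chebyshev's inequality turns the one-shot
bound into inequalities between expected logarithms (`eventually_exists_blockCode`). With the
conditional probabilities of the codewords as tests (`likelihoods`), the differences of these
expectations are exactly the differences of mutual informations in the theorem
(`condMutualInfo_sub_eq₁`, `condMutualInfo_sub_eq₂`, `mutualInfo_sub_eq`). The proof needs strict
inequalities unless a rate is `0`; scaling a pair by `θ < 1` provides them, and the closure takes
care of the limit `θ → 1`.
-/

open Finset Function Filter Topology
open scoped BigOperators

namespace CoopMAC

set_option linter.unusedSectionVars false

/-! ### Finite averages -/

section Indicator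

open Classical in
/-- The indicator of a proposition, as a real number. -/
noncomputable def ind (p : Prop) : ℝ := if p then 1 else 0

theorem ind_of {p : Prop} (h : p) : ind p = 1 := if_pos h

theorem ind_of_not {p : Prop} (h : ¬p) : ind p = 0 := if_neg h

theorem ind_nonneg (p : Prop) : 0 ≤ ind p := by
  by_cases h : p <;> simp [ind, h]

theorem ind_le_one (p : Prop) : ind p ≤ 1 := by
  by_cases h : p <;> simp [ind, h]

theorem ind_mono {p q : Prop} (h : p → q) : ind p ≤ ind q := by
  by_cases hp : p
  · rw [ind_of hp, ind_of (h hp)]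
  · rw [ind_of_not hp]; exact ind_nonneg q

theorem ind_or_le (p q : Prop) : ind (p ∨ q) ≤ ind p + ind q := by
  by_cases hp : p <;> by_cases hq : q <;> simp [ind, hp, hq]

theorem ind_exists_le {ι : Type*} [Fintype ι] (p : ι → Prop) :
    ind (∃ i, p i) ≤ ∑ i, ind (p i) := by
  by_cases h : ∃ i, p i
  · obtain ⟨i, hi⟩ := h
    rw [ind_of ⟨i, hi⟩, ← ind_of hi]
    exact single_le_sum (f := fun i => ind (p i)) (fun j _ => ind_nonneg _) (mem_univ i)
  · rw [ind_of_not h]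
    exact sum_nonneg fun j _ => ind_nonneg _

/-- Markov's inequality for one value. -/
theorem ind_lt_le_div {x t : ℝ} (hx : 0 ≤ x) (ht : 0 < t) : ind (t < x) ≤ x / t := by
  by_cases h : t < x
  · rw [ind_of h, le_div_iff₀ ht]; linarith
  · rw [ind_of_not h]; positivity

end Indicator

section Expect

variable {ι α β : Type*} [Fintype ι] [Fintype α] [Fintype β]

/-- Markov's inequality for a uniform average in which `F` has total mass at most `1`. -/
theorem expect_ind_lt_le {F : α → ℝ} (hF : ∀ x, 0 ≤ F x) (hsum : ∑ x, F x ≤ 1) {t : ℝ}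
    (ht : 0 < t) : 𝔼 x, ind (t < F x) ≤ 1 / (Fintype.card α * t) := by
  calc 𝔼 x, ind (t < F x) ≤ 𝔼 x, F x / t :=
        expect_le_expect fun x _ => ind_lt_le_div (hF x) ht
    _ = (∑ x, F x) / (Fintype.card α * t) := by
        rw [← expect_div, Fintype.expect_eq_sum_div_card, div_div]
    _ ≤ 1 / (Fintype.card α * t) := by gcongr

theorem exists_le_of_expect_le [Nonempty α] {F : α → ℝ} {c : ℝ} (h : 𝔼 x, F x ≤ c) :
    ∃ x, F x ≤ c := by
  by_contra! hc
  have : c < 𝔼 x, F x :=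
    lt_expect (fun x _ => (hc x).le) ⟨Classical.arbitrary α, mem_univ _, hc _⟩
  linarith

theorem abs_expect_le_sqrt (F : α → ℝ) : 𝔼 x, |F x| ≤ √(𝔼 x, F x ^ 2) := by
  apply Real.le_sqrt_of_sq_le
  rcases isEmpty_or_nonempty α with h | h
  · simp
  have hc : (0 : ℝ) < Fintype.card α := by exact_mod_cast Fintype.card_pos
  rw [Fintype.expect_eq_sum_div_card, Fintype.expect_eq_sum_div_card, div_pow,
    div_le_div_iff₀ (by positivity) hc]
  have := sq_sum_le_card_mul_sum_sq (s := univ) (f := fun x => |F x|)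
  simp only [sq_abs, card_univ] at this
  nlinarith

theorem expect_prod (G : α × β → ℝ) : 𝔼 z, G z = 𝔼 x, 𝔼 y, G (x, y) := by
  rw [← expect_product', univ_product_univ]

/-- Swaps the value of a function at `i` with a spare value. -/
def swapAt [DecidableEq ι] (i : ι) : (ι → α) × α ≃ (ι → α) × α :=
  Involutive.toPerm (fun z => (update z.1 i z.2, z.1 i)) fun z => by
    ext <;> simp

/-- Under the uniform law on functions, resampling the value at `i` changes no average. -/
theorem expect_update [DecidableEq ι] [Nonempty α] (i : ι) (G : (ι → α) → ℝ) :
    𝔼 f, G f = 𝔼 f, 𝔼 x, G (update f i x) := by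
  have h := Fintype.expect_equiv (swapAt i) (fun z : (ι → α) × α => G (update z.1 i z.2))
    (fun z => G z.1) fun z => rfl
  rw [expect_prod, expect_prod] at h
  simp only [Fintype.expect_const] at h
  exact h.symm

theorem expect_apply_eq [DecidableEq ι] [Nonempty α] (i : ι) (G : α → ℝ) :
    𝔼 f : ι → α, G (f i) = 𝔼 x, G x := by
  rw [expect_update i]
  simp

theorem expect_apply_apply [DecidableEq ι] [Nonempty α] {i j : ι} (hij : i ≠ j)
    (G : α → α → ℝ) : 𝔼 f : ι → α, G (f i) (f j) = 𝔼 x, 𝔼 y, G x y := by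
  rw [expect_update i]
  simp only [update_self, update_of_ne hij.symm]
  rw [expect_comm]
  refine expect_congr rfl fun x _ => expect_apply_eq j (G x)

/-- The second moment of an average of pairwise independent terms of mean `0`. -/
theorem expect_sum_sq [DecidableEq ι] [Nonempty α] {L : ℕ} {e : Fin L → ι}
    (he : Injective e) {g : α → ℝ} (hg : 𝔼 x, g x = 0) :
    𝔼 f : ι → α, (∑ l, g (f (e l))) ^ 2 = L * 𝔼 x, g x ^ 2 := by
  have key : ∀ l l' : Fin L, 𝔼 f : ι → α, g (f (e l)) * g (f (e l'))
      = if l = l' then 𝔼 x, g x ^ 2 else 0 := by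
    intro l l'
    split_ifs with h
    · subst h
      simp only [← sq]
      exact expect_apply_eq (e l) fun x => g x ^ 2
    · rw [expect_apply_apply (fun h' => h (he h')) fun x y => g x * g y]
      simp [← mul_expect, hg]
  simp only [sq (∑ l, g _), sum_mul_sum]
  rw [expect_sum_comm]
  simp only [expect_sum_comm, key]
  simp

/-- One-shot soft covering: the average of `L` independent copies of a nonnegative variable of
mean `1` is close to `1` in mean, up to the part of the variable above a threshold `T`. -/
theorem expect_abs_one_sub_le [DecidableEq ι] [Nonempty α] {L : ℕ} (hL : 0 < L) {e : Fin L → ι}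
    (he : Injective e) {h : α → ℝ} (h0 : ∀ x, 0 ≤ h x) (h1 : 𝔼 x, h x = 1) {T : ℝ} (hT : 0 ≤ T) :
    𝔼 f : ι → α, |1 - (∑ l, h (f (e l))) / L|
      ≤ 2 * 𝔼 x, h x * ind (T < h x) + √(T / L) := by
  have hL' : (0 : ℝ) < L := by exact_mod_cast hL
  -- `b` is the part of `h` above the threshold, `s` the part below, `c` its mean
  set b : α → ℝ := fun x => h x * ind (T < h x) with hb
  set s : α → ℝ := fun x => h x - b x with hs
  set c : ℝ := 𝔼 x, s x with hc
  have hb0 : ∀ x, 0 ≤ b x := fun x => mul_nonneg (h0 x) (ind_nonneg _)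
  have hs0 : ∀ x, 0 ≤ s x := fun x => by
    have := mul_le_mul_of_nonneg_left (ind_le_one (T < h x)) (h0 x)
    simp only [hs, hb]; linarith
  have hsT : ∀ x, s x ≤ T := fun x => by
    by_cases hx : T < h x
    · simp [hs, hb, ind_of hx, hT]
    · simp only [hs, hb, ind_of_not hx]; linarith
  have hsh : ∀ x, s x ≤ h x := fun x => by simp only [hs]; linarith [hb0 x]
  have hc1 : c = 1 - 𝔼 x, b x := by
    rw [hc, ← h1, ← expect_sub_distrib]
  have hg : 𝔼 x, (s x - c) = 0 := by
    rw [expect_sub_distrib, Fintype.expect_const, hc, sub_self]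
  have hvar : 𝔼 x, (s x - c) ^ 2 ≤ T := by
    have h2 : 𝔼 x, (s x - c) ^ 2 = 𝔼 x, s x ^ 2 - c ^ 2 := by
      have : ∀ x, (s x - c) ^ 2 = s x ^ 2 - 2 * c * s x + c ^ 2 := fun x => by ring
      simp only [this]
      rw [expect_add_distrib, expect_sub_distrib, Fintype.expect_const, ← mul_expect, ← hc]
      ring
    have h3 : 𝔼 x, s x ^ 2 ≤ 𝔼 x, T * h x := expect_le_expect fun x _ => by
      rw [sq]; exact mul_le_mul (hsT x) (hsh x) (hs0 x) hT
    rw [← mul_expect, h1] at h3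
    nlinarith [sq_nonneg c]
  have hpt : ∀ f : ι → α, |1 - (∑ l, h (f (e l))) / L|
      ≤ |(∑ l, (s (f (e l)) - c)) / L| + (1 - c) + (∑ l, b (f (e l))) / L := by
    intro f
    have e1 : 1 - (∑ l, h (f (e l))) / L
        = -((∑ l, (s (f (e l)) - c)) / L) + (1 - c) - (∑ l, b (f (e l))) / L := by
      have : ∑ l, h (f (e l)) = ∑ l, (s (f (e l)) - c) + L * c + ∑ l, b (f (e l)) := by
        simp only [hs, sum_sub_distrib, sum_const, card_univ, Fintype.card_fin, nsmul_eq_mul]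
        ring
      rw [this]; field_simp; ring
    have hc0 : 0 ≤ 1 - c := by
      rw [hc1]; simpa using expect_nonneg fun x _ => hb0 x
    have hB : 0 ≤ (∑ l, b (f (e l))) / L := div_nonneg (sum_nonneg fun l _ => hb0 _) hL'.le
    rw [e1]
    have a1 := abs_sub (-((∑ l, (s (f (e l)) - c)) / L) + (1 - c)) ((∑ l, b (f (e l))) / L)
    have a2 := abs_add_le (-((∑ l, (s (f (e l)) - c)) / L)) (1 - c)
    rw [abs_neg, abs_of_nonneg hc0] at a2
    rw [abs_of_nonneg hB] at a1
    linarith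
  refine (expect_le_expect fun f _ => hpt f).trans ?_
  rw [expect_add_distrib, expect_add_distrib, Fintype.expect_const]
  have t1 : 𝔼 f : ι → α, |(∑ l, (s (f (e l)) - c)) / L| ≤ √(T / L) := by
    refine (abs_expect_le_sqrt _).trans (Real.sqrt_le_sqrt ?_)
    simp only [div_pow, ← expect_div]
    rw [expect_sum_sq he hg, div_le_div_iff₀ (by positivity) hL']
    nlinarith [mul_le_mul_of_nonneg_left hvar (sq_nonneg (L : ℝ))]
  have t2 : 𝔼 f : ι → α, (∑ l, b (f (e l))) / L = 𝔼 x, b x := by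
    rw [← expect_div, expect_sum_comm]
    simp only [expect_apply_eq (α := α) _ b]
    simp only [sum_const, card_univ, Fintype.card_fin, nsmul_eq_mul]
    field_simp
  rw [t2]
  linarith

end Expect

section Weighted

variable {ι α : Type*} [Fintype ι] [DecidableEq ι] [Fintype α]

theorem sum_pi_prod_eq_one {p : ι → α → ℝ} (hp : ∀ i, ∑ x, p i x = 1) :
    ∑ f : ι → α, ∏ i, p i (f i) = 1 := by
  rw [← Fintype.prod_sum]
  simp [hp]

/-- Under a product law on functions, resampling the value at `i` changes no average. -/
theorem sum_pi_update {p : ι → α → ℝ} (i : ι) (hp : ∑ x, p i x = 1) (G : (ι → α) → ℝ) :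
    ∑ f : ι → α, (∏ j, p j (f j)) * G f
      = ∑ f : ι → α, (∏ j, p j (f j)) * ∑ x, p i x * G (update f i x) := by
  have h := Fintype.sum_equiv (swapAt (α := α) i)
    (fun z : (ι → α) × α => (∏ j, p j (z.1 j)) * (p i z.2 * G (update z.1 i z.2)))
    (fun z => (∏ j, p j (z.1 j)) * (p i z.2 * G z.1)) fun z => by
      have e : (∏ j, p j (z.1 j)) * p i z.2 = (∏ j, p j (update z.1 i z.2 j)) * p i (z.1 i) := by
        rw [← mul_prod_erase univ _ (mem_univ i), ← mul_prod_erase univ _ (mem_univ i),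
          update_self]
        have : ∏ j ∈ univ.erase i, p j (update z.1 i z.2 j) = ∏ j ∈ univ.erase i, p j (z.1 j) :=
          prod_congr rfl fun j hj => by rw [update_of_ne (ne_of_mem_erase hj)]
        rw [this]; ring
      change _ = (∏ j, p j (update z.1 i z.2 j)) * (p i (z.1 i) * G (update z.1 i z.2))
      rw [← mul_assoc, ← mul_assoc, e]
  rw [Fintype.sum_prod_type, Fintype.sum_prod_type] at h
  simp only [← mul_sum, ← sum_mul, hp, one_mul] at h
  exact h.symm

theorem sum_pi_apply {p : ι → α → ℝ} (hp : ∀ i, ∑ x, p i x = 1) (i : ι) (G : α → ℝ) :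
    ∑ f : ι → α, (∏ j, p j (f j)) * G (f i) = ∑ x, p i x * G x := by
  rw [sum_pi_update i (hp i)]
  simp only [update_self]
  rw [← sum_mul, sum_pi_prod_eq_one hp, one_mul]

/-- The variance of a sum of independent and identically distributed terms of mean `0`. -/
theorem sum_pi_sum_sq {p g : α → ℝ} (hp : ∑ x, p x = 1) (hg : ∑ x, p x * g x = 0) :
    ∑ f : ι → α, (∏ j, p (f j)) * (∑ i, g (f i)) ^ 2
      = Fintype.card ι * ∑ x, p x * g x ^ 2 := by
  have key : ∀ i k : ι, ∑ f : ι → α, (∏ j, p (f j)) * (g (f i) * g (f k))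
      = if i = k then ∑ x, p x * g x ^ 2 else 0 := by
    intro i k
    split_ifs with h
    · subst h
      simp only [← sq]
      exact sum_pi_apply (p := fun _ => p) (fun _ => hp) i fun x => g x ^ 2
    · rw [sum_pi_update (p := fun _ => p) i hp]
      simp only [update_self, update_of_ne (Ne.symm h), ← mul_assoc, ← sum_mul, hg]
      simp
  simp only [sq (∑ i, g _), sum_mul_sum]
  simp only [mul_sum]
  rw [sum_comm]
  simp only [sum_comm (s := (univ : Finset (ι → α))), key]
  simp [mul_sum]

end Weighted

/-- A randomized choice can be replaced by a deterministic one. For every key `k` the weights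
`ω k` on the options need not be normalized, and the price is the distance of their sum from `1`. -/
theorem exists_choice_le {T Key I : Type*} [Fintype T] [Fintype I] [Nonempty I]
    (key : T → Key) {ω : Key → I → ℝ} (hω : ∀ k i, 0 ≤ ω k i) {c : T → ℝ} (hc : ∀ t, 0 ≤ c t)
    {F : T → I → ℝ} (hF0 : ∀ t i, 0 ≤ F t i) (hF1 : ∀ t i, F t i ≤ 1) :
    ∃ φ : Key → I, ∑ t, c t * F t (φ (key t))
      ≤ ∑ t, c t * |1 - ∑ i, ω (key t) i| + ∑ t, c t * ∑ i, ω (key t) i * F t i := by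
  classical
  -- on each fibre of `key` the choice minimizes the total cost of the fibre
  have hmin : ∀ k : Key, ∃ i₀ : I, ∀ i, ∑ t with key t = k, c t * F t i₀
      ≤ ∑ t with key t = k, c t * F t i := fun k => by
    obtain ⟨i₀, hi₀⟩ := Finite.exists_min fun i => ∑ t with key t = k, c t * F t i
    exact ⟨i₀, hi₀⟩
  choose φ hφ using hmin
  refine ⟨φ, ?_⟩
  have fib : ∀ H : T → ℝ, ∑ t, H t = ∑ k ∈ univ.image key, ∑ t with key t = k, H t := fun H =>
    (sum_fiberwise_of_maps_to (fun t _ => mem_image_of_mem key (mem_univ t)) H).symm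
  rw [← sum_add_distrib, fib, fib fun t => _ + _]
  refine sum_le_sum fun k _ => ?_
  have e1 : ∑ t with key t = k, c t * F t (φ (key t)) = ∑ t with key t = k, c t * F t (φ k) :=
    sum_congr rfl fun t ht => by rw [(mem_filter.1 ht).2]
  have e2 : ∑ t with key t = k, (c t * |1 - ∑ i, ω (key t) i| + c t * ∑ i, ω (key t) i * F t i)
      = (∑ t with key t = k, c t) * |1 - ∑ i, ω k i|
        + ∑ i, ω k i * ∑ t with key t = k, c t * F t i := by
    have : ∑ i, ω k i * ∑ t with key t = k, c t * F t i
        = ∑ t with key t = k, c t * ∑ i, ω k i * F t i := by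
      simp only [mul_sum]
      rw [sum_comm]
      exact sum_congr rfl fun t _ => sum_congr rfl fun i _ => by ring
    rw [this, sum_mul, ← sum_add_distrib]
    exact sum_congr rfl fun t ht => by rw [(mem_filter.1 ht).2]
  rw [e1, e2]
  set m := ∑ t with key t = k, c t * F t (φ k)
  have hm0 : 0 ≤ m := sum_nonneg fun t _ => mul_nonneg (hc t) (hF0 t _)
  have hm1 : m ≤ ∑ t with key t = k, c t := sum_le_sum fun t _ =>
    mul_le_of_le_one_right (hc t) (hF1 t _)
  have h1 : (∑ i, ω k i) * m ≤ ∑ i, ω k i * ∑ t with key t = k, c t * F t i := by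
    rw [sum_mul]
    exact sum_le_sum fun i _ => mul_le_mul_of_nonneg_left (hφ k i) (hω k i)
  have h2 : m * (1 - ∑ i, ω k i) ≤ (∑ t with key t = k, c t) * |1 - ∑ i, ω k i| :=
    (mul_le_mul_of_nonneg_left (le_abs_self _) hm0).trans
      (mul_le_mul_of_nonneg_right hm1 (abs_nonneg _))
  linarith

/-! ### Selecting a codeword -/

section Pick

variable {K V X : Type*} [Fintype K] [DecidableEq K] [Fintype V] [Fintype X] {L : ℕ}

/-- The weight with which an encoder with message `w` and codewords `f (w, l)` selects the index
`i.1` and sends the symbol `i.2`. Here `q` is the wanted law of the pair of symbol and codeword,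
and the codewords are drawn uniformly, so that these weights sum up to `1` only on average. -/
noncomputable def pickWeight (q : X × V → ℝ) (f : K × Fin L → V) (w : K) (i : Fin L × X) : ℝ :=
  Fintype.card V / L * q (i.2, f (w, i.1))

theorem pickWeight_nonneg {q : X × V → ℝ} (hq : ∀ z, 0 ≤ q z) (f : K × Fin L → V) (w : K)
    (i : Fin L × X) : 0 ≤ pickWeight q f w i :=
  mul_nonneg (by positivity) (hq _)

variable [Nonempty V]

theorem expect_pickWeight (hL : 0 < L) (q : X × V → ℝ) (w : K) (H : X → V → ℝ) :
    𝔼 f : K × Fin L → V, ∑ i, pickWeight q f w i * H i.2 (f (w, i.1))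
      = ∑ z, q z * H z.1 z.2 := by
  have hL' : (L : ℝ) ≠ 0 := by exact_mod_cast hL.ne'
  have hV : (Fintype.card V : ℝ) ≠ 0 := by exact_mod_cast Fintype.card_ne_zero
  rw [expect_sum_comm]
  have : ∀ i : Fin L × X, 𝔼 f : K × Fin L → V, pickWeight q f w i * H i.2 (f (w, i.1))
      = (∑ v, q (i.2, v) * H i.2 v) / L := fun i => by
    simp only [pickWeight]
    rw [expect_apply_eq (w, i.1) fun v => (Fintype.card V : ℝ) / L * q (i.2, v) * H i.2 v,
      Fintype.expect_eq_sum_div_card]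
    simp only [mul_assoc, ← mul_sum]
    field_simp
  simp only [this]
  rw [Fintype.sum_prod_type, Fintype.sum_prod_type]
  simp only [← sum_div, sum_const, card_univ, Fintype.card_fin, nsmul_eq_mul]
  field_simp

theorem expect_sum_pickWeight (hL : 0 < L) (q : X × V → ℝ) (w : K) :
    𝔼 f : K × Fin L → V, ∑ i, pickWeight q f w i = ∑ z, q z := by
  simpa using expect_pickWeight hL q w fun _ _ => 1

/-- A codeword of another message passes a test `τ < β x ·` with small probability. -/
theorem expect_pickWeight_other_le (hL : 0 < L) {q : X × V → ℝ} (hq : ∀ z, 0 ≤ q z)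
    (hq1 : ∑ z, q z = 1) {w w' : K} (hw : w' ≠ w) (l' : Fin L) {β : X → V → ℝ}
    (hβ : ∀ x v, 0 ≤ β x v) (hβ1 : ∀ x, ∑ v, β x v ≤ 1) {τ : ℝ} (hτ : 0 < τ) :
    𝔼 f : K × Fin L → V, ∑ i, pickWeight q f w i * ind (τ < β i.2 (f (w', l')))
      ≤ 1 / (Fintype.card V * τ) := by
  have : ∀ i : Fin L × X,
      𝔼 f : K × Fin L → V, pickWeight q f w i * ind (τ < β i.2 (f (w', l')))
        ≤ (𝔼 f : K × Fin L → V, pickWeight q f w i) * (1 / (Fintype.card V * τ)) := fun i => by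
    have hne : (w, i.1) ≠ (w', l') := fun h => hw (congrArg Prod.fst h).symm
    simp only [pickWeight]
    rw [expect_apply_apply hne fun v v' =>
        (Fintype.card V : ℝ) / L * q (i.2, v) * ind (τ < β i.2 v'),
      expect_apply_eq (w, i.1) fun v => (Fintype.card V : ℝ) / L * q (i.2, v), expect_mul]
    refine expect_le_expect fun v _ => ?_
    rw [← mul_expect]
    exact mul_le_mul_of_nonneg_left (expect_ind_lt_le (hβ i.2) (hβ1 i.2) hτ)
      (mul_nonneg (by positivity) (hq _))
  rw [expect_sum_comm]
  refine (sum_le_sum fun i _ => this i).trans_eq ?_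
  rw [← sum_mul, ← expect_sum_comm, expect_sum_pickWeight hL, hq1, one_mul]

/-- With enough codewords the selection weights sum up to nearly `1`. -/
theorem expect_abs_one_sub_pickWeight_le (hL : 0 < L) {q : X × V → ℝ} (hq : ∀ z, 0 ≤ q z)
    (hq1 : ∑ z, q z = 1) (w : K) {t : ℝ} (ht : 0 ≤ t) :
    𝔼 f : K × Fin L → V, |1 - ∑ i, pickWeight q f w i|
      ≤ 2 * ∑ z, q z * ind (t < ∑ x, q (x, z.2)) + √(Fintype.card V * t / L) := by
  have hV : (0 : ℝ) < Fintype.card V := by exact_mod_cast Fintype.card_pos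
  set h : V → ℝ := fun v => Fintype.card V * ∑ x, q (x, v) with hh
  have hinj : Injective fun l : Fin L => (w, l) := fun l l' h => (Prod.ext_iff.1 h).2
  have h1 : 𝔼 v, h v = 1 := by
    rw [← hq1, Fintype.expect_eq_sum_div_card, ← mul_sum, Fintype.sum_prod_type_right]
    field_simp
  have key := expect_abs_one_sub_le (h := h) hL hinj
    (fun v => mul_nonneg hV.le (sum_nonneg fun x _ => hq (x, v)) : ∀ v, 0 ≤ h v) h1
    (mul_nonneg hV.le ht)
  have e1 : ∀ f : K × Fin L → V, (∑ l, h (f (w, l))) / L = ∑ i, pickWeight q f w i := fun f => by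
    rw [Fintype.sum_prod_type, sum_div]
    refine sum_congr rfl fun l _ => ?_
    simp only [pickWeight, hh, ← mul_sum]
    ring
  have e2 : 𝔼 v, h v * ind (Fintype.card V * t < h v)
      = ∑ z, q z * ind (t < ∑ x, q (x, z.2)) := by
    rw [Fintype.expect_eq_sum_div_card, Fintype.sum_prod_type_right, sum_div]
    refine sum_congr rfl fun v _ => ?_
    simp only [hh, mul_lt_mul_iff_right₀ hV, ← sum_mul]
    field_simp
  simp only [e1, e2] at key
  exact key

end Pick

/-! ### One block -/

/-- A code for one block, used with super-letters: all alphabets are those of whole blocks. Both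
encoders know the pair `a` of messages of the preceding block, encoder `i` has a fresh message, and
after the block each encoder estimates the fresh message of the other one from the symbols that it
has learned. The decoder knows the fresh messages and estimates `a`. -/
structure BlockCode (K₁ K₂ 𝒳₁ 𝒳₂ 𝒮₀ 𝒮₁ 𝒮₂ 𝒴 : Type*) where
  e₁ : K₁ × K₂ → K₁ → 𝒮₀ → 𝒮₁ → 𝒳₁
  e₂ : K₁ × K₂ → K₂ → 𝒮₀ → 𝒮₂ → 𝒳₂
  d₁ : K₁ × K₂ → 𝒮₀ → 𝒳₁ → K₁
  d₂ : K₁ × K₂ → 𝒮₀ → 𝒳₂ → K₂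
  g : K₁ × K₂ → 𝒴 → K₁ × K₂

section Block

variable {K₁ K₂ 𝒳₁ 𝒳₂ 𝒮₀ 𝒮₁ 𝒮₂ 𝒴 𝒰 𝒱₁ 𝒱₂ : Type*}
  [Fintype 𝒳₁] [Fintype 𝒳₂] [Fintype 𝒮₀] [Fintype 𝒮₁] [Fintype 𝒮₂] [Fintype 𝒴]
  [Fintype 𝒰] [Fintype 𝒱₁] [Fintype 𝒱₂]

/-- The probability of a triple of states. -/
def Channel.P (ch : Channel 𝒳₁ 𝒳₂ 𝒮₀ 𝒮₁ 𝒮₂ 𝒴) (σ : 𝒮₀ × 𝒮₁ × 𝒮₂) : ℝ :=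
  ch.P₀ σ.1 * ch.P₁ σ.2.1 * ch.P₂ σ.2.2

theorem Channel.P_nonneg (ch : Channel 𝒳₁ 𝒳₂ 𝒮₀ 𝒮₁ 𝒮₂ 𝒴) (σ : 𝒮₀ × 𝒮₁ × 𝒮₂) : 0 ≤ ch.P σ :=
  mul_nonneg (mul_nonneg (ch.P₀_mem.1 _) (ch.P₁_mem.1 _)) (ch.P₂_mem.1 _)

theorem Channel.sum_P (ch : Channel 𝒳₁ 𝒳₂ 𝒮₀ 𝒮₁ 𝒮₂ 𝒴) : ∑ σ, ch.P σ = 1 := by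
  simp only [Channel.P, Fintype.sum_prod_type, ← mul_sum, ch.P₂_mem.2, mul_one, ch.P₁_mem.2,
    ch.P₀_mem.2]

/-- Some estimate is wrong in a block. -/
def BlockCode.Bad (C : BlockCode K₁ K₂ 𝒳₁ 𝒳₂ 𝒮₀ 𝒮₁ 𝒮₂ 𝒴) (a w : K₁ × K₂) (σ : 𝒮₀ × 𝒮₁ × 𝒮₂)
    (y : 𝒴) : Prop :=
  C.d₁ a σ.1 (C.e₁ a w.1 σ.1 σ.2.1) ≠ w.1 ∨ C.d₂ a σ.1 (C.e₂ a w.2 σ.1 σ.2.2) ≠ w.2 ∨ C.g w y ≠ a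

/-- The probability that some estimate is wrong in a block with common messages `a` and fresh
messages `w`. -/
noncomputable def BlockCode.err (ch : Channel 𝒳₁ 𝒳₂ 𝒮₀ 𝒮₁ 𝒮₂ 𝒴)
    (C : BlockCode K₁ K₂ 𝒳₁ 𝒳₂ 𝒮₀ 𝒮₁ 𝒮₂ 𝒴) (a w : K₁ × K₂) : ℝ :=
  ∑ σ, ch.P σ * ∑ y, ch.W (C.e₁ a w.1 σ.1 σ.2.1) (C.e₂ a w.2 σ.1 σ.2.2) σ.1 σ.2.1 σ.2.2 y *
    ind (C.Bad a w σ y)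

/-- The expectation of `G` under the joint law, as an iterated sum. -/
noncomputable def jointExp (ch : Channel 𝒳₁ 𝒳₂ 𝒮₀ 𝒮₁ 𝒮₂ 𝒴)
    (aux : AuxLaws 𝒳₁ 𝒳₂ 𝒮₀ 𝒮₁ 𝒮₂ 𝒰 𝒱₁ 𝒱₂)
    (G : 𝒮₀ × 𝒮₁ × 𝒮₂ → 𝒰 → 𝒳₁ × 𝒱₁ → 𝒳₂ × 𝒱₂ → 𝒴 → ℝ) : ℝ :=
  ∑ σ, ch.P σ * ∑ u, aux.PU σ.1 u * ∑ z₂, aux.Q₂ u σ.1 σ.2.2 z₂ *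
    ∑ z₁, aux.Q₁ u σ.1 σ.2.1 z₁ * ∑ y, ch.W z₁.1 z₂.1 σ.1 σ.2.1 σ.2.2 y * G σ u z₁ z₂ y

theorem jointExp_eq_sum (ch : Channel 𝒳₁ 𝒳₂ 𝒮₀ 𝒮₁ 𝒮₂ 𝒴)
    (aux : AuxLaws 𝒳₁ 𝒳₂ 𝒮₀ 𝒮₁ 𝒮₂ 𝒰 𝒱₁ 𝒱₂)
    (G : 𝒮₀ × 𝒮₁ × 𝒮₂ → 𝒰 → 𝒳₁ × 𝒱₁ → 𝒳₂ × 𝒱₂ → 𝒴 → ℝ) :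
    jointExp ch aux G = ∑ ω, jointLaw ch aux ω *
      G (ω.1, ω.2.1, ω.2.2.1) ω.2.2.2.1 (ω.2.2.2.2.2.2.1, ω.2.2.2.2.1)
        (ω.2.2.2.2.2.2.2.1, ω.2.2.2.2.2.1) ω.2.2.2.2.2.2.2.2 := by
  let e : (𝒮₀ × 𝒮₁ × 𝒮₂) × 𝒰 × (𝒳₂ × 𝒱₂) × (𝒳₁ × 𝒱₁) × 𝒴 ≃
      𝒮₀ × 𝒮₁ × 𝒮₂ × 𝒰 × 𝒱₁ × 𝒱₂ × 𝒳₁ × 𝒳₂ × 𝒴 :=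
    { toFun := fun z => (z.1.1, z.1.2.1, z.1.2.2, z.2.1, z.2.2.2.1.2, z.2.2.1.2, z.2.2.2.1.1,
        z.2.2.1.1, z.2.2.2.2)
      invFun := fun ω => ((ω.1, ω.2.1, ω.2.2.1), ω.2.2.2.1,
        (ω.2.2.2.2.2.2.2.1, ω.2.2.2.2.2.1), (ω.2.2.2.2.2.2.1, ω.2.2.2.2.1), ω.2.2.2.2.2.2.2.2)
      left_inv := fun _ => rfl
      right_inv := fun _ => rfl }
  rw [← e.sum_comp]
  refine Eq.trans ?_ (Fintype.sum_prod_type _).symm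
  simp only [jointExp, mul_sum]
  refine sum_congr rfl fun σ _ => ?_
  refine Eq.trans ?_ (Fintype.sum_prod_type _).symm
  refine sum_congr rfl fun u _ => ?_
  refine Eq.trans ?_ (Fintype.sum_prod_type _).symm
  refine sum_congr rfl fun z₂ _ => ?_
  refine Eq.trans ?_ (Fintype.sum_prod_type _).symm
  refine sum_congr rfl fun z₁ _ => sum_congr rfl fun y _ => ?_
  simp only [e, jointLaw, Channel.P, Equiv.coe_fn_mk]
  ring

/-- The three tests used for decoding: encoder 2 tests the codewords of encoder 1 with `b₁`,
encoder 1 those of encoder 2 with `b₂`, and the decoder tests triples of codewords with `b`. Each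
of the three has total mass at most `1` in the codewords, like a conditional probability of the
codewords given the data of the test. -/
structure Tests (𝒳₁ 𝒳₂ 𝒮₀ 𝒴 𝒰 𝒱₁ 𝒱₂ : Type*) [Fintype 𝒰] [Fintype 𝒱₁] [Fintype 𝒱₂] where
  b₁ : 𝒰 → 𝒮₀ → 𝒳₁ → 𝒱₁ → ℝ
  b₂ : 𝒰 → 𝒮₀ → 𝒳₂ → 𝒱₂ → ℝ
  b : 𝒴 → 𝒰 × 𝒱₁ × 𝒱₂ → ℝ
  b₁_nonneg : ∀ u s x v, 0 ≤ b₁ u s x v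
  b₂_nonneg : ∀ u s x v, 0 ≤ b₂ u s x v
  b_nonneg : ∀ y c, 0 ≤ b y c
  sum_b₁_le : ∀ u s x, ∑ v, b₁ u s x v ≤ 1
  sum_b₂_le : ∀ u s x, ∑ v, b₂ u s x v ≤ 1
  sum_b_le : ∀ y, ∑ c, b y c ≤ 1

open Classical in
/-- An element that satisfies `p` if there is one, and an arbitrary element otherwise. -/
noncomputable def select {K : Type*} [Nonempty K] (p : K → Prop) : K :=
  if h : ∃ k, p k then h.choose else Classical.arbitrary K

theorem select_ne {K : Type*} [Nonempty K] {p : K → Prop} {k : K} (h : select p ≠ k) :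
    ¬p k ∨ ∃ k', k' ≠ k ∧ p k' := by
  by_cases hk : ∃ k, p k
  · refine Or.inr ⟨select p, h, ?_⟩
    rw [select, dif_pos hk]
    exact hk.choose_spec
  · exact Or.inl fun h' => hk ⟨k, h'⟩

variable [Fintype K₁] [DecidableEq K₁] [Nonempty K₁] [Fintype K₂] [DecidableEq K₂] [Nonempty K₂]

/-- The codewords that belong to one value of the common index: the word `u`, and for each fresh
message of either encoder a list of words. -/
abbrev Word (K₁ K₂ 𝒰 𝒱₁ 𝒱₂ : Type*) (L₁ L₂ : ℕ) :=
  𝒰 × (K₁ × Fin L₁ → 𝒱₁) × (K₂ × Fin L₂ → 𝒱₂)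

/-- A codebook: for each pair of common messages a list of words. -/
abbrev Codebook (K₁ K₂ 𝒰 𝒱₁ 𝒱₂ : Type*) (L₀ L₁ L₂ : ℕ) :=
  (K₁ × K₂) × Fin L₀ → Word K₁ K₂ 𝒰 𝒱₁ 𝒱₂ L₁ L₂

variable {L₀ L₁ L₂ : ℕ}

/-- The estimate that encoder 2 makes of the message of encoder 1. -/
noncomputable def estimate₁ (B : Tests 𝒳₁ 𝒳₂ 𝒮₀ 𝒴 𝒰 𝒱₁ 𝒱₂) (τ₁ : ℝ)
    (c : Word K₁ K₂ 𝒰 𝒱₁ 𝒱₂ L₁ L₂) (s₀ : 𝒮₀) (x₁ : 𝒳₁) : K₁ :=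
  select fun k => ∃ l, τ₁ < B.b₁ c.1 s₀ x₁ (c.2.1 (k, l))

/-- The estimate that encoder 1 makes of the message of encoder 2. -/
noncomputable def estimate₂ (B : Tests 𝒳₁ 𝒳₂ 𝒮₀ 𝒴 𝒰 𝒱₁ 𝒱₂) (τ₂ : ℝ)
    (c : Word K₁ K₂ 𝒰 𝒱₁ 𝒱₂ L₁ L₂) (s₀ : 𝒮₀) (x₂ : 𝒳₂) : K₂ :=
  select fun k => ∃ l, τ₂ < B.b₂ c.1 s₀ x₂ (c.2.2 (k, l))

/-- The estimate that the decoder makes of the common messages when the fresh ones are `w`. -/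
noncomputable def estimate (B : Tests 𝒳₁ 𝒳₂ 𝒮₀ 𝒴 𝒰 𝒱₁ 𝒱₂) (τ : ℝ)
    (cb : Codebook K₁ K₂ 𝒰 𝒱₁ 𝒱₂ L₀ L₁ L₂) (w : K₁ × K₂) (y : 𝒴) : K₁ × K₂ :=
  select fun a => ∃ l l₁ l₂,
    τ < B.b y ((cb (a, l)).1, (cb (a, l)).2.1 (w.1, l₁), (cb (a, l)).2.2 (w.2, l₂))

/-- Some estimate is wrong when the common index is `l` and the symbols `x₁`, `x₂` are sent. -/
def BadEvent (B : Tests 𝒳₁ 𝒳₂ 𝒮₀ 𝒴 𝒰 𝒱₁ 𝒱₂) (τ₁ τ₂ τ : ℝ)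
    (cb : Codebook K₁ K₂ 𝒰 𝒱₁ 𝒱₂ L₀ L₁ L₂) (a w : K₁ × K₂) (l : Fin L₀) (s₀ : 𝒮₀) (x₁ : 𝒳₁)
    (x₂ : 𝒳₂) (y : 𝒴) : Prop :=
  estimate₁ B τ₁ (cb (a, l)) s₀ x₁ ≠ w.1 ∨ estimate₂ B τ₂ (cb (a, l)) s₀ x₂ ≠ w.2 ∨
    estimate B τ cb w y ≠ a

/-- The weight with which the encoders select the common index `l`. -/
noncomputable def commonWeight (aux : AuxLaws 𝒳₁ 𝒳₂ 𝒮₀ 𝒮₁ 𝒮₂ 𝒰 𝒱₁ 𝒱₂)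
    (cb : Codebook K₁ K₂ 𝒰 𝒱₁ 𝒱₂ L₀ L₁ L₂) (a : K₁ × K₂) (s₀ : 𝒮₀) (l : Fin L₀) : ℝ :=
  Fintype.card 𝒰 / L₀ * aux.PU s₀ (cb (a, l)).1

/-- The weight with which encoder 1 selects its codeword and the symbol that it sends. -/
noncomputable def weight₁ (aux : AuxLaws 𝒳₁ 𝒳₂ 𝒮₀ 𝒮₁ 𝒮₂ 𝒰 𝒱₁ 𝒱₂)
    (c : Word K₁ K₂ 𝒰 𝒱₁ 𝒱₂ L₁ L₂) (k : K₁) (σ : 𝒮₀ × 𝒮₁ × 𝒮₂) (i : Fin L₁ × 𝒳₁) : ℝ :=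
  pickWeight (aux.Q₁ c.1 σ.1 σ.2.1) c.2.1 k i

/-- The weight with which encoder 2 selects its codeword and the symbol that it sends. -/
noncomputable def weight₂ (aux : AuxLaws 𝒳₁ 𝒳₂ 𝒮₀ 𝒮₁ 𝒮₂ 𝒰 𝒱₁ 𝒱₂)
    (c : Word K₁ K₂ 𝒰 𝒱₁ 𝒱₂ L₁ L₂) (k : K₂) (σ : 𝒮₀ × 𝒮₁ × 𝒮₂) (i : Fin L₂ × 𝒳₂) : ℝ :=
  pickWeight (aux.Q₂ c.1 σ.1 σ.2.2) c.2.2 k i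

/-- The total mass of `G` when the encoders select with the unnormalized weights. -/
noncomputable def ideal (ch : Channel 𝒳₁ 𝒳₂ 𝒮₀ 𝒮₁ 𝒮₂ 𝒴)
    (aux : AuxLaws 𝒳₁ 𝒳₂ 𝒮₀ 𝒮₁ 𝒮₂ 𝒰 𝒱₁ 𝒱₂) (cb : Codebook K₁ K₂ 𝒰 𝒱₁ 𝒱₂ L₀ L₁ L₂)
    (a w : K₁ × K₂)
    (G : 𝒮₀ × 𝒮₁ × 𝒮₂ → Fin L₀ → Fin L₁ × 𝒳₁ → Fin L₂ × 𝒳₂ → 𝒴 → ℝ) : ℝ :=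
  ∑ σ, ch.P σ * ∑ l, commonWeight aux cb a σ.1 l * ∑ i₂, weight₂ aux (cb (a, l)) w.2 σ i₂ *
    ∑ i₁, weight₁ aux (cb (a, l)) w.1 σ i₁ *
      ∑ y, ch.W i₁.2 i₂.2 σ.1 σ.2.1 σ.2.2 y * G σ l i₁ i₂ y

/-- A bound for the error probability of the deterministic codes made from a codebook: the error
under the unnormalized selection weights, and the defects of these weights. -/
noncomputable def cost (ch : Channel 𝒳₁ 𝒳₂ 𝒮₀ 𝒮₁ 𝒮₂ 𝒴)
    (aux : AuxLaws 𝒳₁ 𝒳₂ 𝒮₀ 𝒮₁ 𝒮₂ 𝒰 𝒱₁ 𝒱₂) (B : Tests 𝒳₁ 𝒳₂ 𝒮₀ 𝒴 𝒰 𝒱₁ 𝒱₂) (τ₁ τ₂ τ : ℝ)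
    (cb : Codebook K₁ K₂ 𝒰 𝒱₁ 𝒱₂ L₀ L₁ L₂) (a w : K₁ × K₂) : ℝ :=
  ∑ σ, ch.P σ * |1 - ∑ l, commonWeight aux cb a σ.1 l| +
  (∑ σ, ch.P σ * ∑ l, commonWeight aux cb a σ.1 l *
    |1 - ∑ i₂, weight₂ aux (cb (a, l)) w.2 σ i₂| +
  (∑ σ, ch.P σ * ∑ l, commonWeight aux cb a σ.1 l * ∑ i₂, weight₂ aux (cb (a, l)) w.2 σ i₂ *
    |1 - ∑ i₁, weight₁ aux (cb (a, l)) w.1 σ i₁| +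
  ideal ch aux cb a w fun σ l i₁ i₂ y =>
    ind (BadEvent B τ₁ τ₂ τ cb a w l σ.1 i₁.2 i₂.2 y)))

theorem commonWeight_nonneg (aux : AuxLaws 𝒳₁ 𝒳₂ 𝒮₀ 𝒮₁ 𝒮₂ 𝒰 𝒱₁ 𝒱₂)
    (cb : Codebook K₁ K₂ 𝒰 𝒱₁ 𝒱₂ L₀ L₁ L₂) (a : K₁ × K₂) (s₀ : 𝒮₀) (l : Fin L₀) :
    0 ≤ commonWeight aux cb a s₀ l :=
  mul_nonneg (by positivity) ((aux.PU_mem _).1 _)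

theorem weight₁_nonneg (aux : AuxLaws 𝒳₁ 𝒳₂ 𝒮₀ 𝒮₁ 𝒮₂ 𝒰 𝒱₁ 𝒱₂)
    (c : Word K₁ K₂ 𝒰 𝒱₁ 𝒱₂ L₁ L₂) (k : K₁) (σ : 𝒮₀ × 𝒮₁ × 𝒮₂) (i : Fin L₁ × 𝒳₁) :
    0 ≤ weight₁ aux c k σ i :=
  pickWeight_nonneg (aux.Q₁_mem _ _ _).1 _ _ _

theorem weight₂_nonneg (aux : AuxLaws 𝒳₁ 𝒳₂ 𝒮₀ 𝒮₁ 𝒮₂ 𝒰 𝒱₁ 𝒱₂)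
    (c : Word K₁ K₂ 𝒰 𝒱₁ 𝒱₂ L₁ L₂) (k : K₂) (σ : 𝒮₀ × 𝒮₁ × 𝒮₂) (i : Fin L₂ × 𝒳₂) :
    0 ≤ weight₂ aux c k σ i :=
  pickWeight_nonneg (aux.Q₂_mem _ _ _).1 _ _ _

/-- The random selections of the encoders can be made deterministic, for a whole family of pairs
of messages at once. The choices are made in the order encoder 1, encoder 2, common index: each is
optimal on average over those selections that are still random, and the key of each holds only what
the encoders that make it know. -/
theorem exists_blockCode_le_cost [Nonempty 𝒳₁] [Nonempty 𝒳₂] (hL₀ : 0 < L₀) (hL₁ : 0 < L₁)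
    (hL₂ : 0 < L₂) (ch : Channel 𝒳₁ 𝒳₂ 𝒮₀ 𝒮₁ 𝒮₂ 𝒴)
    (aux : AuxLaws 𝒳₁ 𝒳₂ 𝒮₀ 𝒮₁ 𝒮₂ 𝒰 𝒱₁ 𝒱₂) (B : Tests 𝒳₁ 𝒳₂ 𝒮₀ 𝒴 𝒰 𝒱₁ 𝒱₂) (τ₁ τ₂ τ : ℝ)
    (cb : Codebook K₁ K₂ 𝒰 𝒱₁ 𝒱₂ L₀ L₁ L₂) {T : Type*} [Fintype T] (a w : T → K₁ × K₂) :
    ∃ C : BlockCode K₁ K₂ 𝒳₁ 𝒳₂ 𝒮₀ 𝒮₁ 𝒮₂ 𝒴,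
      ∑ t, C.err ch (a t) (w t) ≤ ∑ t, cost ch aux B τ₁ τ₂ τ cb (a t) (w t) := by
  have : Nonempty (Fin L₀) := ⟨⟨0, hL₀⟩⟩
  have : Nonempty (Fin L₁) := ⟨⟨0, hL₁⟩⟩
  have : Nonempty (Fin L₂) := ⟨⟨0, hL₂⟩⟩
  let F : T → 𝒮₀ × 𝒮₁ × 𝒮₂ → Fin L₀ → 𝒳₁ → 𝒳₂ → ℝ := fun t σ l x₁ x₂ =>
    ∑ y, ch.W x₁ x₂ σ.1 σ.2.1 σ.2.2 y *
      ind (BadEvent B τ₁ τ₂ τ cb (a t) (w t) l σ.1 x₁ x₂ y)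
  have hF0 : ∀ t σ l x₁ x₂, 0 ≤ F t σ l x₁ x₂ := fun t σ l x₁ x₂ =>
    sum_nonneg fun y _ => mul_nonneg ((ch.W_mem _ _ _ _ _).1 _) (ind_nonneg _)
  have hF1 : ∀ t σ l x₁ x₂, F t σ l x₁ x₂ ≤ 1 := fun t σ l x₁ x₂ => by
    rw [← (ch.W_mem x₁ x₂ σ.1 σ.2.1 σ.2.2).2]
    exact sum_le_sum fun y _ =>
      mul_le_of_le_one_right ((ch.W_mem _ _ _ _ _).1 _) (ind_le_one _)
  have hw0 := fun (t : T) (σ : 𝒮₀ × 𝒮₁ × 𝒮₂) (l : Fin L₀) =>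
    commonWeight_nonneg aux cb (a t) σ.1 l
  have hw2 := fun (t : T) (σ : 𝒮₀ × 𝒮₁ × 𝒮₂) (l : Fin L₀) (i₂ : Fin L₂ × 𝒳₂) =>
    weight₂_nonneg aux (cb (a t, l)) (w t).2 σ i₂
  obtain ⟨φ₁, h₁⟩ := exists_choice_le
    (T := T × (𝒮₀ × 𝒮₁ × 𝒮₂) × Fin L₀ × (Fin L₂ × 𝒳₂))
    (Key := (K₁ × K₂) × Fin L₀ × K₁ × 𝒮₀ × 𝒮₁) (I := Fin L₁ × 𝒳₁)
    (fun t => (a t.1, t.2.2.1, (w t.1).1, t.2.1.1, t.2.1.2.1))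
    (ω := fun k i => pickWeight (aux.Q₁ (cb (k.1, k.2.1)).1 k.2.2.2.1 k.2.2.2.2)
      (cb (k.1, k.2.1)).2.1 k.2.2.1 i)
    (fun k i => pickWeight_nonneg (aux.Q₁_mem _ _ _).1 _ _ _)
    (c := fun t => ch.P t.2.1 * commonWeight aux cb (a t.1) t.2.1.1 t.2.2.1 *
      weight₂ aux (cb (a t.1, t.2.2.1)) (w t.1).2 t.2.1 t.2.2.2)
    (fun t => mul_nonneg (mul_nonneg (ch.P_nonneg _) (hw0 _ _ _)) (hw2 _ _ _ _))
    (F := fun t i => F t.1 t.2.1 t.2.2.1 i.2 t.2.2.2.2)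
    (fun t i => hF0 _ _ _ _ _) (fun t i => hF1 _ _ _ _ _)
  set x₁ : K₁ × K₂ → Fin L₀ → K₁ → 𝒮₀ → 𝒮₁ → 𝒳₁ := fun a l k s₀ s₁ => (φ₁ (a, l, k, s₀, s₁)).2
  obtain ⟨φ₂, h₂⟩ := exists_choice_le
    (T := T × (𝒮₀ × 𝒮₁ × 𝒮₂) × Fin L₀)
    (Key := (K₁ × K₂) × Fin L₀ × K₂ × 𝒮₀ × 𝒮₂) (I := Fin L₂ × 𝒳₂)
    (fun t => (a t.1, t.2.2, (w t.1).2, t.2.1.1, t.2.1.2.2))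
    (ω := fun k i => pickWeight (aux.Q₂ (cb (k.1, k.2.1)).1 k.2.2.2.1 k.2.2.2.2)
      (cb (k.1, k.2.1)).2.2 k.2.2.1 i)
    (fun k i => pickWeight_nonneg (aux.Q₂_mem _ _ _).1 _ _ _)
    (c := fun t => ch.P t.2.1 * commonWeight aux cb (a t.1) t.2.1.1 t.2.2)
    (fun t => mul_nonneg (ch.P_nonneg _) (hw0 _ _ _))
    (F := fun t i => F t.1 t.2.1 t.2.2 (x₁ (a t.1) t.2.2 (w t.1).1 t.2.1.1 t.2.1.2.1) i.2)
    (fun t i => hF0 _ _ _ _ _) (fun t i => hF1 _ _ _ _ _)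
  set x₂ : K₁ × K₂ → Fin L₀ → K₂ → 𝒮₀ → 𝒮₂ → 𝒳₂ := fun a l k s₀ s₂ => (φ₂ (a, l, k, s₀, s₂)).2
  obtain ⟨φ₀, h₀⟩ := exists_choice_le
    (T := T × (𝒮₀ × 𝒮₁ × 𝒮₂)) (Key := (K₁ × K₂) × 𝒮₀) (I := Fin L₀)
    (fun t => (a t.1, t.2.1)) (ω := fun k l => commonWeight aux cb k.1 k.2 l)
    (fun k l => commonWeight_nonneg _ _ _ _ _)
    (c := fun t => ch.P t.2) (fun t => ch.P_nonneg _)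
    (F := fun t l => F t.1 t.2 l (x₁ (a t.1) l (w t.1).1 t.2.1 t.2.2.1)
      (x₂ (a t.1) l (w t.1).2 t.2.1 t.2.2.2))
    (fun t i => hF0 _ _ _ _ _) (fun t i => hF1 _ _ _ _ _)
  refine ⟨{ e₁ := fun a k s₀ s₁ => x₁ a (φ₀ (a, s₀)) k s₀ s₁
            e₂ := fun a k s₀ s₂ => x₂ a (φ₀ (a, s₀)) k s₀ s₂
            d₁ := fun a s₀ x => estimate₁ B τ₁ (cb (a, φ₀ (a, s₀))) s₀ x
            d₂ := fun a s₀ x => estimate₂ B τ₂ (cb (a, φ₀ (a, s₀))) s₀ x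
            g := estimate B τ cb }, ?_⟩
  have e0 : ∀ H : T × (𝒮₀ × 𝒮₁ × 𝒮₂) → ℝ, ∑ t, H t = ∑ t, ∑ σ, H (t, σ) :=
    fun H => Fintype.sum_prod_type _
  have e2 : ∀ H : T × (𝒮₀ × 𝒮₁ × 𝒮₂) × Fin L₀ → ℝ, ∑ t, H t = ∑ t, ∑ σ, ∑ l, H (t, σ, l) :=
    fun H => by simp only [Fintype.sum_prod_type]
  have e1 : ∀ H : T × (𝒮₀ × 𝒮₁ × 𝒮₂) × Fin L₀ × (Fin L₂ × 𝒳₂) → ℝ,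
      ∑ t, H t = ∑ t, ∑ σ, ∑ l, ∑ i, H (t, σ, l, i) :=
    fun H => by simp only [Fintype.sum_prod_type]
  simp only [e0] at h₀
  simp only [e2] at h₂
  simp only [e1] at h₁
  simp only [cost, sum_add_distrib]
  simp only [ideal, weight₁, weight₂, mul_sum] at h₀ h₁ h₂ ⊢
  simp only [← mul_assoc] at h₀ h₁ h₂ ⊢
  refine le_trans ?_ (h₀.trans (add_le_add_right (h₂.trans (add_le_add_right (h₁.trans ?_) _)) _))
  · simp only [BlockCode.err, mul_sum, F, BlockCode.Bad, BadEvent]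
    exact le_rfl
  · simp only [F, mul_sum, mul_assoc]
    exact le_rfl

end Block

section OneShot

variable {K₁ K₂ 𝒳₁ 𝒳₂ 𝒮₀ 𝒮₁ 𝒮₂ 𝒴 𝒰 𝒱₁ 𝒱₂ : Type*}
  [Fintype 𝒳₁] [Fintype 𝒳₂] [Fintype 𝒮₀] [Fintype 𝒮₁] [Fintype 𝒮₂] [Fintype 𝒴]
  [Fintype 𝒰] [Fintype 𝒱₁] [Fintype 𝒱₂]
  [Fintype K₁] [DecidableEq K₁] [Nonempty K₁] [Fintype K₂] [DecidableEq K₂] [Nonempty K₂]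
  {L₀ L₁ L₂ : ℕ}

theorem ind_exists_ne_le {K : Type*} [Fintype K] [DecidableEq K] (w : K) (p : K → Prop) :
    ind (∃ k, k ≠ w ∧ p k) ≤ ∑ k ∈ univ.erase w, ind (p k) := by
  by_cases h : ∃ k, k ≠ w ∧ p k
  · obtain ⟨k, hk, hp⟩ := h
    rw [ind_of ⟨k, hk, hp⟩, ← ind_of hp]
    exact single_le_sum (f := fun k => ind (p k)) (fun j _ => ind_nonneg _)
      (mem_erase.2 ⟨hk, mem_univ k⟩)
  · rw [ind_of_not h]
    exact sum_nonneg fun j _ => ind_nonneg _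

section Ideal

variable (ch : Channel 𝒳₁ 𝒳₂ 𝒮₀ 𝒮₁ 𝒮₂ 𝒴) (aux : AuxLaws 𝒳₁ 𝒳₂ 𝒮₀ 𝒮₁ 𝒮₂ 𝒰 𝒱₁ 𝒱₂)
  (cb : Codebook K₁ K₂ 𝒰 𝒱₁ 𝒱₂ L₀ L₁ L₂) (a w : K₁ × K₂)

theorem ideal_mono {G G' : 𝒮₀ × 𝒮₁ × 𝒮₂ → Fin L₀ → Fin L₁ × 𝒳₁ → Fin L₂ × 𝒳₂ → 𝒴 → ℝ}
    (h : ∀ σ l i₁ i₂ y, G σ l i₁ i₂ y ≤ G' σ l i₁ i₂ y) :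
    ideal ch aux cb a w G ≤ ideal ch aux cb a w G' := by
  refine sum_le_sum fun σ _ => mul_le_mul_of_nonneg_left ?_ (ch.P_nonneg σ)
  refine sum_le_sum fun l _ => mul_le_mul_of_nonneg_left ?_ (commonWeight_nonneg _ _ _ _ _)
  refine sum_le_sum fun i₂ _ => mul_le_mul_of_nonneg_left ?_ (weight₂_nonneg _ _ _ _ _)
  refine sum_le_sum fun i₁ _ => mul_le_mul_of_nonneg_left ?_ (weight₁_nonneg _ _ _ _ _)
  exact sum_le_sum fun y _ => mul_le_mul_of_nonneg_left (h _ _ _ _ _) ((ch.W_mem _ _ _ _ _).1 _)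

theorem ideal_add (G G' : 𝒮₀ × 𝒮₁ × 𝒮₂ → Fin L₀ → Fin L₁ × 𝒳₁ → Fin L₂ × 𝒳₂ → 𝒴 → ℝ) :
    ideal ch aux cb a w (fun σ l i₁ i₂ y => G σ l i₁ i₂ y + G' σ l i₁ i₂ y)
      = ideal ch aux cb a w G + ideal ch aux cb a w G' := by
  simp only [ideal, mul_add, sum_add_distrib]

theorem ideal_sum {ι : Type*} (s : Finset ι)
    (G : ι → 𝒮₀ × 𝒮₁ × 𝒮₂ → Fin L₀ → Fin L₁ × 𝒳₁ → Fin L₂ × 𝒳₂ → 𝒴 → ℝ) :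
    ideal ch aux cb a w (fun σ l i₁ i₂ y => ∑ k ∈ s, G k σ l i₁ i₂ y)
      = ∑ k ∈ s, ideal ch aux cb a w (G k) := by
  classical
  induction s using Finset.induction_on with
  | empty => simp [ideal]
  | insert k s hk ih => simp only [sum_insert hk, ideal_add, ih]

end Ideal

/-- A wrong estimate means that the right codewords fail a test or that wrong ones pass it. The
indices `l₁`, `l₂` of the right codewords are arbitrary here. -/
theorem ind_badEvent_le (B : Tests 𝒳₁ 𝒳₂ 𝒮₀ 𝒴 𝒰 𝒱₁ 𝒱₂) (τ₁ τ₂ τ : ℝ)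
    (cb : Codebook K₁ K₂ 𝒰 𝒱₁ 𝒱₂ L₀ L₁ L₂) (a w : K₁ × K₂) (l : Fin L₀) (s₀ : 𝒮₀) (x₁ : 𝒳₁)
    (x₂ : 𝒳₂) (y : 𝒴) (l₁ : Fin L₁) (l₂ : Fin L₂) :
    ind (BadEvent B τ₁ τ₂ τ cb a w l s₀ x₁ x₂ y) ≤
      (ind (B.b₁ (cb (a, l)).1 s₀ x₁ ((cb (a, l)).2.1 (w.1, l₁)) ≤ τ₁) +
        ∑ k ∈ univ.erase w.1, ∑ l', ind (τ₁ < B.b₁ (cb (a, l)).1 s₀ x₁ ((cb (a, l)).2.1 (k, l')))) +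
      ((ind (B.b₂ (cb (a, l)).1 s₀ x₂ ((cb (a, l)).2.2 (w.2, l₂)) ≤ τ₂) +
        ∑ k ∈ univ.erase w.2, ∑ l', ind (τ₂ < B.b₂ (cb (a, l)).1 s₀ x₂ ((cb (a, l)).2.2 (k, l')))) +
      (ind (B.b y ((cb (a, l)).1, (cb (a, l)).2.1 (w.1, l₁), (cb (a, l)).2.2 (w.2, l₂)) ≤ τ) +
        ∑ a' ∈ univ.erase a, ∑ l', ∑ l₁', ∑ l₂',
          ind (τ < B.b y ((cb (a', l')).1, (cb (a', l')).2.1 (w.1, l₁'),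
            (cb (a', l')).2.2 (w.2, l₂'))))) := by
  refine (ind_or_le _ _).trans (add_le_add ?_ ((ind_or_le _ _).trans (add_le_add ?_ ?_)))
  · refine (ind_mono select_ne).trans ((ind_or_le _ _).trans (add_le_add (ind_mono ?_) ?_))
    · intro h; by_contra! hc; exact h ⟨l₁, hc⟩
    · exact (ind_exists_ne_le _ _).trans (sum_le_sum fun k _ => ind_exists_le _)
  · refine (ind_mono select_ne).trans ((ind_or_le _ _).trans (add_le_add (ind_mono ?_) ?_))
    · intro h; by_contra! hc; exact h ⟨l₂, hc⟩
    · exact (ind_exists_ne_le _ _).trans (sum_le_sum fun k _ => ind_exists_le _)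
  · refine (ind_mono select_ne).trans ((ind_or_le _ _).trans (add_le_add (ind_mono ?_) ?_))
    · intro h; by_contra! hc; exact h ⟨l, l₁, l₂, hc⟩
    · exact (ind_exists_ne_le _ _).trans (sum_le_sum fun k _ => (ind_exists_le _).trans
        (sum_le_sum fun l _ => (ind_exists_le _).trans (sum_le_sum fun l _ => ind_exists_le _)))

variable [Nonempty 𝒰] [Nonempty 𝒱₁] [Nonempty 𝒱₂]

theorem expect_commonWeight (hL₀ : 0 < L₀) (aux : AuxLaws 𝒳₁ 𝒳₂ 𝒮₀ 𝒮₁ 𝒮₂ 𝒰 𝒱₁ 𝒱₂)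
    (a : K₁ × K₂) (s₀ : 𝒮₀) (H : Word K₁ K₂ 𝒰 𝒱₁ 𝒱₂ L₁ L₂ → ℝ) :
    𝔼 cb : Codebook K₁ K₂ 𝒰 𝒱₁ 𝒱₂ L₀ L₁ L₂, ∑ l, commonWeight aux cb a s₀ l * H (cb (a, l))
      = ∑ u, aux.PU s₀ u * 𝔼 f₁, 𝔼 f₂, H (u, f₁, f₂) := by
  have hL' : (L₀ : ℝ) ≠ 0 := by exact_mod_cast hL₀.ne'
  have hU : (Fintype.card 𝒰 : ℝ) ≠ 0 := by exact_mod_cast Fintype.card_ne_zero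
  rw [expect_sum_comm]
  have : ∀ l : Fin L₀, 𝔼 cb : Codebook K₁ K₂ 𝒰 𝒱₁ 𝒱₂ L₀ L₁ L₂,
      commonWeight aux cb a s₀ l * H (cb (a, l))
        = (∑ u, aux.PU s₀ u * 𝔼 f₁, 𝔼 f₂, H (u, f₁, f₂)) / L₀ := fun l => by
    simp only [commonWeight]
    rw [expect_apply_eq (a, l) fun c : Word K₁ K₂ 𝒰 𝒱₁ 𝒱₂ L₁ L₂ =>
      (Fintype.card 𝒰 : ℝ) / L₀ * aux.PU s₀ c.1 * H c]
    simp only [expect_prod, ← mul_expect, mul_assoc]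
    rw [Fintype.expect_eq_sum_div_card]
    field_simp
  simp only [this, sum_const, card_univ, Fintype.card_fin, nsmul_eq_mul]
  field_simp

/-- The words of other common messages are independent of the selection of the common index. -/
theorem expect_commonWeight_other (hL₀ : 0 < L₀) (aux : AuxLaws 𝒳₁ 𝒳₂ 𝒮₀ 𝒮₁ 𝒮₂ 𝒰 𝒱₁ 𝒱₂)
    {a a' : K₁ × K₂} (ha : a' ≠ a) (l' : Fin L₀) (s₀ : 𝒮₀)
    (H : Word K₁ K₂ 𝒰 𝒱₁ 𝒱₂ L₁ L₂ → Word K₁ K₂ 𝒰 𝒱₁ 𝒱₂ L₁ L₂ → ℝ) :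
    𝔼 cb : Codebook K₁ K₂ 𝒰 𝒱₁ 𝒱₂ L₀ L₁ L₂,
        ∑ l, commonWeight aux cb a s₀ l * H (cb (a, l)) (cb (a', l'))
      = ∑ u, aux.PU s₀ u * 𝔼 f₁, 𝔼 f₂, 𝔼 c, H (u, f₁, f₂) c := by
  rw [← expect_commonWeight hL₀ aux a s₀ fun c => 𝔼 c', H c c', expect_sum_comm, expect_sum_comm]
  refine sum_congr rfl fun l _ => ?_
  have hne : (a, l) ≠ (a', l') := fun h => ha (congrArg Prod.fst h).symm
  simp only [commonWeight]
  rw [expect_apply_apply hne fun c c' : Word K₁ K₂ 𝒰 𝒱₁ 𝒱₂ L₁ L₂ =>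
      (Fintype.card 𝒰 : ℝ) / L₀ * aux.PU s₀ c.1 * H c c',
    expect_apply_eq (a, l) fun c : Word K₁ K₂ 𝒰 𝒱₁ 𝒱₂ L₁ L₂ =>
      (Fintype.card 𝒰 : ℝ) / L₀ * aux.PU s₀ c.1 * 𝔼 c', H c c']
  simp only [← mul_expect]

theorem expect_abs_one_sub_commonWeight_le (hL₀ : 0 < L₀)
    (aux : AuxLaws 𝒳₁ 𝒳₂ 𝒮₀ 𝒮₁ 𝒮₂ 𝒰 𝒱₁ 𝒱₂) (a : K₁ × K₂) (s₀ : 𝒮₀) {t : ℝ} (ht : 0 ≤ t) :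
    𝔼 cb : Codebook K₁ K₂ 𝒰 𝒱₁ 𝒱₂ L₀ L₁ L₂, |1 - ∑ l, commonWeight aux cb a s₀ l|
      ≤ 2 * ∑ u, aux.PU s₀ u * ind (t < aux.PU s₀ u) + √(Fintype.card 𝒰 * t / L₀) := by
  have hU : (0 : ℝ) < Fintype.card 𝒰 := by exact_mod_cast Fintype.card_pos
  set h : Word K₁ K₂ 𝒰 𝒱₁ 𝒱₂ L₁ L₂ → ℝ := fun c => Fintype.card 𝒰 * aux.PU s₀ c.1 with hh
  have hinj : Injective fun l : Fin L₀ => (a, l) := fun l l' h => (Prod.ext_iff.1 h).2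
  have h1 : 𝔼 c, h c = 1 := by
    simp only [hh, expect_prod, Fintype.expect_const]
    rw [Fintype.expect_eq_sum_div_card, ← mul_sum, (aux.PU_mem s₀).2]
    field_simp
  have key := expect_abs_one_sub_le (h := h) hL₀ hinj
    (fun c => mul_nonneg hU.le ((aux.PU_mem s₀).1 _)) h1 (mul_nonneg hU.le ht)
  have e1 : ∀ cb : Codebook K₁ K₂ 𝒰 𝒱₁ 𝒱₂ L₀ L₁ L₂,
      (∑ l, h (cb (a, l))) / L₀ = ∑ l, commonWeight aux cb a s₀ l := fun cb => by
    rw [sum_div]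
    refine sum_congr rfl fun l _ => ?_
    simp only [commonWeight, hh]
    ring
  have e2 : 𝔼 c, h c * ind (Fintype.card 𝒰 * t < h c)
      = ∑ u, aux.PU s₀ u * ind (t < aux.PU s₀ u) := by
    simp only [hh, expect_prod, Fintype.expect_const, mul_lt_mul_iff_right₀ hU, mul_assoc]
    rw [Fintype.expect_eq_sum_div_card, ← mul_sum]
    field_simp
  simp only [e1, e2] at key
  exact key

/-- Averaged over the codebook, the selected codewords have the joint law. -/
theorem expect_ideal_true (hL₀ : 0 < L₀) (hL₁ : 0 < L₁) (hL₂ : 0 < L₂)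
    (ch : Channel 𝒳₁ 𝒳₂ 𝒮₀ 𝒮₁ 𝒮₂ 𝒴) (aux : AuxLaws 𝒳₁ 𝒳₂ 𝒮₀ 𝒮₁ 𝒮₂ 𝒰 𝒱₁ 𝒱₂) (a w : K₁ × K₂)
    (G : 𝒮₀ × 𝒮₁ × 𝒮₂ → 𝒰 → 𝒳₁ × 𝒱₁ → 𝒳₂ × 𝒱₂ → 𝒴 → ℝ) :
    𝔼 cb : Codebook K₁ K₂ 𝒰 𝒱₁ 𝒱₂ L₀ L₁ L₂, ideal ch aux cb a w (fun σ l i₁ i₂ y =>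
        G σ (cb (a, l)).1 (i₁.2, (cb (a, l)).2.1 (w.1, i₁.1)) (i₂.2, (cb (a, l)).2.2 (w.2, i₂.1)) y)
      = jointExp ch aux G := by
  simp only [ideal, jointExp]
  rw [expect_sum_comm]
  refine sum_congr rfl fun σ _ => ?_
  rw [← mul_expect, expect_commonWeight hL₀ aux a σ.1 fun c =>
    ∑ i₂, weight₂ aux c w.2 σ i₂ * ∑ i₁, weight₁ aux c w.1 σ i₁ *
      ∑ y, ch.W i₁.2 i₂.2 σ.1 σ.2.1 σ.2.2 y *
        G σ c.1 (i₁.2, c.2.1 (w.1, i₁.1)) (i₂.2, c.2.2 (w.2, i₂.1)) y]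
  refine congrArg _ (sum_congr rfl fun u _ => congrArg _ ?_)
  simp only [weight₁, weight₂]
  have h2 : ∀ f₁ : K₁ × Fin L₁ → 𝒱₁, _ := fun f₁ =>
    expect_pickWeight hL₂ (aux.Q₂ u σ.1 σ.2.2) w.2 fun x₂ v₂ =>
      ∑ i₁, pickWeight (aux.Q₁ u σ.1 σ.2.1) f₁ w.1 i₁ *
        ∑ y, ch.W i₁.2 x₂ σ.1 σ.2.1 σ.2.2 y * G σ u (i₁.2, f₁ (w.1, i₁.1)) (x₂, v₂) y
  simp only [h2]
  rw [expect_sum_comm]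
  refine sum_congr rfl fun z₂ _ => ?_
  rw [← mul_expect, expect_pickWeight hL₁ (aux.Q₁ u σ.1 σ.2.1) w.1 fun x₁ v₁ =>
    ∑ y, ch.W x₁ z₂.1 σ.1 σ.2.1 σ.2.2 y * G σ u (x₁, v₁) (z₂.1, z₂.2) y]

/-- A codeword of a wrong message of encoder 1 is uniform and independent of the right ones, so that
it passes the test of encoder 2 with small probability. -/
theorem expect_ideal_other₁ (hL₀ : 0 < L₀) (hL₁ : 0 < L₁) (hL₂ : 0 < L₂)
    (ch : Channel 𝒳₁ 𝒳₂ 𝒮₀ 𝒮₁ 𝒮₂ 𝒴) (aux : AuxLaws 𝒳₁ 𝒳₂ 𝒮₀ 𝒮₁ 𝒮₂ 𝒰 𝒱₁ 𝒱₂) (a w : K₁ × K₂)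
    (B : Tests 𝒳₁ 𝒳₂ 𝒮₀ 𝒴 𝒰 𝒱₁ 𝒱₂) {τ₁ : ℝ} (hτ₁ : 0 < τ₁) {k : K₁} (hk : k ≠ w.1)
    (l' : Fin L₁) :
    𝔼 cb : Codebook K₁ K₂ 𝒰 𝒱₁ 𝒱₂ L₀ L₁ L₂, ideal ch aux cb a w (fun σ l i₁ _ _ =>
        ind (τ₁ < B.b₁ (cb (a, l)).1 σ.1 i₁.2 ((cb (a, l)).2.1 (k, l'))))
      ≤ 1 / (Fintype.card 𝒱₁ * τ₁) := by
  simp only [ideal, ← sum_mul, (ch.W_mem _ _ _ _ _).2, one_mul]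
  rw [expect_sum_comm]
  refine (sum_le_sum (g := fun σ => ch.P σ * (1 / (Fintype.card 𝒱₁ * τ₁)))
    fun σ _ => ?_).trans_eq (by rw [← sum_mul, ch.sum_P, one_mul])
  rw [← mul_expect, expect_commonWeight hL₀ aux a σ.1 fun c =>
    (∑ i₂, weight₂ aux c w.2 σ i₂) * ∑ i₁, weight₁ aux c w.1 σ i₁ *
      ind (τ₁ < B.b₁ c.1 σ.1 i₁.2 (c.2.1 (k, l')))]
  refine mul_le_mul_of_nonneg_left ?_ (ch.P_nonneg σ)
  refine (sum_le_sum (g := fun u => aux.PU σ.1 u * (1 / (Fintype.card 𝒱₁ * τ₁)))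
    fun u _ => ?_).trans_eq (by rw [← sum_mul, (aux.PU_mem _).2, one_mul])
  refine mul_le_mul_of_nonneg_left ?_ ((aux.PU_mem _).1 u)
  simp only [weight₁, weight₂, ← expect_mul]
  rw [expect_sum_pickWeight hL₂, (aux.Q₂_mem _ _ _).2]
  simp only [one_mul]
  exact expect_pickWeight_other_le hL₁ (aux.Q₁_mem _ _ _).1 (aux.Q₁_mem _ _ _).2 hk l'
    (B.b₁_nonneg u σ.1) (B.sum_b₁_le u σ.1) hτ₁

theorem expect_ideal_other₂ (hL₀ : 0 < L₀) (hL₁ : 0 < L₁) (hL₂ : 0 < L₂)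
    (ch : Channel 𝒳₁ 𝒳₂ 𝒮₀ 𝒮₁ 𝒮₂ 𝒴) (aux : AuxLaws 𝒳₁ 𝒳₂ 𝒮₀ 𝒮₁ 𝒮₂ 𝒰 𝒱₁ 𝒱₂) (a w : K₁ × K₂)
    (B : Tests 𝒳₁ 𝒳₂ 𝒮₀ 𝒴 𝒰 𝒱₁ 𝒱₂) {τ₂ : ℝ} (hτ₂ : 0 < τ₂) {k : K₂} (hk : k ≠ w.2)
    (l' : Fin L₂) :
    𝔼 cb : Codebook K₁ K₂ 𝒰 𝒱₁ 𝒱₂ L₀ L₁ L₂, ideal ch aux cb a w (fun σ l _ i₂ _ =>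
        ind (τ₂ < B.b₂ (cb (a, l)).1 σ.1 i₂.2 ((cb (a, l)).2.2 (k, l'))))
      ≤ 1 / (Fintype.card 𝒱₂ * τ₂) := by
  simp only [ideal, ← sum_mul, (ch.W_mem _ _ _ _ _).2, one_mul]
  rw [expect_sum_comm]
  refine (sum_le_sum (g := fun σ => ch.P σ * (1 / (Fintype.card 𝒱₂ * τ₂)))
    fun σ _ => ?_).trans_eq (by rw [← sum_mul, ch.sum_P, one_mul])
  rw [← mul_expect, expect_commonWeight hL₀ aux a σ.1 fun c =>
    ∑ i₂, weight₂ aux c w.2 σ i₂ * ((∑ i₁, weight₁ aux c w.1 σ i₁) *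
      ind (τ₂ < B.b₂ c.1 σ.1 i₂.2 (c.2.2 (k, l'))))]
  refine mul_le_mul_of_nonneg_left ?_ (ch.P_nonneg σ)
  refine (sum_le_sum (g := fun u => aux.PU σ.1 u * (1 / (Fintype.card 𝒱₂ * τ₂)))
    fun u _ => ?_).trans_eq (by rw [← sum_mul, (aux.PU_mem _).2, one_mul])
  refine mul_le_mul_of_nonneg_left ?_ ((aux.PU_mem _).1 u)
  simp only [weight₁, weight₂, mul_left_comm, ← mul_sum, ← mul_expect]
  rw [← expect_mul, expect_sum_pickWeight hL₁, (aux.Q₁_mem _ _ _).2, one_mul]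
  exact expect_pickWeight_other_le hL₂ (aux.Q₂_mem _ _ _).1 (aux.Q₂_mem _ _ _).2 hk l'
    (B.b₂_nonneg u σ.1) (B.sum_b₂_le u σ.1) hτ₂

/-- The words of a wrong pair of common messages are independent of the output, so that they pass
the test of the decoder with small probability. -/
theorem expect_ideal_other (hL₀ : 0 < L₀) (hL₁ : 0 < L₁) (hL₂ : 0 < L₂)
    (ch : Channel 𝒳₁ 𝒳₂ 𝒮₀ 𝒮₁ 𝒮₂ 𝒴) (aux : AuxLaws 𝒳₁ 𝒳₂ 𝒮₀ 𝒮₁ 𝒮₂ 𝒰 𝒱₁ 𝒱₂) {a a' : K₁ × K₂}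
    (w : K₁ × K₂) (ha : a' ≠ a) (B : Tests 𝒳₁ 𝒳₂ 𝒮₀ 𝒴 𝒰 𝒱₁ 𝒱₂) {τ : ℝ} (hτ : 0 < τ)
    (l' : Fin L₀) (l₁ : Fin L₁) (l₂ : Fin L₂) :
    𝔼 cb : Codebook K₁ K₂ 𝒰 𝒱₁ 𝒱₂ L₀ L₁ L₂, ideal ch aux cb a w (fun _ _ _ _ y =>
        ind (τ < B.b y ((cb (a', l')).1, (cb (a', l')).2.1 (w.1, l₁), (cb (a', l')).2.2 (w.2, l₂))))
      ≤ 1 / (Fintype.card 𝒰 * Fintype.card 𝒱₁ * Fintype.card 𝒱₂ * τ) := by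
  set δ : ℝ := 1 / (Fintype.card 𝒰 * Fintype.card 𝒱₁ * Fintype.card 𝒱₂ * τ)
  have hc : ∀ y, 𝔼 c : Word K₁ K₂ 𝒰 𝒱₁ 𝒱₂ L₁ L₂,
      ind (τ < B.b y (c.1, c.2.1 (w.1, l₁), c.2.2 (w.2, l₂))) ≤ δ := fun y => by
    have h := expect_ind_lt_le (B.b_nonneg y) (B.sum_b_le y) hτ
    simp only [expect_prod, Fintype.card_prod, Nat.cast_mul, ← mul_assoc] at h ⊢
    refine le_trans (le_of_eq ?_) h
    refine expect_congr rfl fun u _ => ?_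
    rw [expect_apply_eq (w.1, l₁) fun v₁ => 𝔼 f₂ : K₂ × Fin L₂ → 𝒱₂,
      ind (τ < B.b y (u, v₁, f₂ (w.2, l₂)))]
    refine expect_congr rfl fun v₁ _ => ?_
    rw [expect_apply_eq (w.2, l₂) fun v₂ => ind (τ < B.b y (u, v₁, v₂))]
  -- given the selected codewords, every output passes the test with probability at most `δ`
  have h1 : jointExp ch aux (fun _ _ _ _ _ => δ) = δ := by
    simp only [jointExp, ← sum_mul, (ch.W_mem _ _ _ _ _).2, (aux.Q₁_mem _ _ _).2,
      (aux.Q₂_mem _ _ _).2, (aux.PU_mem _).2, ch.sum_P, one_mul]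
  rw [← h1, ← expect_ideal_true hL₀ hL₁ hL₂ ch aux a w fun _ _ _ _ _ => δ]
  simp only [ideal]
  rw [expect_sum_comm, expect_sum_comm]
  refine sum_le_sum fun σ _ => ?_
  rw [← mul_expect, ← mul_expect, expect_commonWeight_other hL₀ aux ha l' σ.1 fun c c' =>
    ∑ i₂, weight₂ aux c w.2 σ i₂ * ∑ i₁, weight₁ aux c w.1 σ i₁ *
      ∑ y, ch.W i₁.2 i₂.2 σ.1 σ.2.1 σ.2.2 y *
        ind (τ < B.b y (c'.1, c'.2.1 (w.1, l₁), c'.2.2 (w.2, l₂))),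
    expect_commonWeight hL₀ aux a σ.1 fun c =>
    ∑ i₂, weight₂ aux c w.2 σ i₂ * ∑ i₁, weight₁ aux c w.1 σ i₁ *
      ∑ y, ch.W i₁.2 i₂.2 σ.1 σ.2.1 σ.2.2 y * δ]
  refine mul_le_mul_of_nonneg_left ?_ (ch.P_nonneg σ)
  refine sum_le_sum fun u _ => mul_le_mul_of_nonneg_left ?_ ((aux.PU_mem _).1 u)
  refine expect_le_expect fun f₁ _ => expect_le_expect fun f₂ _ => ?_
  simp only [expect_sum_comm, ← mul_expect]
  refine sum_le_sum fun i₂ _ => mul_le_mul_of_nonneg_left ?_ (weight₂_nonneg _ _ _ _ _)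
  refine sum_le_sum fun i₁ _ => mul_le_mul_of_nonneg_left ?_ (weight₁_nonneg _ _ _ _ _)
  exact sum_le_sum fun y _ => mul_le_mul_of_nonneg_left (hc y) ((ch.W_mem _ _ _ _ _).1 _)

end OneShot

section OneShotBound

variable {K₁ K₂ 𝒳₁ 𝒳₂ 𝒮₀ 𝒮₁ 𝒮₂ 𝒴 𝒰 𝒱₁ 𝒱₂ : Type*}
  [Fintype 𝒳₁] [Fintype 𝒳₂] [Fintype 𝒮₀] [Fintype 𝒮₁] [Fintype 𝒮₂] [Fintype 𝒴]
  [Fintype 𝒰] [Fintype 𝒱₁] [Fintype 𝒱₂]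
  [Fintype K₁] [DecidableEq K₁] [Nonempty K₁] [Fintype K₂] [DecidableEq K₂] [Nonempty K₂]
  [Nonempty 𝒰] [Nonempty 𝒱₁] [Nonempty 𝒱₂]

/-- The bound for the error of a selection rule with `L` uniform codewords from an alphabet of `N`
letters, when the wanted law has mass `π` above the threshold `t`. -/
noncomputable def coverBound (π t : ℝ) (N L : ℕ) : ℝ := 2 * π + √(N * t / L)

theorem sum_mul_le_two_mul_add {α : Type*} [Fintype α] {p : α → ℝ} (hp : ∀ x, 0 ≤ p x)
    (hp1 : ∑ x, p x = 1) {F G : α → ℝ} {s : ℝ} (h : ∀ x, F x ≤ 2 * G x + s) :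
    ∑ x, p x * F x ≤ 2 * ∑ x, p x * G x + s := by
  calc ∑ x, p x * F x ≤ ∑ x, p x * (2 * G x + s) :=
        sum_le_sum fun x _ => mul_le_mul_of_nonneg_left (h x) (hp x)
    _ = 2 * ∑ x, p x * G x + s := by
        simp only [mul_add, sum_add_distrib, ← sum_mul, hp1, one_mul, mul_sum]
        exact congrArg (· + s) (sum_congr rfl fun x _ => mul_left_comm _ _ _)

section Defects

variable {L₀ L₁ L₂ : ℕ} (hL₀ : 0 < L₀) (hL₁ : 0 < L₁) (hL₂ : 0 < L₂)
  (ch : Channel 𝒳₁ 𝒳₂ 𝒮₀ 𝒮₁ 𝒮₂ 𝒴) (aux : AuxLaws 𝒳₁ 𝒳₂ 𝒮₀ 𝒮₁ 𝒮₂ 𝒰 𝒱₁ 𝒱₂) (a w : K₁ × K₂)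
include hL₀

theorem expect_defect_common {t : ℝ} (ht : 0 ≤ t) :
    𝔼 cb : Codebook K₁ K₂ 𝒰 𝒱₁ 𝒱₂ L₀ L₁ L₂,
        ∑ σ, ch.P σ * |1 - ∑ l, commonWeight aux cb a σ.1 l|
      ≤ coverBound (jointExp ch aux fun σ u _ _ _ => ind (t < aux.PU σ.1 u)) t
          (Fintype.card 𝒰) L₀ := by
  have h : jointExp ch aux (fun σ u _ _ _ => ind (t < aux.PU σ.1 u))
      = ∑ σ, ch.P σ * ∑ u, aux.PU σ.1 u * ind (t < aux.PU σ.1 u) := by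
    simp only [jointExp, ← sum_mul, (ch.W_mem _ _ _ _ _).2, (aux.Q₁_mem _ _ _).2,
      (aux.Q₂_mem _ _ _).2, one_mul]
  rw [expect_sum_comm, coverBound, h]
  simp only [← mul_expect]
  exact sum_mul_le_two_mul_add ch.P_nonneg ch.sum_P fun σ =>
    expect_abs_one_sub_commonWeight_le hL₀ aux a σ.1 ht

include hL₂ in
theorem expect_defect₂ {t : ℝ} (ht : 0 ≤ t) :
    𝔼 cb : Codebook K₁ K₂ 𝒰 𝒱₁ 𝒱₂ L₀ L₁ L₂,
        ∑ σ, ch.P σ * ∑ l, commonWeight aux cb a σ.1 l *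
          |1 - ∑ i₂, weight₂ aux (cb (a, l)) w.2 σ i₂|
      ≤ coverBound (jointExp ch aux fun σ u _ z₂ _ => ind (t < ∑ x, aux.Q₂ u σ.1 σ.2.2 (x, z₂.2))) t
          (Fintype.card 𝒱₂) L₂ := by
  have h : jointExp ch aux (fun σ u _ z₂ _ => ind (t < ∑ x, aux.Q₂ u σ.1 σ.2.2 (x, z₂.2)))
      = ∑ σ, ch.P σ * ∑ u, aux.PU σ.1 u * ∑ z₂, aux.Q₂ u σ.1 σ.2.2 z₂ *
        ind (t < ∑ x, aux.Q₂ u σ.1 σ.2.2 (x, z₂.2)) := by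
    simp only [jointExp, ← sum_mul, (ch.W_mem _ _ _ _ _).2, (aux.Q₁_mem _ _ _).2, one_mul]
  rw [expect_sum_comm, coverBound, h]
  simp only [← mul_expect]
  refine sum_mul_le_two_mul_add ch.P_nonneg ch.sum_P fun σ => ?_
  rw [expect_commonWeight hL₀ aux a σ.1 fun c => |1 - ∑ i₂, weight₂ aux c w.2 σ i₂|]
  refine sum_mul_le_two_mul_add (aux.PU_mem _).1 (aux.PU_mem _).2 fun u => ?_
  simp only [weight₂, Fintype.expect_const]
  exact expect_abs_one_sub_pickWeight_le hL₂ (aux.Q₂_mem _ _ _).1 (aux.Q₂_mem _ _ _).2 _ ht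

include hL₁ hL₂ in
theorem expect_defect₁ {t : ℝ} (ht : 0 ≤ t) :
    𝔼 cb : Codebook K₁ K₂ 𝒰 𝒱₁ 𝒱₂ L₀ L₁ L₂,
        ∑ σ, ch.P σ * ∑ l, commonWeight aux cb a σ.1 l *
          ∑ i₂, weight₂ aux (cb (a, l)) w.2 σ i₂ *
            |1 - ∑ i₁, weight₁ aux (cb (a, l)) w.1 σ i₁|
      ≤ coverBound (jointExp ch aux fun σ u z₁ _ _ => ind (t < ∑ x, aux.Q₁ u σ.1 σ.2.1 (x, z₁.2))) t
          (Fintype.card 𝒱₁) L₁ := by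
  have h : jointExp ch aux (fun σ u z₁ _ _ => ind (t < ∑ x, aux.Q₁ u σ.1 σ.2.1 (x, z₁.2)))
      = ∑ σ, ch.P σ * ∑ u, aux.PU σ.1 u * ∑ z₁, aux.Q₁ u σ.1 σ.2.1 z₁ *
        ind (t < ∑ x, aux.Q₁ u σ.1 σ.2.1 (x, z₁.2)) := by
    simp only [jointExp, ← sum_mul, (ch.W_mem _ _ _ _ _).2, (aux.Q₂_mem _ _ _).2, one_mul]
  rw [expect_sum_comm, coverBound, h]
  simp only [← mul_expect, ← sum_mul]
  refine sum_mul_le_two_mul_add ch.P_nonneg ch.sum_P fun σ => ?_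
  rw [expect_commonWeight hL₀ aux a σ.1 fun c =>
    (∑ i₂, weight₂ aux c w.2 σ i₂) * |1 - ∑ i₁, weight₁ aux c w.1 σ i₁|]
  refine sum_mul_le_two_mul_add (aux.PU_mem _).1 (aux.PU_mem _).2 fun u => ?_
  simp only [weight₁, weight₂, ← expect_mul]
  rw [expect_sum_pickWeight hL₂, (aux.Q₂_mem _ _ _).2]
  simp only [one_mul]
  exact expect_abs_one_sub_pickWeight_le hL₁ (aux.Q₁_mem _ _ _).1 (aux.Q₁_mem _ _ _).2 _ ht

end Defects

/-- The one-shot bound: the defects of the three selections, and for each of the three tests the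
probability that the right codewords fail it and a union bound over the wrong ones. -/
noncomputable def oneShotBound (ch : Channel 𝒳₁ 𝒳₂ 𝒮₀ 𝒮₁ 𝒮₂ 𝒴)
    (aux : AuxLaws 𝒳₁ 𝒳₂ 𝒮₀ 𝒮₁ 𝒮₂ 𝒰 𝒱₁ 𝒱₂) (B : Tests 𝒳₁ 𝒳₂ 𝒮₀ 𝒴 𝒰 𝒱₁ 𝒱₂)
    (k₁ k₂ L₀ L₁ L₂ : ℕ) (t₀ t₁ t₂ τ₁ τ₂ τ : ℝ) : ℝ :=
  coverBound (jointExp ch aux fun σ u _ _ _ => ind (t₀ < aux.PU σ.1 u)) t₀ (Fintype.card 𝒰) L₀ +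
  (coverBound (jointExp ch aux fun σ u _ z₂ _ => ind (t₂ < ∑ x, aux.Q₂ u σ.1 σ.2.2 (x, z₂.2))) t₂
    (Fintype.card 𝒱₂) L₂ +
  (coverBound (jointExp ch aux fun σ u z₁ _ _ => ind (t₁ < ∑ x, aux.Q₁ u σ.1 σ.2.1 (x, z₁.2))) t₁
    (Fintype.card 𝒱₁) L₁ +
  ((jointExp ch aux (fun σ u z₁ _ _ => ind (B.b₁ u σ.1 z₁.1 z₁.2 ≤ τ₁)) +
    ((k₁ : ℝ) - 1) * (L₁ * (1 / (Fintype.card 𝒱₁ * τ₁)))) +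
  ((jointExp ch aux (fun σ u _ z₂ _ => ind (B.b₂ u σ.1 z₂.1 z₂.2 ≤ τ₂)) +
    ((k₂ : ℝ) - 1) * (L₂ * (1 / (Fintype.card 𝒱₂ * τ₂)))) +
  (jointExp ch aux (fun _ u z₁ z₂ y => ind (B.b y (u, z₁.2, z₂.2) ≤ τ)) +
    (k₁ : ℝ) * k₂ * (L₀ * (L₁ * (L₂ *
      (1 / (Fintype.card 𝒰 * Fintype.card 𝒱₁ * Fintype.card 𝒱₂ * τ))))))))))

theorem expect_cost_le {L₀ L₁ L₂ : ℕ} (hL₀ : 0 < L₀) (hL₁ : 0 < L₁) (hL₂ : 0 < L₂)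
    (ch : Channel 𝒳₁ 𝒳₂ 𝒮₀ 𝒮₁ 𝒮₂ 𝒴) (aux : AuxLaws 𝒳₁ 𝒳₂ 𝒮₀ 𝒮₁ 𝒮₂ 𝒰 𝒱₁ 𝒱₂)
    (B : Tests 𝒳₁ 𝒳₂ 𝒮₀ 𝒴 𝒰 𝒱₁ 𝒱₂) {t₀ t₁ t₂ τ₁ τ₂ τ : ℝ} (ht₀ : 0 ≤ t₀) (ht₁ : 0 ≤ t₁)
    (ht₂ : 0 ≤ t₂) (hτ₁ : 0 < τ₁) (hτ₂ : 0 < τ₂) (hτ : 0 < τ) (a w : K₁ × K₂) :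
    𝔼 cb : Codebook K₁ K₂ 𝒰 𝒱₁ 𝒱₂ L₀ L₁ L₂, cost ch aux B τ₁ τ₂ τ cb a w
      ≤ oneShotBound ch aux B (Fintype.card K₁) (Fintype.card K₂) L₀ L₁ L₂ t₀ t₁ t₂ τ₁ τ₂ τ := by
  simp only [cost, expect_add_distrib]
  refine add_le_add (expect_defect_common hL₀ ch aux a ht₀) (add_le_add
    (expect_defect₂ hL₀ hL₂ ch aux a w ht₂) (add_le_add
    (expect_defect₁ hL₀ hL₁ hL₂ ch aux a w ht₁) ?_))
  refine (expect_le_expect fun cb _ => ideal_mono ch aux cb a w fun σ l i₁ i₂ y =>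
    ind_badEvent_le B τ₁ τ₂ τ cb a w l σ.1 i₁.2 i₂.2 y i₁.1 i₂.1).trans ?_
  simp only [ideal_add, ideal_sum, expect_add_distrib, expect_sum_comm]
  refine add_le_add (add_le_add (expect_ideal_true hL₀ hL₁ hL₂ ch aux a w fun σ u z₁ _ _ =>
    ind (B.b₁ u σ.1 z₁.1 z₁.2 ≤ τ₁)).le ?_) (add_le_add (add_le_add
    (expect_ideal_true hL₀ hL₁ hL₂ ch aux a w fun σ u _ z₂ _ =>
    ind (B.b₂ u σ.1 z₂.1 z₂.2 ≤ τ₂)).le ?_) (add_le_add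
    (expect_ideal_true hL₀ hL₁ hL₂ ch aux a w fun _ u z₁ z₂ y =>
    ind (B.b y (u, z₁.2, z₂.2) ≤ τ)).le ?_))
  · refine (sum_le_sum fun k hk => sum_le_sum fun l _ =>
      expect_ideal_other₁ hL₀ hL₁ hL₂ ch aux a w B hτ₁ (ne_of_mem_erase hk) l).trans_eq ?_
    simp only [sum_const, card_univ, Fintype.card_fin, nsmul_eq_mul,
      card_erase_of_mem (mem_univ _), Nat.cast_pred (Fintype.card_pos (α := K₁))]
  · refine (sum_le_sum fun k hk => sum_le_sum fun l _ =>
      expect_ideal_other₂ hL₀ hL₁ hL₂ ch aux a w B hτ₂ (ne_of_mem_erase hk) l).trans_eq ?_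
    simp only [sum_const, card_univ, Fintype.card_fin, nsmul_eq_mul,
      card_erase_of_mem (mem_univ _), Nat.cast_pred (Fintype.card_pos (α := K₂))]
  · refine (sum_le_sum fun k hk => sum_le_sum fun l _ => sum_le_sum fun l₁ _ =>
      sum_le_sum fun l₂ _ => expect_ideal_other hL₀ hL₁ hL₂ ch aux w (ne_of_mem_erase hk) B hτ
        l l₁ l₂).trans ?_
    simp only [sum_const, card_univ, Fintype.card_fin, nsmul_eq_mul]
    refine mul_le_mul_of_nonneg_right ?_ (by positivity)
    rw [← Nat.cast_mul, ← Fintype.card_prod]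
    exact_mod_cast card_le_univ _

/-- One-shot achievability: some code for one block is good on average over any given finite family
of pairs of messages. -/
theorem exists_blockCode_le {L₀ L₁ L₂ : ℕ} (hL₀ : 0 < L₀) (hL₁ : 0 < L₁) (hL₂ : 0 < L₂)
    [Nonempty 𝒳₁] [Nonempty 𝒳₂]
    (ch : Channel 𝒳₁ 𝒳₂ 𝒮₀ 𝒮₁ 𝒮₂ 𝒴) (aux : AuxLaws 𝒳₁ 𝒳₂ 𝒮₀ 𝒮₁ 𝒮₂ 𝒰 𝒱₁ 𝒱₂)
    (B : Tests 𝒳₁ 𝒳₂ 𝒮₀ 𝒴 𝒰 𝒱₁ 𝒱₂) {t₀ t₁ t₂ τ₁ τ₂ τ : ℝ} (ht₀ : 0 ≤ t₀) (ht₁ : 0 ≤ t₁)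
    (ht₂ : 0 ≤ t₂) (hτ₁ : 0 < τ₁) (hτ₂ : 0 < τ₂) (hτ : 0 < τ) {T : Type*} [Fintype T]
    (a w : T → K₁ × K₂) :
    ∃ C : BlockCode K₁ K₂ 𝒳₁ 𝒳₂ 𝒮₀ 𝒮₁ 𝒮₂ 𝒴, ∑ t, C.err ch (a t) (w t) ≤ Fintype.card T *
      oneShotBound ch aux B (Fintype.card K₁) (Fintype.card K₂) L₀ L₁ L₂ t₀ t₁ t₂ τ₁ τ₂ τ := by
  obtain ⟨cb, hcb⟩ := exists_le_of_expect_le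
    (F := fun cb : Codebook K₁ K₂ 𝒰 𝒱₁ 𝒱₂ L₀ L₁ L₂ => ∑ t, cost ch aux B τ₁ τ₂ τ cb (a t) (w t))
    (c := Fintype.card T *
      oneShotBound ch aux B (Fintype.card K₁) (Fintype.card K₂) L₀ L₁ L₂ t₀ t₁ t₂ τ₁ τ₂ τ) (by
    rw [expect_sum_comm, ← nsmul_eq_mul, ← card_univ]
    exact sum_le_card_nsmul _ _ _ fun t _ =>
      expect_cost_le hL₀ hL₁ hL₂ ch aux B ht₀ ht₁ ht₂ hτ₁ hτ₂ hτ (a t) (w t))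
  obtain ⟨C, hC⟩ := exists_blockCode_le_cost hL₀ hL₁ hL₂ ch aux B τ₁ τ₂ τ cb a w
  exact ⟨C, hC.trans hcb⟩

end OneShotBound

/-! ### Products of pmfs and their concentration -/

section Concentration

variable {Ω : Type*} [Fintype Ω] {p f : Ω → ℝ}

/-- Chebyshev's inequality for a sum of independent copies of `g`. -/
theorem sum_pi_ind_le (hp : ∀ ω, 0 ≤ p ω) (hp1 : ∑ ω, p ω = 1) {g : Ω → ℝ}
    (hg : ∑ ω, p ω * g ω = 0) {m : ℕ} (hm : 0 < m) {δ : ℝ} (hδ : 0 < δ) {A : (Fin m → Ω) → Prop}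
    (hA : ∀ ω, (∀ j, p (ω j) ≠ 0) → A ω → m * δ ≤ |∑ j, g (ω j)|) :
    ∑ ω : Fin m → Ω, (∏ j, p (ω j)) * ind (A ω) ≤ (∑ ω, p ω * g ω ^ 2) / (m * δ ^ 2) := by
  have hm' : (0 : ℝ) < m := by exact_mod_cast hm
  have key : ∀ ω : Fin m → Ω, (∏ j, p (ω j)) * ind (A ω)
      ≤ (∏ j, p (ω j)) * (∑ j, g (ω j)) ^ 2 / (m * δ) ^ 2 := fun ω => by
    have h0 : 0 ≤ ∏ j, p (ω j) := prod_nonneg fun j _ => hp _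
    by_cases hz : ∏ j, p (ω j) = 0
    · simp [hz]
    by_cases ha : A ω
    · have h1 := hA ω (fun j hj => hz (prod_eq_zero (mem_univ j) hj)) ha
      rw [ind_of ha, mul_one, le_div_iff₀ (by positivity)]
      refine mul_le_mul_of_nonneg_left ?_ h0
      rw [← sq_abs (∑ j, g (ω j))]
      exact pow_le_pow_left₀ (by positivity) h1 2
    · rw [ind_of_not ha, mul_zero]
      exact div_nonneg (mul_nonneg h0 (sq_nonneg _)) (sq_nonneg _)
  refine (sum_le_sum fun ω _ => key ω).trans_eq ?_
  rw [← sum_div, sum_pi_sum_sq hp1 hg, Fintype.card_fin]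
  field_simp

theorem logb_prod_of_pos {m : ℕ} {ω : Fin m → Ω} (hf : ∀ j, 0 < f (ω j)) :
    Real.logb 2 (∏ j, f (ω j)) = ∑ j, Real.logb 2 (f (ω j)) :=
  Real.logb_prod _ _ fun j _ => (hf j).ne'

/-- The variance of `log₂ f`. -/
noncomputable def logVar (p f : Ω → ℝ) : ℝ :=
  ∑ ω, p ω * (Real.logb 2 (f ω) - ∑ ω, p ω * Real.logb 2 (f ω)) ^ 2

theorem sum_pi_ind_lt_le (hp : ∀ ω, 0 ≤ p ω) (hp1 : ∑ ω, p ω = 1)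
    (hf : ∀ ω, p ω ≠ 0 → 0 < f ω) {m : ℕ} (hm : 0 < m) {δ : ℝ} (hδ : 0 < δ) :
    ∑ ω : Fin m → Ω, (∏ j, p (ω j)) *
        ind ((2 : ℝ) ^ (m * (∑ ω, p ω * Real.logb 2 (f ω) + δ)) < ∏ j, f (ω j))
      ≤ logVar p f / (m * δ ^ 2) := by
  refine sum_pi_ind_le hp hp1 ?_ hm hδ fun ω hω hA => ?_
  · simp only [mul_sub, sum_sub_distrib, ← sum_mul, hp1, one_mul, sub_self]
  · have h1 := Real.logb_lt_logb one_lt_two (by positivity) hA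
    rw [Real.logb_rpow two_pos (by norm_num), logb_prod_of_pos fun j => hf _ (hω j)] at h1
    refine le_trans ?_ (le_abs_self _)
    simp only [sum_sub_distrib, sum_const, card_univ, Fintype.card_fin, nsmul_eq_mul]
    linarith

theorem sum_pi_ind_le_le (hp : ∀ ω, 0 ≤ p ω) (hp1 : ∑ ω, p ω = 1)
    (hf : ∀ ω, p ω ≠ 0 → 0 < f ω) {m : ℕ} (hm : 0 < m) {δ : ℝ} (hδ : 0 < δ) :
    ∑ ω : Fin m → Ω, (∏ j, p (ω j)) *
        ind (∏ j, f (ω j) ≤ (2 : ℝ) ^ (m * (∑ ω, p ω * Real.logb 2 (f ω) - δ)))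
      ≤ logVar p f / (m * δ ^ 2) := by
  refine sum_pi_ind_le hp hp1 ?_ hm hδ fun ω hω hA => ?_
  · simp only [mul_sub, sum_sub_distrib, ← sum_mul, hp1, one_mul, sub_self]
  · have h1 := Real.logb_le_logb_of_le one_lt_two (prod_pos fun j _ => hf _ (hω j)) hA
    rw [Real.logb_rpow two_pos (by norm_num), logb_prod_of_pos fun j => hf _ (hω j)] at h1
    refine le_trans ?_ (neg_le_abs _)
    simp only [sum_sub_distrib, sum_const, card_univ, Fintype.card_fin, nsmul_eq_mul]
    linarith

/-- A form of Gibbs' inequality. -/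
theorem logb_add_sum_nonneg (hp : ∀ ω, 0 ≤ p ω) (hp1 : ∑ ω, p ω = 1)
    (hf : ∀ ω, p ω ≠ 0 → 0 < f ω) {N : ℝ} (hN : 0 < N) (h : ∑ ω, p ω * (f ω)⁻¹ ≤ N) :
    0 ≤ Real.logb 2 N + ∑ ω, p ω * Real.logb 2 (f ω) := by
  have hlog2 : 0 < Real.log 2 := Real.log_pos one_lt_two
  have key : ∀ ω, p ω * (1 - (f ω)⁻¹ / N) ≤ p ω * (Real.log N + Real.log (f ω)) := fun ω => by
    by_cases hω : p ω = 0
    · simp [hω]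
    · refine mul_le_mul_of_nonneg_left ?_ (hp ω)
      have hfω := hf ω hω
      rw [← Real.log_mul hN.ne' hfω.ne']
      have h1 := Real.one_sub_inv_le_log_of_pos (mul_pos hN hfω)
      refine le_trans (le_of_eq ?_) h1
      rw [mul_inv]; ring
  have h2 := sum_le_sum fun ω (_ : ω ∈ (univ : Finset Ω)) => key ω
  simp only [mul_add, mul_sub, mul_one, sum_add_distrib, sum_sub_distrib, ← sum_mul, hp1, one_mul,
    ← mul_div_assoc, ← sum_div] at h2
  have h3 : (∑ ω, p ω * (f ω)⁻¹) / N ≤ 1 := (div_le_one hN).2 h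
  have h4 : Real.logb 2 N + ∑ ω, p ω * Real.logb 2 (f ω)
      = (Real.log N + ∑ ω, p ω * Real.log (f ω)) / Real.log 2 := by
    simp only [Real.logb, ← mul_div_assoc, ← sum_div, add_div]
  rw [h4]
  exact div_nonneg (by linarith) hlog2.le

end Concentration

/-! ### Block lengths -/

theorem prod_mem_stdSimplex {α : Type*} [Fintype α] {m : ℕ} {p : Fin m → α → ℝ}
    (hp : ∀ j, p j ∈ stdSimplex ℝ α) :
    (fun f : Fin m → α => ∏ j, p j (f j)) ∈ stdSimplex ℝ (Fin m → α) :=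
  ⟨fun _ => prod_nonneg fun j _ => (hp j).1 _, sum_pi_prod_eq_one fun j => (hp j).2⟩

theorem prod_mem_stdSimplex_prod {α β : Type*} [Fintype α] [Fintype β] {m : ℕ}
    {p : Fin m → α × β → ℝ} (hp : ∀ j, p j ∈ stdSimplex ℝ (α × β)) :
    (fun z : (Fin m → α) × (Fin m → β) => ∏ j, p j (z.1 j, z.2 j))
      ∈ stdSimplex ℝ ((Fin m → α) × (Fin m → β)) := by
  refine ⟨fun _ => prod_nonneg fun j _ => (hp j).1 _, ?_⟩
  rw [← sum_pi_prod_eq_one fun j => (hp j).2]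
  exact ((Equiv.arrowProdEquivProdArrow (Fin m) (fun _ => α) (fun _ => β)).sum_comp
    fun z => ∏ j, p j (z.1 j, z.2 j)).symm

section Power

variable {𝒳₁ 𝒳₂ 𝒮₀ 𝒮₁ 𝒮₂ 𝒴 𝒰 𝒱₁ 𝒱₂ : Type*}
  [Fintype 𝒳₁] [Fintype 𝒳₂] [Fintype 𝒮₀] [Fintype 𝒮₁] [Fintype 𝒮₂] [Fintype 𝒴]
  [Fintype 𝒰] [Fintype 𝒱₁] [Fintype 𝒱₂]

/-- `m` uses of a channel, as one use of a channel with super-letters. -/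
def Channel.pow (ch : Channel 𝒳₁ 𝒳₂ 𝒮₀ 𝒮₁ 𝒮₂ 𝒴) (m : ℕ) :
    Channel (Fin m → 𝒳₁) (Fin m → 𝒳₂) (Fin m → 𝒮₀) (Fin m → 𝒮₁) (Fin m → 𝒮₂) (Fin m → 𝒴) where
  P₀ s := ∏ j, ch.P₀ (s j)
  P₁ s := ∏ j, ch.P₁ (s j)
  P₂ s := ∏ j, ch.P₂ (s j)
  W x₁ x₂ s₀ s₁ s₂ y := ∏ j, ch.W (x₁ j) (x₂ j) (s₀ j) (s₁ j) (s₂ j) (y j)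
  P₀_mem := prod_mem_stdSimplex fun _ => ch.P₀_mem
  P₁_mem := prod_mem_stdSimplex fun _ => ch.P₁_mem
  P₂_mem := prod_mem_stdSimplex fun _ => ch.P₂_mem
  W_mem _ _ _ _ _ := prod_mem_stdSimplex fun _ => ch.W_mem _ _ _ _ _

/-- `m` independent copies of the auxiliary laws. -/
def AuxLaws.pow (aux : AuxLaws 𝒳₁ 𝒳₂ 𝒮₀ 𝒮₁ 𝒮₂ 𝒰 𝒱₁ 𝒱₂) (m : ℕ) :
    AuxLaws (Fin m → 𝒳₁) (Fin m → 𝒳₂) (Fin m → 𝒮₀) (Fin m → 𝒮₁) (Fin m → 𝒮₂)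
      (Fin m → 𝒰) (Fin m → 𝒱₁) (Fin m → 𝒱₂) where
  PU s₀ u := ∏ j, aux.PU (s₀ j) (u j)
  Q₁ u s₀ s₁ z := ∏ j, aux.Q₁ (u j) (s₀ j) (s₁ j) (z.1 j, z.2 j)
  Q₂ u s₀ s₂ z := ∏ j, aux.Q₂ (u j) (s₀ j) (s₂ j) (z.1 j, z.2 j)
  PU_mem _ := prod_mem_stdSimplex fun _ => aux.PU_mem _
  Q₁_mem _ _ _ := prod_mem_stdSimplex_prod fun _ => aux.Q₁_mem _ _ _
  Q₂_mem _ _ _ := prod_mem_stdSimplex_prod fun _ => aux.Q₂_mem _ _ _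

theorem sum_prod_le_one {α : Type*} [Fintype α] {m : ℕ} {p : Fin m → α → ℝ}
    (h0 : ∀ j x, 0 ≤ p j x) (h1 : ∀ j, ∑ x, p j x ≤ 1) : ∑ f : Fin m → α, ∏ j, p j (f j) ≤ 1 := by
  rw [← Fintype.prod_sum]
  exact prod_le_one (fun j _ => sum_nonneg fun x _ => h0 j x) fun j _ => h1 j

/-- The products of tests. -/
def Tests.pow (B : Tests 𝒳₁ 𝒳₂ 𝒮₀ 𝒴 𝒰 𝒱₁ 𝒱₂) (m : ℕ) :
    Tests (Fin m → 𝒳₁) (Fin m → 𝒳₂) (Fin m → 𝒮₀) (Fin m → 𝒴) (Fin m → 𝒰) (Fin m → 𝒱₁)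
      (Fin m → 𝒱₂) where
  b₁ u s x v := ∏ j, B.b₁ (u j) (s j) (x j) (v j)
  b₂ u s x v := ∏ j, B.b₂ (u j) (s j) (x j) (v j)
  b y c := ∏ j, B.b (y j) (c.1 j, c.2.1 j, c.2.2 j)
  b₁_nonneg _ _ _ _ := prod_nonneg fun _ _ => B.b₁_nonneg _ _ _ _
  b₂_nonneg _ _ _ _ := prod_nonneg fun _ _ => B.b₂_nonneg _ _ _ _
  b_nonneg _ _ := prod_nonneg fun _ _ => B.b_nonneg _ _
  sum_b₁_le _ _ _ := sum_prod_le_one (fun _ => B.b₁_nonneg _ _ _) fun _ => B.sum_b₁_le _ _ _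
  sum_b₂_le _ _ _ := sum_prod_le_one (fun _ => B.b₂_nonneg _ _ _) fun _ => B.sum_b₂_le _ _ _
  sum_b_le y := by
    let e : (Fin m → 𝒰 × 𝒱₁ × 𝒱₂) ≃ (Fin m → 𝒰) × (Fin m → 𝒱₁) × (Fin m → 𝒱₂) :=
      { toFun := fun c => (fun j => (c j).1, fun j => (c j).2.1, fun j => (c j).2.2)
        invFun := fun c j => (c.1 j, c.2.1 j, c.2.2 j)
        left_inv := fun _ => rfl
        right_inv := fun _ => rfl }
    rw [← e.sum_comp]
    exact sum_prod_le_one (p := fun j c => B.b (y j) c) (fun _ => B.b_nonneg _)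
      fun _ => B.sum_b_le _

/-- A function of the arguments of `jointExp`, as a function on the sample space. -/
def onSample (f : 𝒮₀ × 𝒮₁ × 𝒮₂ → 𝒰 → 𝒳₁ × 𝒱₁ → 𝒳₂ × 𝒱₂ → 𝒴 → ℝ)
    (ω : 𝒮₀ × 𝒮₁ × 𝒮₂ × 𝒰 × 𝒱₁ × 𝒱₂ × 𝒳₁ × 𝒳₂ × 𝒴) : ℝ :=
  f (ω.1, ω.2.1, ω.2.2.1) ω.2.2.2.1 (ω.2.2.2.2.2.2.1, ω.2.2.2.2.1)
    (ω.2.2.2.2.2.2.2.1, ω.2.2.2.2.2.1) ω.2.2.2.2.2.2.2.2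

variable (ch : Channel 𝒳₁ 𝒳₂ 𝒮₀ 𝒮₁ 𝒮₂ 𝒴) (aux : AuxLaws 𝒳₁ 𝒳₂ 𝒮₀ 𝒮₁ 𝒮₂ 𝒰 𝒱₁ 𝒱₂)

theorem jointLaw_nonneg (ω : 𝒮₀ × 𝒮₁ × 𝒮₂ × 𝒰 × 𝒱₁ × 𝒱₂ × 𝒳₁ × 𝒳₂ × 𝒴) :
    0 ≤ jointLaw ch aux ω := by
  have := ch.P₀_mem.1 ω.1
  have := ch.P₁_mem.1 ω.2.1
  have := ch.P₂_mem.1 ω.2.2.1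
  have := (aux.PU_mem ω.1).1 ω.2.2.2.1
  have := (aux.Q₁_mem ω.2.2.2.1 ω.1 ω.2.1).1 (ω.2.2.2.2.2.2.1, ω.2.2.2.2.1)
  have := (aux.Q₂_mem ω.2.2.2.1 ω.1 ω.2.2.1).1 (ω.2.2.2.2.2.2.2.1, ω.2.2.2.2.2.1)
  have := (ch.W_mem ω.2.2.2.2.2.2.1 ω.2.2.2.2.2.2.2.1 ω.1 ω.2.1 ω.2.2.1).1 ω.2.2.2.2.2.2.2.2
  unfold jointLaw
  positivity

theorem jointExp_eq_sum_onSample (G : 𝒮₀ × 𝒮₁ × 𝒮₂ → 𝒰 → 𝒳₁ × 𝒱₁ → 𝒳₂ × 𝒱₂ → 𝒴 → ℝ) :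
    jointExp ch aux G = ∑ ω, jointLaw ch aux ω * onSample G ω :=
  jointExp_eq_sum ch aux G

theorem jointExp_one : jointExp ch aux (fun _ _ _ _ _ => 1) = 1 := by
  simp only [jointExp, ← sum_mul, (ch.W_mem _ _ _ _ _).2, (aux.Q₁_mem _ _ _).2,
    (aux.Q₂_mem _ _ _).2, (aux.PU_mem _).2, ch.sum_P, one_mul]

theorem sum_jointLaw : ∑ ω, jointLaw ch aux ω = 1 := by
  rw [← jointExp_one ch aux, jointExp_eq_sum]
  simp only [mul_one]

/-- The joint law of a block is a product. -/
theorem jointExp_pow (m : ℕ) (G : (Fin m → 𝒮₀) × (Fin m → 𝒮₁) × (Fin m → 𝒮₂) → (Fin m → 𝒰) →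
      (Fin m → 𝒳₁) × (Fin m → 𝒱₁) → (Fin m → 𝒳₂) × (Fin m → 𝒱₂) → (Fin m → 𝒴) → ℝ) :
    jointExp (ch.pow m) (aux.pow m) G =
      ∑ ω : Fin m → 𝒮₀ × 𝒮₁ × 𝒮₂ × 𝒰 × 𝒱₁ × 𝒱₂ × 𝒳₁ × 𝒳₂ × 𝒴, (∏ j, jointLaw ch aux (ω j)) *
        G (fun j => (ω j).1, fun j => (ω j).2.1, fun j => (ω j).2.2.1) (fun j => (ω j).2.2.2.1)
          (fun j => (ω j).2.2.2.2.2.2.1, fun j => (ω j).2.2.2.2.1)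
          (fun j => (ω j).2.2.2.2.2.2.2.1, fun j => (ω j).2.2.2.2.2.1)
          (fun j => (ω j).2.2.2.2.2.2.2.2) := by
  let e : (Fin m → 𝒮₀ × 𝒮₁ × 𝒮₂ × 𝒰 × 𝒱₁ × 𝒱₂ × 𝒳₁ × 𝒳₂ × 𝒴) ≃
      (Fin m → 𝒮₀) × (Fin m → 𝒮₁) × (Fin m → 𝒮₂) × (Fin m → 𝒰) × (Fin m → 𝒱₁) × (Fin m → 𝒱₂) ×
        (Fin m → 𝒳₁) × (Fin m → 𝒳₂) × (Fin m → 𝒴) :=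
    { toFun := fun ω => (fun j => (ω j).1, fun j => (ω j).2.1, fun j => (ω j).2.2.1,
        fun j => (ω j).2.2.2.1, fun j => (ω j).2.2.2.2.1, fun j => (ω j).2.2.2.2.2.1,
        fun j => (ω j).2.2.2.2.2.2.1, fun j => (ω j).2.2.2.2.2.2.2.1,
        fun j => (ω j).2.2.2.2.2.2.2.2)
      invFun := fun z j => (z.1 j, z.2.1 j, z.2.2.1 j, z.2.2.2.1 j, z.2.2.2.2.1 j,
        z.2.2.2.2.2.1 j, z.2.2.2.2.2.2.1 j, z.2.2.2.2.2.2.2.1 j, z.2.2.2.2.2.2.2.2 j)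
      left_inv := fun _ => rfl
      right_inv := fun _ => rfl }
  rw [jointExp_eq_sum, ← e.sum_comp]
  refine sum_congr rfl fun ω _ => ?_
  congr 1
  simp only [jointLaw, Channel.pow, AuxLaws.pow, prod_mul_distrib]
  rfl

/-- The expectation of `log₂ f`. -/
noncomputable def logMean (f : 𝒮₀ × 𝒮₁ × 𝒮₂ → 𝒰 → 𝒳₁ × 𝒱₁ → 𝒳₂ × 𝒱₂ → 𝒴 → ℝ) : ℝ :=
  ∑ ω, jointLaw ch aux ω * Real.logb 2 (onSample f ω)

/-- `f` is positive on the support of the joint law. -/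
def PosOnSupport (f : 𝒮₀ × 𝒮₁ × 𝒮₂ → 𝒰 → 𝒳₁ × 𝒱₁ → 𝒳₂ × 𝒱₂ → 𝒴 → ℝ) : Prop :=
  ∀ ω, jointLaw ch aux ω ≠ 0 → 0 < onSample f ω

variable {ch aux}
variable {f : 𝒮₀ × 𝒮₁ × 𝒮₂ → 𝒰 → 𝒳₁ × 𝒱₁ → 𝒳₂ × 𝒱₂ → 𝒴 → ℝ}

theorem jointExp_pow_lt_le (hf : PosOnSupport ch aux f) {m : ℕ} (hm : 0 < m) {δ : ℝ}
    (hδ : 0 < δ) :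
    jointExp (ch.pow m) (aux.pow m) (fun σ u z₁ z₂ y =>
        ind ((2 : ℝ) ^ (m * (logMean ch aux f + δ)) <
          ∏ j, f (σ.1 j, σ.2.1 j, σ.2.2 j) (u j) (z₁.1 j, z₁.2 j) (z₂.1 j, z₂.2 j) (y j)))
      ≤ logVar (jointLaw ch aux) (onSample f) / (m * δ ^ 2) := by
  rw [jointExp_pow]
  exact sum_pi_ind_lt_le (jointLaw_nonneg ch aux) (sum_jointLaw ch aux) hf hm hδ

theorem jointExp_pow_le_le (hf : PosOnSupport ch aux f) {m : ℕ} (hm : 0 < m) {δ : ℝ}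
    (hδ : 0 < δ) :
    jointExp (ch.pow m) (aux.pow m) (fun σ u z₁ z₂ y =>
        ind (∏ j, f (σ.1 j, σ.2.1 j, σ.2.2 j) (u j) (z₁.1 j, z₁.2 j) (z₂.1 j, z₂.2 j) (y j)
          ≤ (2 : ℝ) ^ (m * (logMean ch aux f - δ))))
      ≤ logVar (jointLaw ch aux) (onSample f) / (m * δ ^ 2) := by
  rw [jointExp_pow]
  exact sum_pi_ind_le_le (jointLaw_nonneg ch aux) (sum_jointLaw ch aux) hf hm hδ

variable (ch aux)

theorem posOnSupport_PU : PosOnSupport ch aux fun σ u _ _ _ => aux.PU σ.1 u := fun ω hω => by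
  refine lt_of_le_of_ne ((aux.PU_mem _).1 _) (Ne.symm fun h => hω ?_)
  replace h : aux.PU ω.1 ω.2.2.2.1 = 0 := h
  simp only [jointLaw, h, mul_zero, zero_mul]

theorem posOnSupport_Q₁ :
    PosOnSupport ch aux fun σ u z₁ _ _ => ∑ x, aux.Q₁ u σ.1 σ.2.1 (x, z₁.2) := fun ω hω => by
  refine lt_of_lt_of_le (lt_of_le_of_ne ((aux.Q₁_mem _ _ _).1 _) (Ne.symm fun h => hω ?_))
    (single_le_sum (f := fun x => aux.Q₁ ω.2.2.2.1 ω.1 ω.2.1 (x, ω.2.2.2.2.1))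
      (fun x _ => (aux.Q₁_mem _ _ _).1 _) (mem_univ ω.2.2.2.2.2.2.1))
  simp only [jointLaw, h, mul_zero, zero_mul]

theorem posOnSupport_Q₂ :
    PosOnSupport ch aux fun σ u _ z₂ _ => ∑ x, aux.Q₂ u σ.1 σ.2.2 (x, z₂.2) := fun ω hω => by
  refine lt_of_lt_of_le (lt_of_le_of_ne ((aux.Q₂_mem _ _ _).1 _) (Ne.symm fun h => hω ?_))
    (single_le_sum (f := fun x => aux.Q₂ ω.2.2.2.1 ω.1 ω.2.2.1 (x, ω.2.2.2.2.2.1))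
      (fun x _ => (aux.Q₂_mem _ _ _).1 _) (mem_univ ω.2.2.2.2.2.2.2.1))
  simp only [jointLaw, h, mul_zero, zero_mul]

theorem logb_card_add_logMean_nonneg (hf : PosOnSupport ch aux f) {N : ℕ} (hN : 0 < N)
    (h : jointExp ch aux (fun σ u z₁ z₂ y => (f σ u z₁ z₂ y)⁻¹) ≤ N) :
    0 ≤ Real.logb 2 N + logMean ch aux f := by
  rw [jointExp_eq_sum] at h
  exact logb_add_sum_nonneg (jointLaw_nonneg ch aux) (sum_jointLaw ch aux) hf
    (by exact_mod_cast hN) h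

theorem sum_mul_le_of_le {α : Type*} [Fintype α] {p : α → ℝ} (hp : p ∈ stdSimplex ℝ α) {F : α → ℝ}
    {c : ℝ} (h : ∀ x, F x ≤ c) : ∑ x, p x * F x ≤ c := by
  calc ∑ x, p x * F x ≤ ∑ x, p x * c :=
        sum_le_sum fun x _ => mul_le_mul_of_nonneg_left (h x) (hp.1 x)
    _ = c := by rw [← sum_mul, hp.2, one_mul]

/-- `H(U|S₀)` is at most the logarithm of the size of the alphabet, so that rounding up
the number of words `u` at most doubles it. -/
theorem logb_card_add_logMean_PU [Nonempty 𝒰] :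
    0 ≤ Real.logb 2 (Fintype.card 𝒰) + logMean ch aux fun σ u _ _ _ => aux.PU σ.1 u := by
  refine logb_card_add_logMean_nonneg ch aux (posOnSupport_PU ch aux) Fintype.card_pos ?_
  simp only [jointExp, ← sum_mul, (ch.W_mem _ _ _ _ _).2, (aux.Q₁_mem _ _ _).2,
      (aux.Q₂_mem _ _ _).2, one_mul]
  refine sum_mul_le_of_le ⟨ch.P_nonneg, ch.sum_P⟩ fun σ => ?_
  refine (sum_le_card_nsmul _ _ 1 fun u _ => mul_inv_le_one).trans_eq ?_
  simp

theorem sum_mul_inv_sum_le {α β : Type*} [Fintype α] [Fintype β] (q : α × β → ℝ) :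
    ∑ z, q z * (∑ x, q (x, z.2))⁻¹ ≤ Fintype.card β := by
  rw [Fintype.sum_prod_type_right]
  simp only [← sum_mul]
  refine (sum_le_card_nsmul _ _ 1 fun u _ => mul_inv_le_one).trans_eq ?_
  simp

theorem logb_card_add_logMean_Q₁ [Nonempty 𝒱₁] :
    0 ≤ Real.logb 2 (Fintype.card 𝒱₁) +
      logMean ch aux fun σ u z₁ _ _ => ∑ x, aux.Q₁ u σ.1 σ.2.1 (x, z₁.2) := by
  refine logb_card_add_logMean_nonneg ch aux (posOnSupport_Q₁ ch aux) Fintype.card_pos ?_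
  simp only [jointExp, ← sum_mul, (ch.W_mem _ _ _ _ _).2, (aux.Q₂_mem _ _ _).2, one_mul]
  exact sum_mul_le_of_le ⟨ch.P_nonneg, ch.sum_P⟩ fun σ => sum_mul_le_of_le (aux.PU_mem _) fun u =>
    sum_mul_inv_sum_le _

theorem logb_card_add_logMean_Q₂ [Nonempty 𝒱₂] :
    0 ≤ Real.logb 2 (Fintype.card 𝒱₂) +
      logMean ch aux fun σ u _ z₂ _ => ∑ x, aux.Q₂ u σ.1 σ.2.2 (x, z₂.2) := by
  refine logb_card_add_logMean_nonneg ch aux (posOnSupport_Q₂ ch aux) Fintype.card_pos ?_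
  simp only [jointExp, ← sum_mul, (ch.W_mem _ _ _ _ _).2, (aux.Q₁_mem _ _ _).2, one_mul]
  exact sum_mul_le_of_le ⟨ch.P_nonneg, ch.sum_P⟩ fun σ => sum_mul_le_of_le (aux.PU_mem _) fun u =>
    sum_mul_inv_sum_le _

end Power

/-! ### Many channel uses in one block -/

/-- The number of codewords in a list from an alphabet with `N` letters, for a block of length `m`:
`N ^ m * 2 ^ (m * r)`, rounded up. -/
noncomputable def numWords (N m : ℕ) (r : ℝ) : ℕ := ⌈(N : ℝ) ^ m * 2 ^ (m * r)⌉₊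

theorem numWords_pos {N : ℕ} (hN : 0 < N) (m : ℕ) (r : ℝ) : 0 < numWords N m r :=
  Nat.ceil_pos.2 (by positivity)

theorem le_numWords (N m : ℕ) (r : ℝ) : (N : ℝ) ^ m * 2 ^ (m * r) ≤ numWords N m r :=
  Nat.le_ceil _

theorem numWords_le {N : ℕ} (hN : 0 < N) (m : ℕ) {r : ℝ} (hr : 0 ≤ Real.logb 2 N + r) :
    (numWords N m r : ℝ) ≤ 2 * ((N : ℝ) ^ m * 2 ^ (m * r)) := by
  have hN' : (0 : ℝ) < N := by exact_mod_cast hN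
  refine Nat.ceil_le_two_mul ?_
  have : (N : ℝ) ^ m * 2 ^ (m * r) = 2 ^ (m * (Real.logb 2 N + r)) := by
    rw [mul_add, Real.rpow_add two_pos, mul_comm (m : ℝ) (Real.logb 2 N),
      Real.rpow_mul two_pos.le (Real.logb 2 N),
      Real.rpow_logb two_pos (by norm_num) hN', Real.rpow_natCast]
  rw [this]
  exact le_trans (by norm_num) (Real.one_le_rpow one_le_two (mul_nonneg (Nat.cast_nonneg m) hr))

theorem numMessages_pos (m : ℕ) (r : ℝ) : 0 < numMessages m r :=
  Nat.ceil_pos.2 (by positivity)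

theorem numMessages_le {m : ℕ} {r : ℝ} (hr : 0 ≤ r) :
    (numMessages m r : ℝ) ≤ 2 * 2 ^ (m * r) :=
  Nat.ceil_le_two_mul (le_trans (by norm_num)
    (Real.one_le_rpow one_le_two (mul_nonneg (Nat.cast_nonneg m) hr)))

theorem numMessages_zero_rate (m : ℕ) : numMessages m 0 = 1 := by
  simp [numMessages]

/-- The selection bound for a block: the number of words exceeds by a factor `2 ^ (m * δ)` what is
needed for the threshold `2 ^ (m * (μ + δ))`. -/
theorem coverBound_le {N : ℕ} (hN : 0 < N) (m : ℕ) {π c : ℝ} (hπ : π ≤ c) (μ δ : ℝ) :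
    coverBound π (2 ^ (m * (μ + δ))) (N ^ m) (numWords N m (μ + 2 * δ))
      ≤ 2 * c + √(2 ^ (-(m * δ))) := by
  have hN' : (0 : ℝ) < N := by exact_mod_cast hN
  refine add_le_add (by linarith) (Real.sqrt_le_sqrt ?_)
  have h := le_numWords N m (μ + 2 * δ)
  rw [div_le_iff₀ (by exact_mod_cast numWords_pos hN m _)]
  refine le_trans (le_of_eq ?_) (mul_le_mul_of_nonneg_left h (by positivity))
  rw [Nat.cast_pow, mul_left_comm, ← Real.rpow_add two_pos]
  ring_nf

section Asymptotics

variable {𝒳₁ 𝒳₂ 𝒮₀ 𝒮₁ 𝒮₂ 𝒴 𝒰 𝒱₁ 𝒱₂ : Type*}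
  [Fintype 𝒳₁] [Fintype 𝒳₂] [Fintype 𝒮₀] [Fintype 𝒮₁] [Fintype 𝒮₂] [Fintype 𝒴]
  [Fintype 𝒰] [Fintype 𝒱₁] [Fintype 𝒱₂] [Nonempty 𝒰] [Nonempty 𝒱₁] [Nonempty 𝒱₂]

/-- The wrong codewords of one fresh message: a strict rate inequality makes their contribution
to the union bound exponentially small, and at rate `0` there are none. -/
theorem other_message_le {m : ℕ} {r μ ν δ : ℝ} (hr : 0 ≤ r) (hδ : 0 ≤ δ)
    (h : r = 0 ∨ r + μ + 4 * δ ≤ ν) {N : ℕ} (hN : 0 < N) (hμ : 0 ≤ Real.logb 2 N + μ) :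
    ((numMessages m r : ℝ) - 1) * (numWords N m (μ + 2 * δ) *
      (1 / ((N ^ m : ℕ) * 2 ^ (m * (ν - δ))))) ≤ 4 * 2 ^ (-(m * δ)) := by
  have hN' : (0 : ℝ) < N := by exact_mod_cast hN
  rcases h with rfl | h
  · rw [numMessages_zero_rate]
    simp only [Nat.cast_one, sub_self, zero_mul]
    positivity
  have h1 := numWords_le hN m (r := μ + 2 * δ) (by linarith)
  have h2 := numMessages_le (m := m) hr
  have h3 : (1 : ℝ) ≤ numMessages m r := by exact_mod_cast numMessages_pos m r
  calc ((numMessages m r : ℝ) - 1) * (numWords N m (μ + 2 * δ) *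
        (1 / ((N ^ m : ℕ) * 2 ^ (m * (ν - δ)))))
      ≤ (2 * 2 ^ (m * r)) * ((2 * ((N : ℝ) ^ m * 2 ^ (m * (μ + 2 * δ)))) *
        (1 / ((N ^ m : ℕ) * 2 ^ (m * (ν - δ))))) := by
        gcongr
        linarith
    _ = 4 * 2 ^ (m * (r + μ + 3 * δ - ν)) := by
        have e : (m : ℝ) * (r + μ + 3 * δ - ν) = m * r + m * (μ + 2 * δ) - m * (ν - δ) := by ring
        rw [e, Real.rpow_sub two_pos, Real.rpow_add two_pos, Nat.cast_pow]
        field_simp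
        ring
    _ ≤ 4 * 2 ^ (-(m * δ)) := by
        gcongr
        · norm_num
        · have := mul_le_mul_of_nonneg_left h (Nat.cast_nonneg (α := ℝ) m)
          linarith

/-- The words of the wrong pairs of common messages, under the strict inequality for the sum of the
rates. -/
theorem other_pair_le {m : ℕ} {r₁ r₂ μ₀ μ₁ μ₂ ν δ : ℝ} (hr₁ : 0 ≤ r₁) (hr₂ : 0 ≤ r₂) (hδ : 0 ≤ δ)
    (h : r₁ + r₂ + μ₀ + μ₁ + μ₂ + 8 * δ ≤ ν) {N₀ N₁ N₂ : ℕ} (hN₀ : 0 < N₀) (hN₁ : 0 < N₁)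
    (hN₂ : 0 < N₂) (hμ₀ : 0 ≤ Real.logb 2 N₀ + μ₀) (hμ₁ : 0 ≤ Real.logb 2 N₁ + μ₁)
    (hμ₂ : 0 ≤ Real.logb 2 N₂ + μ₂) :
    (numMessages m r₁ : ℝ) * numMessages m r₂ * (numWords N₀ m (μ₀ + 2 * δ) *
      (numWords N₁ m (μ₁ + 2 * δ) * (numWords N₂ m (μ₂ + 2 * δ) *
        (1 / ((N₀ ^ m : ℕ) * (N₁ ^ m : ℕ) * (N₂ ^ m : ℕ) * 2 ^ (m * (ν - δ)))))))
      ≤ 32 * 2 ^ (-(m * δ)) := by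
  have hN₀' : (0 : ℝ) < N₀ := by exact_mod_cast hN₀
  have hN₁' : (0 : ℝ) < N₁ := by exact_mod_cast hN₁
  have hN₂' : (0 : ℝ) < N₂ := by exact_mod_cast hN₂
  have h0 := numWords_le hN₀ m (r := μ₀ + 2 * δ) (by linarith)
  have h1 := numWords_le hN₁ m (r := μ₁ + 2 * δ) (by linarith)
  have h2 := numWords_le hN₂ m (r := μ₂ + 2 * δ) (by linarith)
  have h3 := numMessages_le (m := m) hr₁
  have h4 := numMessages_le (m := m) hr₂
  calc (numMessages m r₁ : ℝ) * numMessages m r₂ * (numWords N₀ m (μ₀ + 2 * δ) *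
      (numWords N₁ m (μ₁ + 2 * δ) * (numWords N₂ m (μ₂ + 2 * δ) *
        (1 / ((N₀ ^ m : ℕ) * (N₁ ^ m : ℕ) * (N₂ ^ m : ℕ) * 2 ^ (m * (ν - δ)))))))
      ≤ (2 * 2 ^ (m * r₁)) * (2 * 2 ^ (m * r₂)) * ((2 * ((N₀ : ℝ) ^ m * 2 ^ (m * (μ₀ + 2 * δ)))) *
      ((2 * ((N₁ : ℝ) ^ m * 2 ^ (m * (μ₁ + 2 * δ)))) *
        ((2 * ((N₂ : ℝ) ^ m * 2 ^ (m * (μ₂ + 2 * δ)))) *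
        (1 / ((N₀ ^ m : ℕ) * (N₁ ^ m : ℕ) * (N₂ ^ m : ℕ) * 2 ^ (m * (ν - δ))))))) := by
        gcongr
    _ = 32 * 2 ^ (m * (r₁ + r₂ + μ₀ + μ₁ + μ₂ + 7 * δ - ν)) := by
        have e : (m : ℝ) * (r₁ + r₂ + μ₀ + μ₁ + μ₂ + 7 * δ - ν) = m * r₁ + m * r₂ +
          m * (μ₀ + 2 * δ) + m * (μ₁ + 2 * δ) + m * (μ₂ + 2 * δ) - m * (ν - δ) := by ring
        rw [e, Real.rpow_sub two_pos, Real.rpow_add two_pos, Real.rpow_add two_pos,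
          Real.rpow_add two_pos, Real.rpow_add two_pos, Nat.cast_pow, Nat.cast_pow, Nat.cast_pow]
        field_simp
        ring
    _ ≤ 32 * 2 ^ (-(m * δ)) := by
        gcongr
        · norm_num
        · have := mul_le_mul_of_nonneg_left h (Nat.cast_nonneg (α := ℝ) m)
          linarith

theorem tendsto_two_rpow_neg_mul {δ : ℝ} (hδ : 0 < δ) :
    Tendsto (fun m : ℕ => (2 : ℝ) ^ (-(m * δ))) atTop (𝓝 0) := by
  have h : Tendsto (fun m : ℕ => ((2 : ℝ) ^ (-δ)) ^ m) atTop (𝓝 0) :=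
    tendsto_pow_atTop_nhds_zero_of_lt_one (by positivity)
      (Real.rpow_lt_one_of_one_lt_of_neg one_lt_two (by linarith))
  refine h.congr fun m => ?_
  rw [← Real.rpow_natCast, ← Real.rpow_mul two_pos.le]
  ring_nf

/-- Codes for long blocks with small error exist if the rates obey strict inequalities between
mean logarithms; a rate `0` needs no inequality of its own. -/
theorem eventually_exists_blockCode [Nonempty 𝒳₁] [Nonempty 𝒳₂]
    (ch : Channel 𝒳₁ 𝒳₂ 𝒮₀ 𝒮₁ 𝒮₂ 𝒴) (aux : AuxLaws 𝒳₁ 𝒳₂ 𝒮₀ 𝒮₁ 𝒮₂ 𝒰 𝒱₁ 𝒱₂)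
    (B : Tests 𝒳₁ 𝒳₂ 𝒮₀ 𝒴 𝒰 𝒱₁ 𝒱₂)
    (hb₁ : PosOnSupport ch aux fun σ u z₁ _ _ => B.b₁ u σ.1 z₁.1 z₁.2)
    (hb₂ : PosOnSupport ch aux fun σ u _ z₂ _ => B.b₂ u σ.1 z₂.1 z₂.2)
    (hb : PosOnSupport ch aux fun _ u z₁ z₂ y => B.b y (u, z₁.2, z₂.2))
    {r₁ r₂ : ℝ} (hr₁ : 0 ≤ r₁) (hr₂ : 0 ≤ r₂)
    (h₁ : r₁ = 0 ∨ r₁ + logMean ch aux (fun σ u z₁ _ _ => ∑ x, aux.Q₁ u σ.1 σ.2.1 (x, z₁.2))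
      < logMean ch aux fun σ u z₁ _ _ => B.b₁ u σ.1 z₁.1 z₁.2)
    (h₂ : r₂ = 0 ∨ r₂ + logMean ch aux (fun σ u _ z₂ _ => ∑ x, aux.Q₂ u σ.1 σ.2.2 (x, z₂.2))
      < logMean ch aux fun σ u _ z₂ _ => B.b₂ u σ.1 z₂.1 z₂.2)
    (h : r₁ + r₂ + logMean ch aux (fun σ u _ _ _ => aux.PU σ.1 u)
      + logMean ch aux (fun σ u z₁ _ _ => ∑ x, aux.Q₁ u σ.1 σ.2.1 (x, z₁.2))
      + logMean ch aux (fun σ u _ z₂ _ => ∑ x, aux.Q₂ u σ.1 σ.2.2 (x, z₂.2))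
      < logMean ch aux fun _ u z₁ z₂ y => B.b y (u, z₁.2, z₂.2))
    {ε : ℝ} (hε : 0 < ε) :
    ∀ᶠ m : ℕ in atTop, ∀ (T : Type) [Fintype T]
      (a w : T → Fin (numMessages m r₁) × Fin (numMessages m r₂)),
      ∃ C : BlockCode (Fin (numMessages m r₁)) (Fin (numMessages m r₂)) (Fin m → 𝒳₁) (Fin m → 𝒳₂)
        (Fin m → 𝒮₀) (Fin m → 𝒮₁) (Fin m → 𝒮₂) (Fin m → 𝒴),
        ∑ t, C.err (ch.pow m) (a t) (w t) ≤ Fintype.card T * ε := by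
  set f₀ : 𝒮₀ × 𝒮₁ × 𝒮₂ → 𝒰 → 𝒳₁ × 𝒱₁ → 𝒳₂ × 𝒱₂ → 𝒴 → ℝ := fun σ u _ _ _ => aux.PU σ.1 u
    with hf₀
  set f₁ : 𝒮₀ × 𝒮₁ × 𝒮₂ → 𝒰 → 𝒳₁ × 𝒱₁ → 𝒳₂ × 𝒱₂ → 𝒴 → ℝ :=
    fun σ u z₁ _ _ => ∑ x, aux.Q₁ u σ.1 σ.2.1 (x, z₁.2) with hf₁
  set f₂ : 𝒮₀ × 𝒮₁ × 𝒮₂ → 𝒰 → 𝒳₁ × 𝒱₁ → 𝒳₂ × 𝒱₂ → 𝒴 → ℝ :=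
    fun σ u _ z₂ _ => ∑ x, aux.Q₂ u σ.1 σ.2.2 (x, z₂.2) with hf₂
  set g₁ : 𝒮₀ × 𝒮₁ × 𝒮₂ → 𝒰 → 𝒳₁ × 𝒱₁ → 𝒳₂ × 𝒱₂ → 𝒴 → ℝ :=
    fun σ u z₁ _ _ => B.b₁ u σ.1 z₁.1 z₁.2 with hg₁
  set g₂ : 𝒮₀ × 𝒮₁ × 𝒮₂ → 𝒰 → 𝒳₁ × 𝒱₁ → 𝒳₂ × 𝒱₂ → 𝒴 → ℝ :=
    fun σ u _ z₂ _ => B.b₂ u σ.1 z₂.1 z₂.2 with hg₂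
  set g : 𝒮₀ × 𝒮₁ × 𝒮₂ → 𝒰 → 𝒳₁ × 𝒱₁ → 𝒳₂ × 𝒱₂ → 𝒴 → ℝ :=
    fun _ u z₁ z₂ y => B.b y (u, z₁.2, z₂.2) with hg
  have hμ₀ : 0 ≤ Real.logb 2 (Fintype.card 𝒰) + logMean ch aux f₀ :=
    logb_card_add_logMean_PU ch aux
  have hμ₁ : 0 ≤ Real.logb 2 (Fintype.card 𝒱₁) + logMean ch aux f₁ :=
    logb_card_add_logMean_Q₁ ch aux
  have hμ₂ : 0 ≤ Real.logb 2 (Fintype.card 𝒱₂) + logMean ch aux f₂ :=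
    logb_card_add_logMean_Q₂ ch aux
  obtain ⟨δ, hδ, hδ₁, hδ₂, hδ₃⟩ : ∃ δ : ℝ, 0 < δ ∧
      (r₁ = 0 ∨ r₁ + logMean ch aux f₁ + 4 * δ ≤ logMean ch aux g₁) ∧
      (r₂ = 0 ∨ r₂ + logMean ch aux f₂ + 4 * δ ≤ logMean ch aux g₂) ∧
      r₁ + r₂ + logMean ch aux f₀ + logMean ch aux f₁ + logMean ch aux f₂ + 8 * δ
        ≤ logMean ch aux g := by
    have pos : ∀ {r x y : ℝ}, (r = 0 ∨ r + x < y) →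
        ∃ d : ℝ, 0 < d ∧ ∀ δ ≤ d, r = 0 ∨ r + x + 4 * δ ≤ y := by
      intro r x y hxy
      rcases hxy with h0 | hlt
      · exact ⟨1, one_pos, fun δ _ => Or.inl h0⟩
      · exact ⟨(y - (r + x)) / 4, by linarith, fun δ hd => Or.inr (by linarith)⟩
    obtain ⟨d₁, hd₁, hd₁'⟩ := pos h₁
    obtain ⟨d₂, hd₂, hd₂'⟩ := pos h₂
    refine ⟨min d₁ (min d₂ ((logMean ch aux g - (r₁ + r₂ + logMean ch aux f₀ + logMean ch aux f₁ +
      logMean ch aux f₂)) / 8)), lt_min hd₁ (lt_min hd₂ (by linarith)), hd₁' _ (min_le_left _ _),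
      hd₂' _ ((min_le_right _ _).trans (min_le_left _ _)), ?_⟩
    have := (min_le_right d₁ _).trans (min_le_right d₂ ((logMean ch aux g - (r₁ + r₂ +
      logMean ch aux f₀ + logMean ch aux f₁ + logMean ch aux f₂)) / 8))
    linarith
  -- the variances of the six logarithms enter through Chebyshev's inequality
  set V : (𝒮₀ × 𝒮₁ × 𝒮₂ → 𝒰 → 𝒳₁ × 𝒱₁ → 𝒳₂ × 𝒱₂ → 𝒴 → ℝ) → ℝ :=
    fun f => logVar (jointLaw ch aux) (onSample f)
  set bound : ℕ → ℝ := fun m =>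
    (2 * V f₀ + 2 * V f₁ + 2 * V f₂ + V g₁ + V g₂ + V g) / δ ^ 2 * (1 / (m : ℝ))
      + 3 * √(2 ^ (-(m * δ))) + 40 * 2 ^ (-(m * δ)) with hbound
  have hlim : Tendsto bound atTop (𝓝 0) := by
    have l1 := tendsto_one_div_atTop_nhds_zero_nat (𝕜 := ℝ)
    have l2 := tendsto_two_rpow_neg_mul hδ
    have l3 := (Real.continuous_sqrt.tendsto 0).comp l2
    rw [Real.sqrt_zero] at l3
    have := ((l1.const_mul ((2 * V f₀ + 2 * V f₁ + 2 * V f₂ + V g₁ + V g₂ + V g) / δ ^ 2)).add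
      (l3.const_mul 3)).add (l2.const_mul 40)
    simp only [mul_zero, add_zero] at this
    exact this
  filter_upwards [hlim.eventually (gt_mem_nhds hε), eventually_gt_atTop 0] with m hmε hm T _ a w
  have := Fin.pos_iff_nonempty.1 (numMessages_pos m r₁)
  have := Fin.pos_iff_nonempty.1 (numMessages_pos m r₂)
  obtain ⟨C, hC⟩ := exists_blockCode_le
    (numWords_pos (Fintype.card_pos (α := 𝒰)) m (logMean ch aux f₀ + 2 * δ))
    (numWords_pos (Fintype.card_pos (α := 𝒱₁)) m (logMean ch aux f₁ + 2 * δ))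
    (numWords_pos (Fintype.card_pos (α := 𝒱₂)) m (logMean ch aux f₂ + 2 * δ))
    (ch.pow m) (aux.pow m) (B.pow m)
    (t₀ := 2 ^ (m * (logMean ch aux f₀ + δ))) (t₁ := 2 ^ (m * (logMean ch aux f₁ + δ)))
    (t₂ := 2 ^ (m * (logMean ch aux f₂ + δ))) (τ₁ := 2 ^ (m * (logMean ch aux g₁ - δ)))
    (τ₂ := 2 ^ (m * (logMean ch aux g₂ - δ))) (τ := 2 ^ (m * (logMean ch aux g - δ)))
    (by positivity) (by positivity) (by positivity) (by positivity) (by positivity) (by positivity)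
    a w
  refine ⟨C, hC.trans (mul_le_mul_of_nonneg_left (le_trans ?_ hmε.le) (Nat.cast_nonneg _))⟩
  have c0 := jointExp_pow_lt_le (posOnSupport_PU ch aux) hm hδ
  have c1 := jointExp_pow_lt_le (posOnSupport_Q₁ ch aux) hm hδ
  have c2 := jointExp_pow_lt_le (posOnSupport_Q₂ ch aux) hm hδ
  have c3 := jointExp_pow_le_le hb₁ hm hδ
  have c4 := jointExp_pow_le_le hb₂ hm hδ
  have c5 := jointExp_pow_le_le hb hm hδ
  simp only [Fintype.prod_sum] at c1 c2
  have k0 := coverBound_le (Fintype.card_pos (α := 𝒰)) m c0 (logMean ch aux f₀) δ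
  have k1 := coverBound_le (Fintype.card_pos (α := 𝒱₁)) m c1 (logMean ch aux f₁) δ
  have k2 := coverBound_le (Fintype.card_pos (α := 𝒱₂)) m c2 (logMean ch aux f₂) δ
  have k3 := other_message_le (m := m) hr₁ hδ.le hδ₁ (Fintype.card_pos (α := 𝒱₁)) hμ₁
  have k4 := other_message_le (m := m) hr₂ hδ.le hδ₂ (Fintype.card_pos (α := 𝒱₂)) hμ₂
  have k5 := other_pair_le (m := m) hr₁ hr₂ hδ.le hδ₃ (Fintype.card_pos (α := 𝒰))
    (Fintype.card_pos (α := 𝒱₁)) (Fintype.card_pos (α := 𝒱₂)) hμ₀ hμ₁ hμ₂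
  have tot := add_le_add k0 (add_le_add k2 (add_le_add k1 (add_le_add (add_le_add c3 k3)
    (add_le_add (add_le_add c4 k4) (add_le_add c5 k5)))))
  simp only [oneShotBound, Fintype.card_fin, Fintype.card_fun]
  refine tot.trans (le_of_eq ?_)
  have hm' : (m : ℝ) ≠ 0 := by exact_mod_cast hm.ne'
  simp only [hbound, V]
  field_simp
  ring

end Asymptotics

/-! ### Block-Markov coding with backward decoding -/

section Sequences

variable {α : Type*} [Nonempty α] {m : ℕ}

/-- A finite sequence, continued arbitrarily. -/
noncomputable def extend {n : ℕ} (x : Fin n → α) (t : ℕ) : α :=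
  if h : t < n then x ⟨t, h⟩ else Classical.arbitrary α

/-- The block with number `b` of a sequence that is cut into blocks of length `m`. -/
def blockOf (m : ℕ) (x : ℕ → α) (b : ℕ) : Fin m → α := fun i => x (i + m * b)

/-- The sequence that consists of the blocks `X 0, …, X (B - 1)`, and is arbitrary afterwards. -/
noncomputable def spread (hm : 0 < m) (B : ℕ) (X : ℕ → Fin m → α) (t : ℕ) : α :=
  if t / m < B then X (t / m) ⟨t % m, Nat.mod_lt t hm⟩ else Classical.arbitrary α

theorem extend_of_lt {n : ℕ} (x : Fin n → α) {t : ℕ} (h : t < n) : extend x t = x ⟨t, h⟩ :=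
  dif_pos h

theorem spread_block (hm : 0 < m) {B b : ℕ} (hb : b < B) (X : ℕ → Fin m → α) (i : Fin m) :
    spread hm B X (i + m * b) = X b i := by
  have h1 : (i + m * b) / m = b := by
    rw [Nat.add_mul_div_left _ _ hm, Nat.div_eq_of_lt i.isLt, zero_add]
  have h2 : (i + m * b) % m = i := by
    rw [Nat.add_mul_mod_self_left, Nat.mod_eq_of_lt i.isLt]
  rw [spread, if_pos (by rwa [h1])]
  simp only [h1, h2]

theorem spread_of_le (hm : 0 < m) {B t : ℕ} (ht : B * m ≤ t) (X : ℕ → Fin m → α) :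
    spread hm B X t = Classical.arbitrary α :=
  if_neg (not_lt.2 ((Nat.le_div_iff_mul_le hm).2 ht))

/-- The messages of the blocks: in block `b` both encoders know `padded κ w b`, and the fresh
message is `padded κ w (b + 1)`. The message `w b` is fresh in block `b`; the fixed message `κ` is
known in block `0`, and it is sent as the fresh message of block `N`. -/
def padded {K : Type*} (κ : K) {N : ℕ} (w : Fin N → K) : ℕ → K
  | 0 => κ
  | b + 1 => if h : b < N then w ⟨b, h⟩ else κ

end Sequences

section Markov

variable {K₁ K₂ 𝒳₁ 𝒳₂ 𝒮₀ 𝒮₁ 𝒮₂ 𝒴 : Type*} {m : ℕ}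
  [Nonempty 𝒳₁] [Nonempty 𝒳₂] [Nonempty 𝒮₀] [Nonempty 𝒮₁] [Nonempty 𝒮₂] [Nonempty 𝒴]
  (C : BlockCode K₁ K₂ (Fin m → 𝒳₁) (Fin m → 𝒳₂) (Fin m → 𝒮₀) (Fin m → 𝒮₁) (Fin m → 𝒮₂)
    (Fin m → 𝒴))

/-- The estimates that encoder 1 makes, block by block, of the messages of encoder 2. -/
def otherEstimate₁ (v₁ : ℕ → K₁) (κ₂ : K₂) (s₀ : ℕ → 𝒮₀) (x₂ : ℕ → 𝒳₂) : ℕ → K₂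
  | 0 => κ₂
  | b + 1 => C.d₂ (v₁ b, otherEstimate₁ v₁ κ₂ s₀ x₂ b) (blockOf m s₀ b) (blockOf m x₂ b)

/-- The estimates that encoder 2 makes, block by block, of the messages of encoder 1. -/
def otherEstimate₂ (v₂ : ℕ → K₂) (κ₁ : K₁) (s₀ : ℕ → 𝒮₀) (x₁ : ℕ → 𝒳₁) : ℕ → K₁
  | 0 => κ₁
  | b + 1 => C.d₁ (otherEstimate₂ v₂ κ₁ s₀ x₁ b, v₂ b) (blockOf m s₀ b) (blockOf m x₁ b)

/-- Backward decoding: `backward C κ N y k` estimates the messages with number `N + 1 - k`. -/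
def backward (κ : K₁ × K₂) (N : ℕ) (y : ℕ → 𝒴) : ℕ → K₁ × K₂
  | 0 => κ
  | k + 1 => C.g (backward κ N y k) (blockOf m y (N - k))

/-- The block-Markov code with `N + 1` blocks of length `m` that transmits `N` messages of each
encoder. The actual messages are numbers, encoded by `ι₁` and `ι₂`. -/
noncomputable def markovCode (hm : 0 < m) (κ : K₁ × K₂) {N n M₁ M₂ : ℕ} [Nonempty (Fin M₁)]
    [Nonempty (Fin M₂)] (ι₁ : Fin M₁ → Fin N → K₁) (ι₂ : Fin M₂ → Fin N → K₂) :
    Code 𝒳₁ 𝒳₂ 𝒮₀ 𝒮₁ 𝒮₂ 𝒴 n M₁ M₂ where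
  f₁ j w s₀ s₁ x₂ := spread hm (N + 1) (fun b => C.e₁
    (padded κ.1 (ι₁ w) b, otherEstimate₁ C (padded κ.1 (ι₁ w)) κ.2 (extend s₀) (extend x₂) b)
    (padded κ.1 (ι₁ w) (b + 1)) (blockOf m (extend s₀) b) (blockOf m (extend s₁) b)) j
  f₂ j w s₀ s₂ x₁ := spread hm (N + 1) (fun b => C.e₂
    (otherEstimate₂ C (padded κ.2 (ι₂ w)) κ.1 (extend s₀) (extend x₁) b, padded κ.2 (ι₂ w) b)
    (padded κ.2 (ι₂ w) (b + 1)) (blockOf m (extend s₀) b) (blockOf m (extend s₂) b)) j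
  g y := (invFun ι₁ fun b => (backward C κ N (extend y) (N - b)).1,
    invFun ι₂ fun b => (backward C κ N (extend y) (N - b)).2)

variable {C}

theorem otherEstimate₁_eq {v₁ : ℕ → K₁} {v₂ : ℕ → K₂} {s₀ : ℕ → 𝒮₀} {x₂ : ℕ → 𝒳₂}
    {X₂ : ℕ → Fin m → 𝒳₂} {B : ℕ} (hX : ∀ b < B, blockOf m x₂ b = X₂ b)
    (hd : ∀ b < B, C.d₂ (v₁ b, v₂ b) (blockOf m s₀ b) (X₂ b) = v₂ (b + 1)) :
    ∀ b ≤ B, otherEstimate₁ C v₁ (v₂ 0) s₀ x₂ b = v₂ b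
  | 0, _ => rfl
  | b + 1, hb => by
    rw [otherEstimate₁, otherEstimate₁_eq hX hd b (by omega), hX b hb, hd b hb]

theorem otherEstimate₂_eq {v₁ : ℕ → K₁} {v₂ : ℕ → K₂} {s₀ : ℕ → 𝒮₀} {x₁ : ℕ → 𝒳₁}
    {X₁ : ℕ → Fin m → 𝒳₁} {B : ℕ} (hX : ∀ b < B, blockOf m x₁ b = X₁ b)
    (hd : ∀ b < B, C.d₁ (v₁ b, v₂ b) (blockOf m s₀ b) (X₁ b) = v₁ (b + 1)) :
    ∀ b ≤ B, otherEstimate₂ C v₂ (v₁ 0) s₀ x₁ b = v₁ b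
  | 0, _ => rfl
  | b + 1, hb => by
    rw [otherEstimate₂, otherEstimate₂_eq hX hd b (by omega), hX b hb, hd b hb]

theorem backward_eq {κ : K₁ × K₂} {N : ℕ} {y : ℕ → 𝒴} {v : ℕ → K₁ × K₂} (hκ : v (N + 1) = κ)
    (hg : ∀ b ≤ N, C.g (v (b + 1)) (blockOf m y b) = v b) :
    ∀ k ≤ N + 1, backward C κ N y k = v (N + 1 - k)
  | 0, _ => hκ.symm
  | k + 1, hk => by
    rw [backward, backward_eq hκ hg k (by omega), show N + 1 - k = N - k + 1 by omega,
      hg (N - k) (by omega), show N + 1 - (k + 1) = N - k by omega]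

/-- Before time `j` all blocks before the one of `j` are complete. -/
theorem blockOf_extend_spread {α : Type*} [Nonempty α] (hm : 0 < m) {B j b : ℕ} (hj : j / m < B)
    (hb : b < j / m) (X : ℕ → Fin m → α) {x : Fin j → α} (hx : ∀ i, x i = spread hm B X i) :
    blockOf m (extend x) b = X b := by
  funext i
  have h1 : i + m * b < j := by
    have h2 : m * (b + 1) ≤ m * (j / m) := Nat.mul_le_mul_left m hb
    have h3 := Nat.mul_div_le j m
    have := i.isLt
    rw [mul_add, mul_one] at h2
    omega
  rw [blockOf, extend_of_lt _ h1, hx, spread_block hm (hb.trans hj)]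

/-- The block with number `b` of the word of encoder 1 if all estimates are right. -/
noncomputable def idealWord₁ (C : BlockCode K₁ K₂ (Fin m → 𝒳₁) (Fin m → 𝒳₂) (Fin m → 𝒮₀)
    (Fin m → 𝒮₁) (Fin m → 𝒮₂) (Fin m → 𝒴)) (v₁ : ℕ → K₁) (v₂ : ℕ → K₂) (s₀ : ℕ → 𝒮₀)
    (s₁ : ℕ → 𝒮₁) (b : ℕ) : Fin m → 𝒳₁ :=
  C.e₁ (v₁ b, v₂ b) (v₁ (b + 1)) (blockOf m s₀ b) (blockOf m s₁ b)

/-- The block with number `b` of the word of encoder 2 if all estimates are right. -/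
noncomputable def idealWord₂ (C : BlockCode K₁ K₂ (Fin m → 𝒳₁) (Fin m → 𝒳₂) (Fin m → 𝒮₀)
    (Fin m → 𝒮₁) (Fin m → 𝒮₂) (Fin m → 𝒴)) (v₁ : ℕ → K₁) (v₂ : ℕ → K₂) (s₀ : ℕ → 𝒮₀)
    (s₂ : ℕ → 𝒮₂) (b : ℕ) : Fin m → 𝒳₂ :=
  C.e₂ (v₁ b, v₂ b) (v₂ (b + 1)) (blockOf m s₀ b) (blockOf m s₂ b)

variable {hm : 0 < m} {κ : K₁ × K₂} {N n M₁ M₂ : ℕ} [Nonempty (Fin M₁)] [Nonempty (Fin M₂)]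
  {ι₁ : Fin M₁ → Fin N → K₁} {ι₂ : Fin M₂ → Fin N → K₂} {w₁ : Fin M₁} {w₂ : Fin M₂}
  {s₀ : Fin n → 𝒮₀} {s₁ : Fin n → 𝒮₁} {s₂ : Fin n → 𝒮₂}

theorem markovCode_f₁ (j : Fin n) (x₂ : Fin (j : ℕ) → 𝒳₂) :
    (markovCode C hm κ ι₁ ι₂ : Code 𝒳₁ 𝒳₂ 𝒮₀ 𝒮₁ 𝒮₂ 𝒴 n M₁ M₂).f₁ j w₁ s₀ s₁ x₂ =
      spread hm (N + 1) (fun b => C.e₁ (padded κ.1 (ι₁ w₁) b,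
        otherEstimate₁ C (padded κ.1 (ι₁ w₁)) κ.2 (extend s₀) (extend x₂) b)
      (padded κ.1 (ι₁ w₁) (b + 1)) (blockOf m (extend s₀) b) (blockOf m (extend s₁) b)) j :=
  rfl

theorem markovCode_f₂ (j : Fin n) (x₁ : Fin (j : ℕ) → 𝒳₁) :
    (markovCode C hm κ ι₁ ι₂ : Code 𝒳₁ 𝒳₂ 𝒮₀ 𝒮₁ 𝒮₂ 𝒴 n M₁ M₂).f₂ j w₂ s₀ s₂ x₁ =
      spread hm (N + 1) (fun b => C.e₂
        (otherEstimate₂ C (padded κ.2 (ι₂ w₂)) κ.1 (extend s₀) (extend x₁) b,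
          padded κ.2 (ι₂ w₂) b)
      (padded κ.2 (ι₂ w₂) (b + 1)) (blockOf m (extend s₀) b) (blockOf m (extend s₂) b)) j :=
  rfl

/-- If the estimates would be right for the ideal words, then the encoders send the ideal words. -/
theorem inputs_markovCode
    (h₁ : ∀ b ≤ N, C.d₁ (padded κ.1 (ι₁ w₁) b, padded κ.2 (ι₂ w₂) b) (blockOf m (extend s₀) b)
      (idealWord₁ C (padded κ.1 (ι₁ w₁)) (padded κ.2 (ι₂ w₂)) (extend s₀) (extend s₁) b)
        = padded κ.1 (ι₁ w₁) (b + 1))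
    (h₂ : ∀ b ≤ N, C.d₂ (padded κ.1 (ι₁ w₁) b, padded κ.2 (ι₂ w₂) b) (blockOf m (extend s₀) b)
      (idealWord₂ C (padded κ.1 (ι₁ w₁)) (padded κ.2 (ι₂ w₂)) (extend s₀) (extend s₂) b)
        = padded κ.2 (ι₂ w₂) (b + 1)) (t : ℕ) (ht : t < n) :
    (markovCode C hm κ ι₁ ι₂ : Code 𝒳₁ 𝒳₂ 𝒮₀ 𝒮₁ 𝒮₂ 𝒴 n M₁ M₂).inputs w₁ w₂ s₀ s₁ s₂ ⟨t, ht⟩ =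
      (spread hm (N + 1) (idealWord₁ C (padded κ.1 (ι₁ w₁)) (padded κ.2 (ι₂ w₂)) (extend s₀)
          (extend s₁)) t,
        spread hm (N + 1) (idealWord₂ C (padded κ.1 (ι₁ w₁)) (padded κ.2 (ι₂ w₂)) (extend s₀)
          (extend s₂)) t) := by
  induction t using Nat.strong_induction_on with
  | _ t ih =>
    rw [Code.inputs]
    by_cases hb : t / m < N + 1
    · refine Prod.ext ?_ ?_
      · simp only [markovCode_f₁]
        rw [spread, spread, if_pos hb, if_pos hb, idealWord₁]
        have := otherEstimate₁_eq (C := C) (v₁ := padded κ.1 (ι₁ w₁)) (v₂ := padded κ.2 (ι₂ w₂))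
          (s₀ := extend s₀) (B := t / m)
          (X₂ := idealWord₂ C (padded κ.1 (ι₁ w₁)) (padded κ.2 (ι₂ w₂)) (extend s₀) (extend s₂))
          (fun b hb' => blockOf_extend_spread hm hb hb' _ fun i =>
            congrArg Prod.snd (ih i i.isLt (i.isLt.trans ht)))
          (fun b hb' => h₂ b (by omega)) (t / m) le_rfl
        exact congrArg (fun k => C.e₁ (_, k) _ _ _ _) this
      · simp only [markovCode_f₂]
        rw [spread, spread, if_pos hb, if_pos hb, idealWord₂]
        have := otherEstimate₂_eq (C := C) (v₁ := padded κ.1 (ι₁ w₁)) (v₂ := padded κ.2 (ι₂ w₂))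
          (s₀ := extend s₀) (B := t / m)
          (X₁ := idealWord₁ C (padded κ.1 (ι₁ w₁)) (padded κ.2 (ι₂ w₂)) (extend s₀) (extend s₁))
          (fun b hb' => blockOf_extend_spread hm hb hb' _ fun i =>
            congrArg Prod.fst (ih i i.isLt (i.isLt.trans ht)))
          (fun b hb' => h₁ b (by omega)) (t / m) le_rfl
        exact congrArg (fun k => C.e₂ (k, _) _ _ _ _) this
    · refine Prod.ext ?_ ?_
      · simp only [markovCode_f₁]
        rw [spread, spread, if_neg hb, if_neg hb]
      · simp only [markovCode_f₂]
        rw [spread, spread, if_neg hb, if_neg hb]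

theorem decode_markovCode (hι₁ : Injective ι₁) (hι₂ : Injective ι₂) {y : Fin n → 𝒴}
    (hg : ∀ b ≤ N, C.g (padded κ.1 (ι₁ w₁) (b + 1), padded κ.2 (ι₂ w₂) (b + 1))
      (blockOf m (extend y) b) = (padded κ.1 (ι₁ w₁) b, padded κ.2 (ι₂ w₂) b)) :
    (markovCode C hm κ ι₁ ι₂ : Code 𝒳₁ 𝒳₂ 𝒮₀ 𝒮₁ 𝒮₂ 𝒴 n M₁ M₂).g y = (w₁, w₂) := by
  have key : ∀ b : Fin N, backward C κ N (extend y) (N - b) = (ι₁ w₁ b, ι₂ w₂ b) := fun b => by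
    rw [backward_eq (v := fun b => (padded κ.1 (ι₁ w₁) b, padded κ.2 (ι₂ w₂) b))
      (by simp [padded]) hg (N - b) (by omega), show N + 1 - (N - b) = b + 1 by omega]
    simp [padded]
  simp only [markovCode, key]
  exact Prod.ext (leftInverse_invFun hι₁ w₁) (leftInverse_invFun hι₂ w₂)

end Markov

section Cut

/-- A sequence of length `B * m + r` as `B` blocks of length `m` and a rest. -/
def cutEquiv (B m r : ℕ) (Z : Type*) :
    (Fin (B * m + r) → Z) ≃ (Fin B → Fin m → Z) × (Fin r → Z) :=
  ((Equiv.arrowCongr finSumFinEquiv.symm (Equiv.refl Z)).trans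
    (Equiv.sumArrowEquivProdArrow _ _ _)).trans
    (Equiv.prodCongr ((Equiv.arrowCongr finProdFinEquiv.symm (Equiv.refl Z)).trans
      (Equiv.curry _ _ _)) (Equiv.refl _))

theorem cutEquiv_apply (B m r : ℕ) (Z : Type*) (z : Fin (B * m + r) → Z) :
    cutEquiv B m r Z z = (fun b i => z (Fin.castAdd r (finProdFinEquiv (b, i))),
      fun t => z (Fin.natAdd (B * m) t)) :=
  rfl

theorem prod_cut (B m r : ℕ) (F : Fin (B * m + r) → ℝ) :
    ∏ j, F j = (∏ b, ∏ i, F (Fin.castAdd r (finProdFinEquiv (b, i)))) *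
      ∏ t, F (Fin.natAdd (B * m) t) := by
  rw [Fin.prod_univ_add, ← finProdFinEquiv.prod_comp, Fintype.prod_prod_type]

theorem blockOf_extend {α : Type*} [Nonempty α] {B m r : ℕ} (x : Fin (B * m + r) → α) (b : Fin B) :
    blockOf m (extend x) b = fun i => x (Fin.castAdd r (finProdFinEquiv (b, i))) := by
  funext i
  have h : (i : ℕ) + m * b < B * m + r := (Fin.castAdd r (finProdFinEquiv (b, i))).isLt
  rw [blockOf, extend_of_lt _ h]
  rfl

theorem sum_arrow_prod {α β γ δ : Type*} [Fintype α] [Fintype β] [Fintype γ] [Fintype δ] (n : ℕ)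
    (G : (Fin n → α) → (Fin n → β) → (Fin n → γ) → (Fin n → δ) → ℝ) :
    ∑ a, ∑ b, ∑ c, ∑ d, G a b c d = ∑ z : Fin n → α × β × γ × δ,
      G (fun j => (z j).1) (fun j => (z j).2.1) (fun j => (z j).2.2.1) (fun j => (z j).2.2.2) := by
  let e : (Fin n → α × β × γ × δ) ≃ (Fin n → α) × (Fin n → β) × (Fin n → γ) × (Fin n → δ) :=
    { toFun := fun z =>
        (fun j => (z j).1, fun j => (z j).2.1, fun j => (z j).2.2.1, fun j => (z j).2.2.2)
      invFun := fun z j => (z.1 j, z.2.1 j, z.2.2.1 j, z.2.2.2 j)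
      left_inv := fun _ => rfl
      right_inv := fun _ => rfl }
  have h := e.sum_comp fun z => G z.1 z.2.1 z.2.2.1 z.2.2.2
  simp only [Fintype.sum_prod_type] at h
  exact h.symm

end Cut

section MarkovError

variable {K₁ K₂ 𝒳₁ 𝒳₂ 𝒮₀ 𝒮₁ 𝒮₂ 𝒴 : Type*} {m : ℕ}
  [Nonempty 𝒳₁] [Nonempty 𝒳₂] [Nonempty 𝒮₀] [Nonempty 𝒮₁] [Nonempty 𝒮₂] [Nonempty 𝒴]
  [Fintype 𝒳₁] [Fintype 𝒳₂] [Fintype 𝒮₀] [Fintype 𝒮₁] [Fintype 𝒮₂] [Fintype 𝒴]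
  (ch : Channel 𝒳₁ 𝒳₂ 𝒮₀ 𝒮₁ 𝒮₂ 𝒴)
  (C : BlockCode K₁ K₂ (Fin m → 𝒳₁) (Fin m → 𝒳₂) (Fin m → 𝒮₀) (Fin m → 𝒮₁) (Fin m → 𝒮₂)
    (Fin m → 𝒴))

/-- The probability of the states and of the output of one block when both encoders have estimated
correctly. -/
noncomputable def blockWeight (a w : K₁ × K₂) (ζ : Fin m → 𝒮₀ × 𝒮₁ × 𝒮₂ × 𝒴) : ℝ :=
  ∏ i, (ch.P₀ (ζ i).1 * ch.P₁ (ζ i).2.1 * ch.P₂ (ζ i).2.2.1) *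
    ch.W (C.e₁ a w.1 (fun i => (ζ i).1) (fun i => (ζ i).2.1) i)
      (C.e₂ a w.2 (fun i => (ζ i).1) (fun i => (ζ i).2.2.1) i)
      (ζ i).1 (ζ i).2.1 (ζ i).2.2.1 (ζ i).2.2.2

theorem sum_blockWeight_mul (a w : K₁ × K₂)
    (G : (Fin m → 𝒮₀) × (Fin m → 𝒮₁) × (Fin m → 𝒮₂) → (Fin m → 𝒴) → ℝ) :
    ∑ ζ, blockWeight ch C a w ζ * G (fun i => (ζ i).1, fun i => (ζ i).2.1, fun i => (ζ i).2.2.1)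
        (fun i => (ζ i).2.2.2)
      = ∑ σ, (ch.pow m).P σ * ∑ y, (ch.pow m).W (C.e₁ a w.1 σ.1 σ.2.1) (C.e₂ a w.2 σ.1 σ.2.2)
          σ.1 σ.2.1 σ.2.2 y * G σ y := by
  simp only [Fintype.sum_prod_type, mul_sum]
  rw [sum_arrow_prod]
  refine sum_congr rfl fun ζ _ => ?_
  simp only [blockWeight, Channel.P, Channel.pow, prod_mul_distrib]
  ring

theorem sum_blockWeight (a w : K₁ × K₂) :
    ∑ ζ, blockWeight ch C a w ζ = 1 := by
  have h := sum_blockWeight_mul ch C a w fun _ _ => 1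
  simp only [mul_one, ((ch.pow m).W_mem _ _ _ _ _).2, (ch.pow m).sum_P] at h
  exact h

variable {C} {hm : 0 < m} {κ : K₁ × K₂} {N n M₁ M₂ : ℕ} [Nonempty (Fin M₁)] [Nonempty (Fin M₂)]
  {ι₁ : Fin M₁ → Fin N → K₁} {ι₂ : Fin M₂ → Fin N → K₂}

/-- The two messages with number `b`. -/
def paddedPair (κ : K₁ × K₂) (w₁ : Fin N → K₁) (w₂ : Fin N → K₂) (b : ℕ) : K₁ × K₂ :=
  (padded κ.1 w₁ b, padded κ.2 w₂ b)

/-- Given the states, the error probability is bounded by the probability of a wrong estimate in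
some block when the inputs are those for right estimates: the inputs differ from these only if some
encoder estimates wrongly, which the states determine. -/
theorem sum_error_markovCode_le (hι₁ : Injective ι₁) (hι₂ : Injective ι₂) (w₁ : Fin M₁)
    (w₂ : Fin M₂) (s₀ : Fin n → 𝒮₀) (s₁ : Fin n → 𝒮₁) (s₂ : Fin n → 𝒮₂) :
    let c : Code 𝒳₁ 𝒳₂ 𝒮₀ 𝒮₁ 𝒮₂ 𝒴 n M₁ M₂ := markovCode C hm κ ι₁ ι₂
    let v := paddedPair κ (ι₁ w₁) (ι₂ w₂)
    ∑ y : Fin n → 𝒴, ind (c.g y ≠ (w₁, w₂)) *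
        ∏ j, ch.W (c.inputs w₁ w₂ s₀ s₁ s₂ j).1 (c.inputs w₁ w₂ s₀ s₁ s₂ j).2
          (s₀ j) (s₁ j) (s₂ j) (y j)
      ≤ ∑ y : Fin n → 𝒴, (∏ j : Fin n, ch.W
          (spread hm (N + 1) (idealWord₁ C (padded κ.1 (ι₁ w₁)) (padded κ.2 (ι₂ w₂)) (extend s₀)
            (extend s₁)) j)
          (spread hm (N + 1) (idealWord₂ C (padded κ.1 (ι₁ w₁)) (padded κ.2 (ι₂ w₂)) (extend s₀)
            (extend s₂)) j) (s₀ j) (s₁ j) (s₂ j) (y j)) *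
          ∑ b : Fin (N + 1), ind (C.Bad (v b) (v (b + 1)) (blockOf m (extend s₀) b,
            blockOf m (extend s₁) b, blockOf m (extend s₂) b) (blockOf m (extend y) b)) := by
  intro c v
  have hW0 : ∀ (x₁ : Fin n → 𝒳₁) (x₂ : Fin n → 𝒳₂) (y : Fin n → 𝒴),
      0 ≤ ∏ j, ch.W (x₁ j) (x₂ j) (s₀ j) (s₁ j) (s₂ j) (y j) := fun x₁ x₂ y =>
    prod_nonneg fun j _ => (ch.W_mem _ _ _ _ _).1 _
  have hW1 : ∀ (x₁ : Fin n → 𝒳₁) (x₂ : Fin n → 𝒳₂),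
      ∑ y : Fin n → 𝒴, ∏ j, ch.W (x₁ j) (x₂ j) (s₀ j) (s₁ j) (s₂ j) (y j) = 1 := fun x₁ x₂ =>
    sum_pi_prod_eq_one (p := fun j => ch.W (x₁ j) (x₂ j) (s₀ j) (s₁ j) (s₂ j))
      fun j => (ch.W_mem _ _ _ _ _).2
  by_cases H : ∃ b ≤ N, ∀ y, C.Bad (v b) (v (b + 1)) (blockOf m (extend s₀) b,
      blockOf m (extend s₁) b, blockOf m (extend s₂) b) y
  · obtain ⟨b, hb, hbad⟩ := H
    calc _ ≤ ∑ y : Fin n → 𝒴, ∏ j, ch.W (c.inputs w₁ w₂ s₀ s₁ s₂ j).1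
          (c.inputs w₁ w₂ s₀ s₁ s₂ j).2 (s₀ j) (s₁ j) (s₂ j) (y j) :=
          sum_le_sum fun y _ => mul_le_of_le_one_left
            (hW0 (fun j => (c.inputs w₁ w₂ s₀ s₁ s₂ j).1)
              (fun j => (c.inputs w₁ w₂ s₀ s₁ s₂ j).2) y) (ind_le_one _)
      _ = 1 := hW1 (fun j => (c.inputs w₁ w₂ s₀ s₁ s₂ j).1)
              (fun j => (c.inputs w₁ w₂ s₀ s₁ s₂ j).2)
      _ = _ := (hW1 (fun j => spread hm (N + 1) (idealWord₁ C (padded κ.1 (ι₁ w₁))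
            (padded κ.2 (ι₂ w₂)) (extend s₀) (extend s₁)) j)
          (fun j => spread hm (N + 1) (idealWord₂ C (padded κ.1 (ι₁ w₁)) (padded κ.2 (ι₂ w₂))
            (extend s₀) (extend s₂)) j)).symm
      _ ≤ _ := by
        refine sum_le_sum fun y _ => le_mul_of_one_le_right (hW0 (fun j => spread hm (N + 1)
            (idealWord₁ C (padded κ.1 (ι₁ w₁)) (padded κ.2 (ι₂ w₂)) (extend s₀) (extend s₁)) j)
          (fun j => spread hm (N + 1) (idealWord₂ C (padded κ.1 (ι₁ w₁)) (padded κ.2 (ι₂ w₂))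
            (extend s₀) (extend s₂)) j) y) ?_
        rw [← ind_of (hbad (blockOf m (extend y) b))]
        exact single_le_sum (f := fun b : Fin (N + 1) => ind (C.Bad (v b) (v (b + 1))
          (blockOf m (extend s₀) b, blockOf m (extend s₁) b, blockOf m (extend s₂) b)
          (blockOf m (extend y) b))) (fun b _ => ind_nonneg _)
          (mem_univ (⟨b, Nat.lt_succ_of_le hb⟩ : Fin (N + 1)))
  · have hd : ∀ b ≤ N, C.d₁ (v b) (blockOf m (extend s₀) b) (idealWord₁ C (padded κ.1 (ι₁ w₁))
          (padded κ.2 (ι₂ w₂)) (extend s₀) (extend s₁) b) = padded κ.1 (ι₁ w₁) (b + 1) ∧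
        C.d₂ (v b) (blockOf m (extend s₀) b) (idealWord₂ C (padded κ.1 (ι₁ w₁))
          (padded κ.2 (ι₂ w₂)) (extend s₀) (extend s₂) b) = padded κ.2 (ι₂ w₂) (b + 1) := by
      intro b hb
      by_contra hcon
      rw [not_and_or] at hcon
      exact H ⟨b, hb, fun y => hcon.elim Or.inl fun h => Or.inr (Or.inl h)⟩
    have hin : ∀ j : Fin n, c.inputs w₁ w₂ s₀ s₁ s₂ j = _ := fun j =>
      inputs_markovCode (fun b hb => (hd b hb).1) (fun b hb => (hd b hb).2) j j.isLt
    simp only [hin]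
    refine sum_le_sum fun y _ => ?_
    rw [mul_comm]
    refine mul_le_mul_of_nonneg_left ?_ (hW0 (fun j => spread hm (N + 1)
            (idealWord₁ C (padded κ.1 (ι₁ w₁)) (padded κ.2 (ι₂ w₂)) (extend s₀) (extend s₁)) j)
          (fun j => spread hm (N + 1) (idealWord₂ C (padded κ.1 (ι₁ w₁)) (padded κ.2 (ι₂ w₂))
            (extend s₀) (extend s₂)) j) y)
    refine (ind_mono fun hg => ?_).trans (ind_exists_le fun b : Fin (N + 1) =>
      C.Bad (v b) (v (b + 1)) (blockOf m (extend s₀) b, blockOf m (extend s₁) b,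
        blockOf m (extend s₂) b) (blockOf m (extend y) b))
    by_contra hcon
    refine hg (decode_markovCode hι₁ hι₂ fun b hb => ?_)
    by_contra hgb
    exact hcon ⟨⟨b, Nat.lt_succ_of_le hb⟩, Or.inr (Or.inr hgb)⟩

/-- The error probability of the block-Markov code is at most the sum of those of its blocks. -/
theorem errorProbGiven_markovCode_le {r : ℕ} (hι₁ : Injective ι₁) (hι₂ : Injective ι₂)
    (w₁ : Fin M₁) (w₂ : Fin M₂) :
    errorProbGiven ch (markovCode C hm κ ι₁ ι₂ :
        Code 𝒳₁ 𝒳₂ 𝒮₀ 𝒮₁ 𝒮₂ 𝒴 ((N + 1) * m + r) M₁ M₂) w₁ w₂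
      ≤ ∑ b : Fin (N + 1), C.err (ch.pow m) (paddedPair κ (ι₁ w₁) (ι₂ w₂) b)
          (paddedPair κ (ι₁ w₁) (ι₂ w₂) (b + 1)) := by
  set v := paddedPair κ (ι₁ w₁) (ι₂ w₂) with hv
  set c : Code 𝒳₁ 𝒳₂ 𝒮₀ 𝒮₁ 𝒮₂ 𝒴 ((N + 1) * m + r) M₁ M₂ := markovCode C hm κ ι₁ ι₂
  have h1 : errorProbGiven ch c w₁ w₂ = ∑ s₀ : Fin ((N + 1) * m + r) → 𝒮₀,
      ∑ s₁ : Fin ((N + 1) * m + r) → 𝒮₁, ∑ s₂ : Fin ((N + 1) * m + r) → 𝒮₂,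
      (∏ j, ch.P₀ (s₀ j) * ch.P₁ (s₁ j) * ch.P₂ (s₂ j)) *
      ∑ y : Fin ((N + 1) * m + r) → 𝒴, ind (c.g y ≠ (w₁, w₂)) *
        ∏ j, ch.W (c.inputs w₁ w₂ s₀ s₁ s₂ j).1 (c.inputs w₁ w₂ s₀ s₁ s₂ j).2
          (s₀ j) (s₁ j) (s₂ j) (y j) := by
    unfold errorProbGiven
    refine sum_congr rfl fun s₀ _ => sum_congr rfl fun s₁ _ => sum_congr rfl fun s₂ _ => ?_
    rw [sum_filter]
    refine congrArg _ (sum_congr rfl fun y _ => ?_)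
    by_cases hy : c.g y ≠ (w₁, w₂)
    · rw [if_pos hy, ind_of hy, one_mul]
    · rw [if_neg hy, ind_of_not hy, zero_mul]
  rw [h1]
  refine (sum_le_sum fun s₀ _ => sum_le_sum fun s₁ _ => sum_le_sum fun s₂ _ =>
    mul_le_mul_of_nonneg_left (sum_error_markovCode_le ch hι₁ hι₂ w₁ w₂ s₀ s₁ s₂)
    (prod_nonneg fun j _ => mul_nonneg (mul_nonneg (ch.P₀_mem.1 _) (ch.P₁_mem.1 _))
      (ch.P₂_mem.1 _))).trans_eq ?_
  simp only [mul_sum]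
  rw [sum_arrow_prod, sum_comm]
  refine sum_congr rfl fun b _ => ?_
  -- the rest of the sequence after the last block has its own product weight
  set x₁ : 𝒳₁ := Classical.arbitrary 𝒳₁
  set x₂ : 𝒳₂ := Classical.arbitrary 𝒳₂
  set q : 𝒮₀ × 𝒮₁ × 𝒮₂ × 𝒴 → ℝ := fun z =>
    (ch.P₀ z.1 * ch.P₁ z.2.1 * ch.P₂ z.2.2.1) * ch.W x₁ x₂ z.1 z.2.1 z.2.2.1 z.2.2.2 with hq
  have hq1 : ∑ z, q z = 1 := by
    simp only [hq, Fintype.sum_prod_type, ← mul_sum, (ch.W_mem _ _ _ _ _).2, mul_one,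
      ch.P₂_mem.2, ch.P₁_mem.2, ch.P₀_mem.2]
  have hq1' : ∑ z : Fin r → 𝒮₀ × 𝒮₁ × 𝒮₂ × 𝒴, ∏ t, q (z t) = 1 :=
    sum_pi_prod_eq_one fun _ => hq1
  let Φ : (Fin (N + 1) → Fin m → 𝒮₀ × 𝒮₁ × 𝒮₂ × 𝒴) × (Fin r → 𝒮₀ × 𝒮₁ × 𝒮₂ × 𝒴) → ℝ := fun ζ =>
      ((∏ b : Fin (N + 1), blockWeight ch C (v b) (v (b + 1)) (ζ.1 b)) *
          ind (C.Bad (v b) (v (b + 1)) (fun i => (ζ.1 b i).1, fun i => (ζ.1 b i).2.1,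
            fun i => (ζ.1 b i).2.2.1) fun i => (ζ.1 b i).2.2.2)) * ∏ t, q (ζ.2 t)
  have hfac : ∀ z : Fin ((N + 1) * m + r) → 𝒮₀ × 𝒮₁ × 𝒮₂ × 𝒴,
      (∏ j, ch.P₀ (z j).1 * ch.P₁ (z j).2.1 * ch.P₂ (z j).2.2.1) *
        ((∏ j : Fin ((N + 1) * m + r), ch.W
          (spread hm (N + 1) (idealWord₁ C (padded κ.1 (ι₁ w₁)) (padded κ.2 (ι₂ w₂))
            (extend fun j => (z j).1) (extend fun j => (z j).2.1)) j)
          (spread hm (N + 1) (idealWord₂ C (padded κ.1 (ι₁ w₁)) (padded κ.2 (ι₂ w₂))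
            (extend fun j => (z j).1) (extend fun j => (z j).2.2.1)) j)
          (z j).1 (z j).2.1 (z j).2.2.1 (z j).2.2.2) *
        ind (C.Bad (v b) (v (b + 1)) (blockOf m (extend fun j => (z j).1) b,
          blockOf m (extend fun j => (z j).2.1) b, blockOf m (extend fun j => (z j).2.2.1) b)
          (blockOf m (extend fun j => (z j).2.2.2) b)))
      = Φ (cutEquiv (N + 1) m r _ z) := by
    intro z
    simp only [Φ]
    rw [cutEquiv_apply, ← mul_assoc, ← prod_mul_distrib, prod_cut, blockOf_extend, blockOf_extend,
      blockOf_extend, blockOf_extend]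
    have hrest : ∀ t : Fin r, (N + 1) * m ≤ ((Fin.natAdd ((N + 1) * m) t : Fin _) : ℕ) :=
      fun t => Nat.le_add_right _ _
    have hidx : ∀ (b : Fin (N + 1)) (i : Fin m),
        ((Fin.castAdd r (finProdFinEquiv (b, i)) : Fin _) : ℕ) = i + m * b := fun b i => rfl
    simp only [spread_of_le hm (hrest _), hidx, spread_block hm (Fin.isLt _), idealWord₁,
      idealWord₂, blockOf_extend, blockWeight, hq]
    simp only [hv, paddedPair]
    ring
  refine (Fintype.sum_congr _ _ hfac).trans
    (((cutEquiv (N + 1) m r (𝒮₀ × 𝒮₁ × 𝒮₂ × 𝒴)).sum_comp Φ).trans ?_)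
  rw [Fintype.sum_prod_type]
  simp only [Φ, ← mul_sum, hq1', mul_one]
  rw [sum_pi_apply (p := fun (b : Fin (N + 1)) ζ => blockWeight ch C (v b) (v (b + 1)) ζ)
    (fun b => sum_blockWeight ch C _ _) b fun ζ => ind (C.Bad (v b) (v (b + 1))
      (fun i => (ζ i).1, fun i => (ζ i).2.1, fun i => (ζ i).2.2.1) fun i => (ζ i).2.2.2)]
  exact sum_blockWeight_mul ch C (v b) (v (b + 1)) fun σ y =>
    ind (C.Bad (v b) (v (b + 1)) σ y)

end MarkovError

/-! ### Achievable rates -/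

section Achievable

variable {𝒳₁ 𝒳₂ 𝒮₀ 𝒮₁ 𝒮₂ 𝒴 𝒰 𝒱₁ 𝒱₂ : Type*}
  [Fintype 𝒳₁] [Fintype 𝒳₂] [Fintype 𝒮₀] [Fintype 𝒮₁] [Fintype 𝒮₂] [Fintype 𝒴]
  [Fintype 𝒰] [Fintype 𝒱₁] [Fintype 𝒱₂]

theorem avgErrorProb_nonneg (ch : Channel 𝒳₁ 𝒳₂ 𝒮₀ 𝒮₁ 𝒮₂ 𝒴) {n M₁ M₂ : ℕ}
    (c : Code 𝒳₁ 𝒳₂ 𝒮₀ 𝒮₁ 𝒮₂ 𝒴 n M₁ M₂) : 0 ≤ avgErrorProb ch c := by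
  refine mul_nonneg (by positivity) (sum_nonneg fun w₁ _ => sum_nonneg fun w₂ _ => ?_)
  refine sum_nonneg fun s₀ _ => sum_nonneg fun s₁ _ => sum_nonneg fun s₂ _ => mul_nonneg
    (prod_nonneg fun j _ => mul_nonneg (mul_nonneg (ch.P₀_mem.1 _) (ch.P₁_mem.1 _))
      (ch.P₂_mem.1 _)) (sum_nonneg fun y _ => prod_nonneg fun j _ => (ch.W_mem _ _ _ _ _).1 _)

/-- It suffices to find, for every error level, codes of all large lengths: the codes of smallest
error of each length then form one sequence. -/
theorem achievable_of_eventually [Nonempty 𝒳₁] [Nonempty 𝒳₂]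
    (ch : Channel 𝒳₁ 𝒳₂ 𝒮₀ 𝒮₁ 𝒮₂ 𝒴) {R : ℝ × ℝ}
    (h₁ : 0 ≤ R.1) (h₂ : 0 ≤ R.2)
    (h : ∀ ε > 0, ∀ᶠ n : ℕ in atTop,
      ∃ c : Code 𝒳₁ 𝒳₂ 𝒮₀ 𝒮₁ 𝒮₂ 𝒴 n (numMessages n R.1) (numMessages n R.2),
        avgErrorProb ch c ≤ ε) : Achievable ch R := by
  have hbdd : ∀ n : ℕ, BddBelow (Set.range fun c : Code 𝒳₁ 𝒳₂ 𝒮₀ 𝒮₁ 𝒮₂ 𝒴 n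
      (numMessages n R.1) (numMessages n R.2) => avgErrorProb ch c) := fun n =>
    ⟨0, by rintro _ ⟨c, rfl⟩; exact avgErrorProb_nonneg ch c⟩
  have hne : ∀ n : ℕ, Nonempty (Code 𝒳₁ 𝒳₂ 𝒮₀ 𝒮₁ 𝒮₂ 𝒴 n (numMessages n R.1)
      (numMessages n R.2)) := fun n =>
    ⟨⟨fun _ _ _ _ _ => Classical.arbitrary _, fun _ _ _ _ _ => Classical.arbitrary _,
      fun _ => (⟨0, numMessages_pos n R.1⟩, ⟨0, numMessages_pos n R.2⟩)⟩⟩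
  have hc : ∀ n : ℕ, ∃ c : Code 𝒳₁ 𝒳₂ 𝒮₀ 𝒮₁ 𝒮₂ 𝒴 n (numMessages n R.1) (numMessages n R.2),
      avgErrorProb ch c < (⨅ c : Code 𝒳₁ 𝒳₂ 𝒮₀ 𝒮₁ 𝒮₂ 𝒴 n (numMessages n R.1)
        (numMessages n R.2), avgErrorProb ch c) + 1 / ((n : ℝ) + 1) := fun n =>
    exists_lt_of_ciInf_lt (lt_add_of_pos_right _ (by positivity))
  choose c hc using hc
  refine ⟨h₁, h₂, c, ?_⟩
  rw [Metric.tendsto_atTop']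
  intro ε hε
  have h3 := (tendsto_one_div_add_atTop_nhds_zero_nat (𝕜 := ℝ)).eventually
    (gt_mem_nhds (half_pos hε))
  obtain ⟨n₀, hn₀⟩ := eventually_atTop.1 ((h (ε / 2) (half_pos hε)).and h3)
  refine ⟨n₀, fun n hn => ?_⟩
  obtain ⟨⟨c', hc'⟩, h4⟩ := hn₀ n hn.le
  rw [Real.dist_eq, sub_zero, abs_of_nonneg (avgErrorProb_nonneg ch _)]
  have h5 := ciInf_le (hbdd n) c'
  have h6 := hc n
  linarith

theorem achievable_zero [Nonempty 𝒳₁] [Nonempty 𝒳₂] (ch : Channel 𝒳₁ 𝒳₂ 𝒮₀ 𝒮₁ 𝒮₂ 𝒴) :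
    Achievable ch (0, 0) := by
  refine achievable_of_eventually ch le_rfl le_rfl fun ε hε => Eventually.of_forall fun n => ?_
  refine ⟨⟨fun _ _ _ _ _ => Classical.arbitrary _, fun _ _ _ _ _ => Classical.arbitrary _,
      fun _ => (⟨0, numMessages_pos n 0⟩, ⟨0, numMessages_pos n 0⟩)⟩, le_of_eq_of_le ?_ hε.le⟩
  have hsub : Subsingleton (Fin (numMessages n 0)) := by
    rw [numMessages_zero_rate]; infer_instance
  -- with one message each, the decoder cannot err
  simp [avgErrorProb, errorProbGiven, eq_iff_true_of_subsingleton]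

theorem nonempty_of_mem_stdSimplex {α : Type*} [Fintype α] {p : α → ℝ} (hp : p ∈ stdSimplex ℝ α) :
    Nonempty α := by
  by_contra hα
  rw [not_nonempty_iff] at hα
  simpa using hp.2

/-- From codes for one block to the block-Markov code. -/
theorem exists_code_of_blockCode [Nonempty 𝒳₁] [Nonempty 𝒳₂]
    (ch : Channel 𝒳₁ 𝒳₂ 𝒮₀ 𝒮₁ 𝒮₂ 𝒴) {m N n r k₁ k₂ M₁ M₂ : ℕ} (hm : 0 < m)
    (hn : n = (N + 1) * m + r) (hk₁ : 0 < k₁) (hk₂ : 0 < k₂) (hM₁ : 0 < M₁) (hM₂ : 0 < M₂)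
    (hkM₁ : M₁ ≤ k₁ ^ N) (hkM₂ : M₂ ≤ k₂ ^ N) {ε : ℝ}
    (h : ∀ (T : Type) [Fintype T] (a w : T → Fin k₁ × Fin k₂),
      ∃ C : BlockCode (Fin k₁) (Fin k₂) (Fin m → 𝒳₁) (Fin m → 𝒳₂)
        (Fin m → 𝒮₀) (Fin m → 𝒮₁) (Fin m → 𝒮₂) (Fin m → 𝒴),
        ∑ t, C.err (ch.pow m) (a t) (w t) ≤ Fintype.card T * ε) :
    ∃ c : Code 𝒳₁ 𝒳₂ 𝒮₀ 𝒮₁ 𝒮₂ 𝒴 n M₁ M₂, avgErrorProb ch c ≤ (N + 1) * ε := by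
  subst hn
  have : Nonempty 𝒮₀ := nonempty_of_mem_stdSimplex ch.P₀_mem
  have : Nonempty 𝒮₁ := nonempty_of_mem_stdSimplex ch.P₁_mem
  have : Nonempty 𝒮₂ := nonempty_of_mem_stdSimplex ch.P₂_mem
  have : Nonempty 𝒴 := nonempty_of_mem_stdSimplex (ch.W_mem (Classical.arbitrary _)
    (Classical.arbitrary _) (Classical.arbitrary _) (Classical.arbitrary _) (Classical.arbitrary _))
  have : Nonempty (Fin M₁) := Fin.pos_iff_nonempty.1 hM₁
  have : Nonempty (Fin M₂) := Fin.pos_iff_nonempty.1 hM₂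
  obtain ⟨ι₁⟩ : Nonempty (Fin M₁ ↪ (Fin N → Fin k₁)) :=
    Function.Embedding.nonempty_of_card_le (by simpa using hkM₁)
  obtain ⟨ι₂⟩ : Nonempty (Fin M₂ ↪ (Fin N → Fin k₂)) :=
    Function.Embedding.nonempty_of_card_le (by simpa using hkM₂)
  let κ : Fin k₁ × Fin k₂ := (⟨0, hk₁⟩, ⟨0, hk₂⟩)
  obtain ⟨C, hC⟩ := h (Fin M₁ × Fin M₂ × Fin (N + 1))
    (fun t => paddedPair κ (ι₁ t.1) (ι₂ t.2.1) t.2.2)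
    (fun t => paddedPair κ (ι₁ t.1) (ι₂ t.2.1) (t.2.2 + 1))
  refine ⟨markovCode C hm κ ι₁ ι₂, ?_⟩
  have hM₁' : (0 : ℝ) < M₁ := by exact_mod_cast hM₁
  have hM₂' : (0 : ℝ) < M₂ := by exact_mod_cast hM₂
  have h1 : ∑ w₁ : Fin M₁, ∑ w₂ : Fin M₂, errorProbGiven ch (markovCode C hm κ ι₁ ι₂ :
      Code 𝒳₁ 𝒳₂ 𝒮₀ 𝒮₁ 𝒮₂ 𝒴 ((N + 1) * m + r) M₁ M₂) w₁ w₂ ≤ M₁ * (M₂ * ((N + 1) * ε)) := by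
    refine (sum_le_sum fun w₁ _ => sum_le_sum fun w₂ _ =>
      errorProbGiven_markovCode_le ch ι₁.injective ι₂.injective w₁ w₂).trans ?_
    simp only [Fintype.sum_prod_type, Fintype.card_prod, Fintype.card_fin] at hC
    refine hC.trans_eq ?_
    push_cast
    ring
  rw [avgErrorProb, one_div_mul_eq_div, div_le_iff₀ (by positivity)]
  linarith

/-- `N` messages of slightly higher rate, one for each block, are enough for all messages. -/
theorem numMessages_le_pow {n m N : ℕ} {R η : ℝ} (hR : 0 ≤ R) (hη : (n : ℝ) ≤ N * m * (1 + η)) :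
    numMessages n R ≤ numMessages m ((1 + η) * R) ^ N := by
  refine Nat.ceil_le.2 ?_
  rw [Nat.cast_pow]
  calc (2 : ℝ) ^ ((n : ℝ) * R) ≤ 2 ^ ((m : ℝ) * ((1 + η) * R) * N) := by
        refine Real.rpow_le_rpow_of_exponent_le one_le_two ?_
        have := mul_le_mul_of_nonneg_right hη hR
        linarith
    _ = ((2 : ℝ) ^ ((m : ℝ) * ((1 + η) * R))) ^ N := Real.rpow_mul_natCast two_pos.le _ _
    _ ≤ _ := pow_le_pow_left₀ (by positivity) (Nat.le_ceil _) N

/-- Rates that obey the strict inequalities for some tests are achievable. -/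
theorem achievable_of_lt [Nonempty 𝒳₁] [Nonempty 𝒳₂] [Nonempty 𝒰] [Nonempty 𝒱₁] [Nonempty 𝒱₂]
    (ch : Channel 𝒳₁ 𝒳₂ 𝒮₀ 𝒮₁ 𝒮₂ 𝒴) (aux : AuxLaws 𝒳₁ 𝒳₂ 𝒮₀ 𝒮₁ 𝒮₂ 𝒰 𝒱₁ 𝒱₂)
    (B : Tests 𝒳₁ 𝒳₂ 𝒮₀ 𝒴 𝒰 𝒱₁ 𝒱₂)
    (hb₁ : PosOnSupport ch aux fun σ u z₁ _ _ => B.b₁ u σ.1 z₁.1 z₁.2)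
    (hb₂ : PosOnSupport ch aux fun σ u _ z₂ _ => B.b₂ u σ.1 z₂.1 z₂.2)
    (hb : PosOnSupport ch aux fun _ u z₁ z₂ y => B.b y (u, z₁.2, z₂.2))
    {R : ℝ × ℝ} (hR₁ : 0 ≤ R.1) (hR₂ : 0 ≤ R.2)
    (h₁ : R.1 = 0 ∨ R.1 + logMean ch aux (fun σ u z₁ _ _ => ∑ x, aux.Q₁ u σ.1 σ.2.1 (x, z₁.2))
      < logMean ch aux fun σ u z₁ _ _ => B.b₁ u σ.1 z₁.1 z₁.2)
    (h₂ : R.2 = 0 ∨ R.2 + logMean ch aux (fun σ u _ z₂ _ => ∑ x, aux.Q₂ u σ.1 σ.2.2 (x, z₂.2))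
      < logMean ch aux fun σ u _ z₂ _ => B.b₂ u σ.1 z₂.1 z₂.2)
    (h : R.1 + R.2 + logMean ch aux (fun σ u _ _ _ => aux.PU σ.1 u)
      + logMean ch aux (fun σ u z₁ _ _ => ∑ x, aux.Q₁ u σ.1 σ.2.1 (x, z₁.2))
      + logMean ch aux (fun σ u _ z₂ _ => ∑ x, aux.Q₂ u σ.1 σ.2.2 (x, z₂.2))
      < logMean ch aux fun _ u z₁ z₂ y => B.b y (u, z₁.2, z₂.2)) :
    Achievable ch R := by
  -- `1 + η` is the factor by which the rates inside the blocks exceed those of the whole code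
  obtain ⟨η, hη, hη₁, hη₂, hη₃⟩ : ∃ η : ℝ, 0 < η ∧
      ((1 + η) * R.1 = 0 ∨
        (1 + η) * R.1 + logMean ch aux (fun σ u z₁ _ _ => ∑ x, aux.Q₁ u σ.1 σ.2.1 (x, z₁.2))
        < logMean ch aux fun σ u z₁ _ _ => B.b₁ u σ.1 z₁.1 z₁.2) ∧
      ((1 + η) * R.2 = 0 ∨
        (1 + η) * R.2 + logMean ch aux (fun σ u _ z₂ _ => ∑ x, aux.Q₂ u σ.1 σ.2.2 (x, z₂.2))
        < logMean ch aux fun σ u _ z₂ _ => B.b₂ u σ.1 z₂.1 z₂.2) ∧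
      (1 + η) * R.1 + (1 + η) * R.2 + logMean ch aux (fun σ u _ _ _ => aux.PU σ.1 u)
        + logMean ch aux (fun σ u z₁ _ _ => ∑ x, aux.Q₁ u σ.1 σ.2.1 (x, z₁.2))
        + logMean ch aux (fun σ u _ z₂ _ => ∑ x, aux.Q₂ u σ.1 σ.2.2 (x, z₂.2))
        < logMean ch aux fun _ u z₁ z₂ y => B.b y (u, z₁.2, z₂.2) := by
    have near : ∀ {r s x y : ℝ}, r + s + x < y →
        ∀ᶠ η : ℝ in 𝓝 0, (1 + η) * r + (1 + η) * s + x < y := by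
      intro r s x y hxy
      have hcont : ContinuousAt (fun η : ℝ => (1 + η) * r + (1 + η) * s + x) 0 := by fun_prop
      exact hcont.eventually (gt_mem_nhds (by simpa using hxy))
    have near' : ∀ {r x y : ℝ}, (r = 0 ∨ r + x < y) →
        ∀ᶠ η : ℝ in 𝓝 0, (1 + η) * r = 0 ∨ (1 + η) * r + x < y := by
      intro r x y hxy
      rcases hxy with h0 | hlt
      · exact Eventually.of_forall fun η => Or.inl (by rw [h0, mul_zero])
      · filter_upwards [near (s := 0) (by linarith : r + 0 + x < y)] with η hη
        exact Or.inr (by linarith)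
    have h' : R.1 + R.2 + (logMean ch aux (fun σ u _ _ _ => aux.PU σ.1 u)
        + logMean ch aux (fun σ u z₁ _ _ => ∑ x, aux.Q₁ u σ.1 σ.2.1 (x, z₁.2))
        + logMean ch aux (fun σ u _ z₂ _ => ∑ x, aux.Q₂ u σ.1 σ.2.2 (x, z₂.2)))
        < logMean ch aux fun _ u z₁ z₂ y => B.b y (u, z₁.2, z₂.2) := by linarith
    have hall := (near' h₁).and ((near' h₂).and (near h'))
    obtain ⟨η, ⟨a1, a2, a3⟩, hη⟩ :=
      ((hall.filter_mono nhdsWithin_le_nhds).and (self_mem_nhdsWithin (s := Set.Ioi (0 : ℝ)))).exists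
    exact ⟨η, hη, a1, a2, by linarith⟩
  obtain ⟨N, hN⟩ := exists_nat_gt (2 / η)
  rw [div_lt_iff₀ hη] at hN
  refine achievable_of_eventually ch hR₁ hR₂ fun ε hε => ?_
  have hblock := eventually_exists_blockCode ch aux B hb₁ hb₂ hb (r₁ := (1 + η) * R.1)
    (r₂ := (1 + η) * R.2) (by positivity) (by positivity) hη₁ hη₂ hη₃
    (ε := ε / (N + 1)) (by positivity)
  have hdiv := Nat.tendsto_div_const_atTop (n := N + 1) (by omega)
  filter_upwards [hdiv.eventually hblock, hdiv.eventually (eventually_ge_atTop (N + 1))]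
    with n hn hnm
  have hlen : (n : ℝ) ≤ N * (n / (N + 1) : ℕ) * (1 + η) := by
    have h1 : n < (N + 1) * (n / (N + 1)) + (N + 1) := by
      have h3 := Nat.div_add_mod n (N + 1)
      have h4 := Nat.mod_lt n (show 0 < N + 1 by omega)
      omega
    have h2 : (n : ℝ) < (N + 1) * (n / (N + 1) : ℕ) + (N + 1) := by exact_mod_cast h1
    have h3 : (N : ℝ) + 1 ≤ (n / (N + 1) : ℕ) := by exact_mod_cast hnm
    nlinarith
  obtain ⟨c, hc⟩ := exists_code_of_blockCode ch (m := n / (N + 1)) (N := N) (n := n)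
    (r := n % (N + 1)) (by omega) (Nat.div_add_mod n (N + 1)).symm (numMessages_pos _ _)
    (numMessages_pos _ _) (numMessages_pos n R.1) (numMessages_pos n R.2)
    (numMessages_le_pow hR₁ hlen) (numMessages_le_pow hR₂ hlen) hn
  refine ⟨c, hc.trans_eq ?_⟩
  field_simp

end Achievable

/-! ### Information measures -/

section Law

variable {Ω α β γ : Type*} [Fintype Ω] {p : Ω → ℝ}

theorem law_eq_sum_ind (p : Ω → ℝ) (X : Ω → α) (a : α) :
    law p X a = ∑ ω, p ω * ind (X ω = a) := by
  classical
  simp only [law, sum_filter, ind, mul_ite, mul_one, mul_zero]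

theorem law_nonneg (hp : ∀ ω, 0 ≤ p ω) (X : Ω → α) (a : α) : 0 ≤ law p X a :=
  sum_nonneg fun ω _ => hp ω

theorem law_pos (hp : ∀ ω, 0 ≤ p ω) (X : Ω → α) {ω : Ω} (hω : p ω ≠ 0) : 0 < law p X (X ω) := by
  classical
  rw [law]
  exact lt_of_lt_of_le (lt_of_le_of_ne (hp ω) hω.symm)
    (single_le_sum (f := p) (fun ω _ => hp ω) (by simp))

theorem law_congr {X : Ω → α} {Y : Ω → β} {a : α} {b : β} (h : ∀ ω, X ω = a ↔ Y ω = b) :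
    law p X a = law p Y b := by
  simp only [law_eq_sum_ind, h]

/-- Marginalization. -/
theorem sum_law {ι : Type*} [Fintype ι] {A : Ω → α} {V : Ω → ι} {X : Ω → β} {a : ι → α} {x : β}
    (h : ∀ ω v, A ω = a v ↔ V ω = v ∧ X ω = x) : ∑ v, law p A (a v) = law p X x := by
  classical
  simp only [law_eq_sum_ind, h]
  rw [sum_comm]
  refine sum_congr rfl fun ω _ => ?_
  rw [← mul_sum, sum_eq_single (V ω)]
  · simp
  · intro v _ hv
    exact ind_of_not fun h' => hv h'.1.symm
  · simp

end Law

section Region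

variable {𝒳₁ 𝒳₂ 𝒮₀ 𝒮₁ 𝒮₂ 𝒴 𝒰 𝒱₁ 𝒱₂ : Type*}
  [Fintype 𝒳₁] [Fintype 𝒳₂] [Fintype 𝒮₀] [Fintype 𝒮₁] [Fintype 𝒮₂] [Fintype 𝒴]
  [Fintype 𝒰] [Fintype 𝒱₁] [Fintype 𝒱₂]
  (ch : Channel 𝒳₁ 𝒳₂ 𝒮₀ 𝒮₁ 𝒮₂ 𝒴) (aux : AuxLaws 𝒳₁ 𝒳₂ 𝒮₀ 𝒮₁ 𝒮₂ 𝒰 𝒱₁ 𝒱₂)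

/-- The likelihoods `P(v₁|x₁,u,s₀)`, `P(v₂|x₂,u,s₀)` and `P(u,v₁,v₂|y)` of the joint law. -/
noncomputable def likelihoods : Tests 𝒳₁ 𝒳₂ 𝒮₀ 𝒴 𝒰 𝒱₁ 𝒱₂ where
  b₁ u s x v :=
    law (jointLaw ch aux) (fun ω => (ω.2.2.2.2.2.2.1, ω.2.2.2.2.1, (ω.2.2.2.1, ω.1))) (x, v, (u, s))
      / law (jointLaw ch aux) (fun ω => (ω.2.2.2.2.2.2.1, (ω.2.2.2.1, ω.1))) (x, (u, s))
  b₂ u s x v :=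
    law (jointLaw ch aux) (fun ω => (ω.2.2.2.2.2.2.2.1, ω.2.2.2.2.2.1, (ω.2.2.2.1, ω.1)))
        (x, v, (u, s))
      / law (jointLaw ch aux) (fun ω => (ω.2.2.2.2.2.2.2.1, (ω.2.2.2.1, ω.1))) (x, (u, s))
  b y c :=
    law (jointLaw ch aux)
        (fun ω => (ω.2.2.2.2.2.2.2.2, (ω.2.2.2.2.1, ω.2.2.2.2.2.1, ω.2.2.2.1)))
        (y, (c.2.1, c.2.2, c.1))
      / law (jointLaw ch aux) (fun ω => ω.2.2.2.2.2.2.2.2) y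
  b₁_nonneg _ _ _ _ := div_nonneg (law_nonneg (jointLaw_nonneg ch aux) _ _)
    (law_nonneg (jointLaw_nonneg ch aux) _ _)
  b₂_nonneg _ _ _ _ := div_nonneg (law_nonneg (jointLaw_nonneg ch aux) _ _)
    (law_nonneg (jointLaw_nonneg ch aux) _ _)
  b_nonneg _ _ := div_nonneg (law_nonneg (jointLaw_nonneg ch aux) _ _)
    (law_nonneg (jointLaw_nonneg ch aux) _ _)
  sum_b₁_le u s x := by
    rw [← sum_div, sum_law (V := fun ω => ω.2.2.2.2.1)
      (X := fun ω => (ω.2.2.2.2.2.2.1, (ω.2.2.2.1, ω.1))) (x := (x, (u, s)))]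
    · exact div_self_le_one _
    · intro ω v; simp only [Prod.mk.injEq]; tauto
  sum_b₂_le u s x := by
    rw [← sum_div, sum_law (V := fun ω => ω.2.2.2.2.2.1)
      (X := fun ω => (ω.2.2.2.2.2.2.2.1, (ω.2.2.2.1, ω.1))) (x := (x, (u, s)))]
    · exact div_self_le_one _
    · intro ω v; simp only [Prod.mk.injEq]; tauto
  sum_b_le y := by
    rw [← sum_div, sum_law (V := fun ω => (ω.2.2.2.1, ω.2.2.2.2.1, ω.2.2.2.2.2.1))
      (X := fun ω => ω.2.2.2.2.2.2.2.2) (x := y)]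
    · exact div_self_le_one _
    · rintro ω ⟨u, v₁, v₂⟩; simp only [Prod.mk.injEq]; tauto

theorem posOnSupport_likelihoods_b₁ : PosOnSupport ch aux
    fun σ u z₁ _ _ => (likelihoods ch aux).b₁ u σ.1 z₁.1 z₁.2 := fun _ hω =>
  div_pos (law_pos (jointLaw_nonneg ch aux)
      (fun ω => (ω.2.2.2.2.2.2.1, ω.2.2.2.2.1, (ω.2.2.2.1, ω.1))) hω)
    (law_pos (jointLaw_nonneg ch aux) (fun ω => (ω.2.2.2.2.2.2.1, (ω.2.2.2.1, ω.1))) hω)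

theorem posOnSupport_likelihoods_b₂ : PosOnSupport ch aux
    fun σ u _ z₂ _ => (likelihoods ch aux).b₂ u σ.1 z₂.1 z₂.2 := fun _ hω =>
  div_pos (law_pos (jointLaw_nonneg ch aux)
      (fun ω => (ω.2.2.2.2.2.2.2.1, ω.2.2.2.2.2.1, (ω.2.2.2.1, ω.1))) hω)
    (law_pos (jointLaw_nonneg ch aux) (fun ω => (ω.2.2.2.2.2.2.2.1, (ω.2.2.2.1, ω.1))) hω)

theorem posOnSupport_likelihoods_b : PosOnSupport ch aux
    fun _ u z₁ z₂ y => (likelihoods ch aux).b y (u, z₁.2, z₂.2) := fun _ hω =>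
  div_pos (law_pos (jointLaw_nonneg ch aux)
      (fun ω => (ω.2.2.2.2.2.2.2.2, (ω.2.2.2.2.1, ω.2.2.2.2.2.1, ω.2.2.2.1))) hω)
    (law_pos (jointLaw_nonneg ch aux) (fun ω => ω.2.2.2.2.2.2.2.2) hω)

theorem sum_mul_ind_snd {α β : Type*} [Fintype α] [Fintype β] (q : α × β → ℝ) (v : β) :
    ∑ z, q z * ind (z.2 = v) = ∑ x, q (x, v) := by
  classical
  rw [Fintype.sum_prod_type]
  refine sum_congr rfl fun x _ => ?_
  simp [ind]

theorem ind_and (p q : Prop) : ind (p ∧ q) = ind p * ind q := by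
  by_cases hp : p <;> by_cases hq : q <;> simp [ind, hp, hq]

/-- `P(v₁,s₁,u,s₀) = P(v₁|u,s₀,s₁) P(s₁,u,s₀)`: the factors for encoder 2 and the output sum to `1`. -/
theorem law_V₁_S₁ (ω : 𝒮₀ × 𝒮₁ × 𝒮₂ × 𝒰 × 𝒱₁ × 𝒱₂ × 𝒳₁ × 𝒳₂ × 𝒴) :
    law (jointLaw ch aux) (fun ω => (ω.2.2.2.2.1, ω.2.1, (ω.2.2.2.1, ω.1)))
        (ω.2.2.2.2.1, ω.2.1, (ω.2.2.2.1, ω.1))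
      = (∑ x, aux.Q₁ ω.2.2.2.1 ω.1 ω.2.1 (x, ω.2.2.2.2.1)) *
        law (jointLaw ch aux) (fun ω => (ω.2.1, (ω.2.2.2.1, ω.1))) (ω.2.1, (ω.2.2.2.1, ω.1)) := by
  obtain ⟨s₀, s₁, s₂, u, v₁, v₂, x₁, x₂, y⟩ := ω
  simp only
  rw [law_eq_sum_ind, law_eq_sum_ind]
  have h1 := jointExp_eq_sum_onSample ch aux
    fun σ u' z₁ _ _ => ind ((z₁.2, σ.2.1, (u', σ.1)) = (v₁, s₁, (u, s₀)))
  have h2 := jointExp_eq_sum_onSample ch aux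
    fun σ u' _ _ _ => ind ((σ.2.1, (u', σ.1)) = (s₁, (u, s₀)))
  refine h1.symm.trans (Eq.trans ?_ (congrArg _ h2))
  simp only [jointExp, ← sum_mul, (ch.W_mem _ _ _ _ _).2, (aux.Q₂_mem _ _ _).2,
    (aux.Q₁_mem _ _ _).2, one_mul]
  simp only [mul_sum]
  refine sum_congr rfl fun σ _ => sum_congr rfl fun u' _ => ?_
  rw [mul_left_comm, mul_left_comm (∑ x, aux.Q₁ u s₀ s₁ (x, v₁))]
  by_cases h : (σ.2.1, (u', σ.1)) = (s₁, (u, s₀))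
  · obtain ⟨rfl, rfl, rfl⟩ : σ.2.1 = s₁ ∧ u' = u ∧ σ.1 = s₀ := by simpa using h
    rw [ind_of rfl, mul_one, ← sum_mul_ind_snd]
    simp [mul_sum]
  · rw [ind_of_not h, mul_zero, mul_zero, mul_zero]
    refine sum_eq_zero fun z _ => ?_
    rw [ind_of_not fun h' => h (Prod.mk.inj h').2, mul_zero, mul_zero, mul_zero]

theorem law_V₂_S₂ (ω : 𝒮₀ × 𝒮₁ × 𝒮₂ × 𝒰 × 𝒱₁ × 𝒱₂ × 𝒳₁ × 𝒳₂ × 𝒴) :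
    law (jointLaw ch aux) (fun ω => (ω.2.2.2.2.2.1, ω.2.2.1, (ω.2.2.2.1, ω.1)))
        (ω.2.2.2.2.2.1, ω.2.2.1, (ω.2.2.2.1, ω.1))
      = (∑ x, aux.Q₂ ω.2.2.2.1 ω.1 ω.2.2.1 (x, ω.2.2.2.2.2.1)) *
        law (jointLaw ch aux) (fun ω => (ω.2.2.1, (ω.2.2.2.1, ω.1))) (ω.2.2.1, (ω.2.2.2.1, ω.1)) := by
  obtain ⟨s₀, s₁, s₂, u, v₁, v₂, x₁, x₂, y⟩ := ω
  simp only
  rw [law_eq_sum_ind, law_eq_sum_ind]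
  have h1 := jointExp_eq_sum_onSample ch aux
    fun σ u' _ z₂ _ => ind ((z₂.2, σ.2.2, (u', σ.1)) = (v₂, s₂, (u, s₀)))
  have h2 := jointExp_eq_sum_onSample ch aux
    fun σ u' _ _ _ => ind ((σ.2.2, (u', σ.1)) = (s₂, (u, s₀)))
  refine h1.symm.trans (Eq.trans ?_ (congrArg _ h2))
  simp only [jointExp, ← sum_mul, (ch.W_mem _ _ _ _ _).2, (aux.Q₂_mem _ _ _).2,
    (aux.Q₁_mem _ _ _).2, one_mul]
  simp only [mul_sum]
  refine sum_congr rfl fun σ _ => sum_congr rfl fun u' _ => ?_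
  rw [mul_left_comm, mul_left_comm (∑ x, aux.Q₂ u s₀ s₂ (x, v₂))]
  by_cases h : (σ.2.2, (u', σ.1)) = (s₂, (u, s₀))
  · obtain ⟨rfl, rfl, rfl⟩ : σ.2.2 = s₂ ∧ u' = u ∧ σ.1 = s₀ := by simpa using h
    rw [ind_of rfl, mul_one, ← sum_mul_ind_snd]
    simp [mul_sum]
  · rw [ind_of_not h, mul_zero, mul_zero, mul_zero]
    refine sum_eq_zero fun z _ => ?_
    rw [ind_of_not fun h' => h (Prod.mk.inj h').2, mul_zero, mul_zero, mul_zero]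

/-- `P(u,v₁,v₂,s₀,s₁,s₂) = P(u|s₀) P(v₁|u,s₀,s₁) P(v₂|u,s₀,s₂) P(s₀,s₁,s₂)`. -/
theorem law_UV₁V₂_S (ω : 𝒮₀ × 𝒮₁ × 𝒮₂ × 𝒰 × 𝒱₁ × 𝒱₂ × 𝒳₁ × 𝒳₂ × 𝒴) :
    law (jointLaw ch aux)
        (fun ω => ((ω.2.2.2.1, ω.2.2.2.2.1, ω.2.2.2.2.2.1), (ω.1, ω.2.1, ω.2.2.1)))
        ((ω.2.2.2.1, ω.2.2.2.2.1, ω.2.2.2.2.2.1), (ω.1, ω.2.1, ω.2.2.1))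
      = aux.PU ω.1 ω.2.2.2.1 * (∑ x, aux.Q₁ ω.2.2.2.1 ω.1 ω.2.1 (x, ω.2.2.2.2.1)) *
        (∑ x, aux.Q₂ ω.2.2.2.1 ω.1 ω.2.2.1 (x, ω.2.2.2.2.2.1)) *
        law (jointLaw ch aux) (fun ω => (ω.1, ω.2.1, ω.2.2.1)) (ω.1, ω.2.1, ω.2.2.1) := by
  classical
  obtain ⟨s₀, s₁, s₂, u, v₁, v₂, x₁, x₂, y⟩ := ω
  simp only
  rw [law_eq_sum_ind, law_eq_sum_ind]
  have h1 := jointExp_eq_sum_onSample ch aux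
    fun σ u' z₁ z₂ _ => ind (((u', z₁.2, z₂.2), σ) = ((u, v₁, v₂), (s₀, s₁, s₂)))
  have h2 := jointExp_eq_sum_onSample ch aux fun σ _ _ _ _ => ind (σ = (s₀, s₁, s₂))
  refine h1.symm.trans (Eq.trans ?_ (congrArg _ h2))
  simp only [jointExp, ← sum_mul, (ch.W_mem _ _ _ _ _).2, (aux.Q₂_mem _ _ _).2,
    (aux.Q₁_mem _ _ _).2, (aux.PU_mem _).2, one_mul]
  rw [mul_sum]
  refine sum_congr rfl fun σ _ => ?_
  rw [mul_left_comm]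
  congr 1
  by_cases h : σ = (s₀, s₁, s₂)
  · subst h
    rw [ind_of rfl, mul_one, ← sum_mul_ind_snd (aux.Q₁ u s₀ s₁),
      ← sum_mul_ind_snd (aux.Q₂ u s₀ s₂), sum_eq_single u]
    · simp only [Prod.mk.injEq, true_and, and_true, ind_and]
      rw [mul_assoc, sum_mul_sum, sum_comm]
      congr 1
      refine sum_congr rfl fun z₂ _ => ?_
      rw [mul_sum]
      exact sum_congr rfl fun z₁ _ => by ring
    · intro u' _ hu
      simp [ind, hu]
    · simp
  · simp [ind, h]

theorem logb_div_sub_logb_div {a c d e g q : ℝ} (ha : 0 < a) (hc : 0 < c) (hd : 0 < d)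
    (he : 0 < e) (hg : 0 < g) (hq : 0 < q) :
    Real.logb 2 ((a / c) / ((d / c) * (e / c))) - Real.logb 2 ((q * g / c) / ((e / c) * (g / c)))
      = Real.logb 2 (a / d) - Real.logb 2 q := by
  rw [← Real.logb_div (by positivity) (by positivity), ← Real.logb_div (by positivity) hq.ne']
  congr 1
  field_simp

theorem logb_div_mul_sub {a d e g q q₁ q₂ : ℝ} (ha : 0 < a) (hd : 0 < d) (he : 0 < e)
    (hg : 0 < g) (hq : 0 < q) (hq₁ : 0 < q₁) (hq₂ : 0 < q₂) :
    Real.logb 2 (a / (d * e)) - Real.logb 2 (q * q₁ * q₂ * g / (e * g))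
      = Real.logb 2 (a / d) - Real.logb 2 q - Real.logb 2 q₁ - Real.logb 2 q₂ := by
  rw [← Real.logb_div (by positivity) (by positivity), ← Real.logb_div (by positivity) hq.ne',
    ← Real.logb_div (by positivity) hq₁.ne', ← Real.logb_div (by positivity) hq₂.ne']
  congr 1
  field_simp

/-- Both conditional mutual informations contain the entropy `H(V₁|U,S₀)`, which cancels. There
remain the expectations of `log₂ P(v₁|x₁,u,s₀)` and of `log₂ P(v₁|u,s₀,s₁)`. -/
theorem condMutualInfo_sub_eq₁ :
    condMutualInfo (jointLaw ch aux)
        (fun (_, _, _, _, _, _, x₁, _, _) => x₁) (fun (_, _, _, _, v₁, _, _, _, _) => v₁)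
        (fun (s₀, _, _, u, _, _, _, _, _) => (u, s₀))
      - condMutualInfo (jointLaw ch aux)
        (fun (_, _, _, _, v₁, _, _, _, _) => v₁) (fun (_, s₁, _, _, _, _, _, _, _) => s₁)
        (fun (s₀, _, _, u, _, _, _, _, _) => (u, s₀))
      = logMean ch aux (fun σ u z₁ _ _ => (likelihoods ch aux).b₁ u σ.1 z₁.1 z₁.2)
        - logMean ch aux fun σ u z₁ _ _ => ∑ x, aux.Q₁ u σ.1 σ.2.1 (x, z₁.2) := by
  simp only [condMutualInfo, logMean, ← sum_sub_distrib, ← mul_sub]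
  refine sum_congr rfl fun ω _ => ?_
  by_cases hω : jointLaw ch aux ω = 0
  · simp [hω]
  congr 1
  have hp := jointLaw_nonneg ch aux
  have h := logb_div_sub_logb_div
    (law_pos hp (fun ω => (ω.2.2.2.2.2.2.1, ω.2.2.2.2.1, (ω.2.2.2.1, ω.1))) hω)
    (law_pos hp (fun ω => (ω.2.2.2.1, ω.1)) hω)
    (law_pos hp (fun ω => (ω.2.2.2.2.2.2.1, (ω.2.2.2.1, ω.1))) hω)
    (law_pos hp (fun ω => (ω.2.2.2.2.1, (ω.2.2.2.1, ω.1))) hω)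
    (law_pos hp (fun ω => (ω.2.1, (ω.2.2.2.1, ω.1))) hω)
    (posOnSupport_Q₁ ch aux ω hω)
  simp only [onSample] at h
  rw [← law_V₁_S₁] at h
  exact h

theorem condMutualInfo_sub_eq₂ :
    condMutualInfo (jointLaw ch aux)
        (fun (_, _, _, _, _, _, _, x₂, _) => x₂) (fun (_, _, _, _, _, v₂, _, _, _) => v₂)
        (fun (s₀, _, _, u, _, _, _, _, _) => (u, s₀))
      - condMutualInfo (jointLaw ch aux)
        (fun (_, _, _, _, _, v₂, _, _, _) => v₂) (fun (_, _, s₂, _, _, _, _, _, _) => s₂)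
        (fun (s₀, _, _, u, _, _, _, _, _) => (u, s₀))
      = logMean ch aux (fun σ u _ z₂ _ => (likelihoods ch aux).b₂ u σ.1 z₂.1 z₂.2)
        - logMean ch aux fun σ u _ z₂ _ => ∑ x, aux.Q₂ u σ.1 σ.2.2 (x, z₂.2) := by
  simp only [condMutualInfo, logMean, ← sum_sub_distrib, ← mul_sub]
  refine sum_congr rfl fun ω _ => ?_
  by_cases hω : jointLaw ch aux ω = 0
  · simp [hω]
  congr 1
  have hp := jointLaw_nonneg ch aux
  have h := logb_div_sub_logb_div
    (law_pos hp (fun ω => (ω.2.2.2.2.2.2.2.1, ω.2.2.2.2.2.1, (ω.2.2.2.1, ω.1))) hω)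
    (law_pos hp (fun ω => (ω.2.2.2.1, ω.1)) hω)
    (law_pos hp (fun ω => (ω.2.2.2.2.2.2.2.1, (ω.2.2.2.1, ω.1))) hω)
    (law_pos hp (fun ω => (ω.2.2.2.2.2.1, (ω.2.2.2.1, ω.1))) hω)
    (law_pos hp (fun ω => (ω.2.2.1, (ω.2.2.2.1, ω.1))) hω)
    (posOnSupport_Q₂ ch aux ω hω)
  simp only [onSample] at h
  rw [← law_V₂_S₂] at h
  exact h

/-- Both mutual informations contain the entropy of `(U,V₁,V₂)`, which cancels. -/
theorem mutualInfo_sub_eq :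
    mutualInfo (jointLaw ch aux)
        (fun (_, _, _, _, _, _, _, _, y) => y)
        (fun (_, _, _, u, v₁, v₂, _, _, _) => (v₁, v₂, u))
      - mutualInfo (jointLaw ch aux)
        (fun (_, _, _, u, v₁, v₂, _, _, _) => (u, v₁, v₂))
        (fun (s₀, s₁, s₂, _, _, _, _, _, _) => (s₀, s₁, s₂))
      = logMean ch aux (fun _ u z₁ z₂ y => (likelihoods ch aux).b y (u, z₁.2, z₂.2))
        - logMean ch aux (fun σ u _ _ _ => aux.PU σ.1 u)
        - logMean ch aux (fun σ u z₁ _ _ => ∑ x, aux.Q₁ u σ.1 σ.2.1 (x, z₁.2))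
        - logMean ch aux fun σ u _ z₂ _ => ∑ x, aux.Q₂ u σ.1 σ.2.2 (x, z₂.2) := by
  simp only [mutualInfo, logMean, ← sum_sub_distrib, ← mul_sub]
  refine sum_congr rfl fun ω _ => ?_
  by_cases hω : jointLaw ch aux ω = 0
  · simp [hω]
  congr 1
  have hp := jointLaw_nonneg ch aux
  have ha := law_pos hp
    (fun ω => (ω.2.2.2.2.2.2.2.2, (ω.2.2.2.2.1, ω.2.2.2.2.2.1, ω.2.2.2.1))) hω
  have hd := law_pos hp (fun ω => ω.2.2.2.2.2.2.2.2) hω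
  have he := law_pos hp (fun ω => (ω.2.2.2.1, ω.2.2.2.2.1, ω.2.2.2.2.2.1)) hω
  have hg := law_pos hp (fun ω => (ω.1, ω.2.1, ω.2.2.1)) hω
  have hu := posOnSupport_PU ch aux ω hω
  have hq₁ := posOnSupport_Q₁ ch aux ω hω
  have hq₂ := posOnSupport_Q₂ ch aux ω hω
  have hperm : law (jointLaw ch aux) (fun ω => (ω.2.2.2.2.1, ω.2.2.2.2.2.1, ω.2.2.2.1))
      (ω.2.2.2.2.1, ω.2.2.2.2.2.1, ω.2.2.2.1) = law (jointLaw ch aux)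
      (fun ω => (ω.2.2.2.1, ω.2.2.2.2.1, ω.2.2.2.2.2.1))
      (ω.2.2.2.1, ω.2.2.2.2.1, ω.2.2.2.2.2.1) :=
    law_congr fun ω' => by simp only [Prod.mk.injEq]; tauto
  have h := logb_div_mul_sub ha hd he hg hu hq₁ hq₂
  simp only [onSample] at h
  rw [← law_UV₁V₂_S, ← hperm] at h
  nth_rw 2 [hperm] at h
  exact h

/-- Scaling by `θ < 1` makes the inequalities strict, except for a rate `0`, which needs none. -/
theorem achievable_smul {R : ℝ × ℝ} (hR : R ∈ ratesFor ch aux) {θ : ℝ}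
    (hθ : 0 ≤ θ) (hθ1 : θ < 1) : Achievable ch (θ • R) := by
  have : Nonempty 𝒮₀ := nonempty_of_mem_stdSimplex ch.P₀_mem
  have : Nonempty 𝒮₁ := nonempty_of_mem_stdSimplex ch.P₁_mem
  have : Nonempty 𝒮₂ := nonempty_of_mem_stdSimplex ch.P₂_mem
  let s₀ : 𝒮₀ := Classical.arbitrary _
  have : Nonempty 𝒰 := nonempty_of_mem_stdSimplex (aux.PU_mem s₀)
  obtain ⟨h𝒳₁, h𝒱₁⟩ := nonempty_prod.1 (nonempty_of_mem_stdSimplex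
    (aux.Q₁_mem (Classical.arbitrary _) s₀ (Classical.arbitrary _)))
  obtain ⟨h𝒳₂, h𝒱₂⟩ := nonempty_prod.1 (nonempty_of_mem_stdSimplex
    (aux.Q₂_mem (Classical.arbitrary _) s₀ (Classical.arbitrary _)))
  rcases eq_or_ne R 0 with rfl | hne
  · rw [smul_zero]
    exact achievable_zero ch
  obtain ⟨h1, h2, h3, h4, h5⟩ := hR
  rw [condMutualInfo_sub_eq₁] at h3
  rw [condMutualInfo_sub_eq₂] at h4
  rw [mutualInfo_sub_eq] at h5
  have lt : ∀ {x : ℝ}, 0 ≤ x → x = 0 ∨ θ * x < x := fun {x} hx => by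
    rcases hx.eq_or_lt with h | h
    · exact Or.inl h.symm
    · exact Or.inr (by nlinarith)
  have hsum : θ * R.1 + θ * R.2 < R.1 + R.2 := by
    rw [← mul_add]
    rcases lt (add_nonneg h1 h2) with h | h
    · exact absurd (Prod.ext (by simp; linarith) (by simp; linarith)) hne
    · exact h
  refine achievable_of_lt ch aux (likelihoods ch aux) (posOnSupport_likelihoods_b₁ ch aux)
    (posOnSupport_likelihoods_b₂ ch aux) (posOnSupport_likelihoods_b ch aux)
    (mul_nonneg hθ h1) (mul_nonneg hθ h2) ?_ ?_ ?_
  · rcases lt h1 with h | h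
    · exact Or.inl (by simp [h])
    · refine Or.inr ?_
      simp only [Prod.smul_fst, smul_eq_mul]
      linarith
  · rcases lt h2 with h | h
    · exact Or.inl (by simp [h])
    · refine Or.inr ?_
      simp only [Prod.smul_snd, smul_eq_mul]
      linarith
  · simp only [Prod.smul_fst, Prod.smul_snd, smul_eq_mul]
    linarith

end Region

end CoopMAC


theorem theorem2 {𝒳₁ 𝒳₂ 𝒮₀ 𝒮₁ 𝒮₂ 𝒴 : Type*} [Fintype 𝒳₁] [Fintype 𝒳₂]
    [Fintype 𝒮₀] [Fintype 𝒮₁] [Fintype 𝒮₂] [Fintype 𝒴]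
    (ch : CoopMAC.Channel 𝒳₁ 𝒳₂ 𝒮₀ 𝒮₁ 𝒮₂ 𝒴) :
    CoopMAC.rateRegion ch ⊆ CoopMAC.capacityRegion ch := by
  rintro R ⟨𝒰, 𝒱₁, 𝒱₂, _, _, _, aux, hR⟩
  -- the scaled pairs `(1 - 1 / (n + 1)) • R` obey the strict inequalities and tend to `R`
  have hlim : Tendsto (fun n : ℕ => (1 - 1 / ((n : ℝ) + 1)) • R) atTop (𝓝 R) := by
    simpa using ((tendsto_one_div_add_atTop_nhds_zero_nat (𝕜 := ℝ)).const_sub 1).smul_const R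
  refine mem_closure_of_tendsto hlim (Eventually.of_forall fun n => ?_)
  exact CoopMAC.achievable_smul ch aux hR
    (by rw [sub_nonneg, div_le_one (by positivity)]; linarith [Nat.cast_nonneg (α := ℝ) n])
    (sub_lt_self _ (by positivity))
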